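/- **Setting.** Let $c>0$, and let $S\subset\mathbb C$ be a set of spectral parameters with $\lambda-\mu\neq ic$ for all $\lambda,\mu\in S$ (for example $S=\mathbb R$). For $\lambda,\mu\in S$ put $$\xi(\lambda,\mu)=\frac{2ic}{c^2+(\lambda-\mu)^2},\quad \tilde\xi(\lambda,\mu)=\frac{2(\lambda-\mu)}{(\lambda-\mu)^2+c^2},\quad \eta(\lambda,\mu)=\frac1{(\lambda-\mu+ic)^2}+\frac1{(\lambda-\mu-ic)^2}.$$ Consider the Bose fields $\psi'(\lambda)=q'_\psi(\lambda)+p'_\psi(\lambda)$, $\phi(\lambda)=q_\phi(\lambda)+p_\phi(\lambda)$, $\Phi(\lambda)=q_\Phi(\lambda)+p_\Phi(\lambda)$ in the Fock space with vacuum $|0)$ and dual vacuum $(0|$, where $p|0)=0$, $(0|q=0$ for all annihilation operators $p$ and creation operators $q$, $(0|0)=1$, and the only non-zero commutators are $$[p'_\psi(\lambda),q_\phi(\mu)]=[p_\phi(\lambda),q'_\psi(\mu)]=\xi(\lambda,\mu),\quad [p'_\psi(\lambda),q_\Phi(\mu)]=[p_\Phi(\mu),q'_\psi(\lambda)]=\tilde\xi(\lambda,\mu),\quad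 [p'_\psi(\lambda),q'_\psi(\mu)]=\eta(\lambda,\mu).$$ The Fock space is realised by functionals $G(u,v,w)$ of three functions $u,v,w:S\to\mathbb C$: $q_\phi(\mu),q_\Phi(\mu),q'_\psi(\mu)$ multiply by $u(\mu),v(\mu),w(\mu)$; the annihilation operators are the directional derivatives prescribed by the commutators; $|0)=1$; $(0|G=G(0,0,0)$. A functional $F$ of the fields gives the vector $F([\phi],[\Phi])|0)=F(u,v)$. A function $f(\phi(\lambda))$ of the field is the Taylor series of $f$ at $0$ in the operator $\phi(\lambda)$, and $(0|\exp\{X\}F|0)$ means $\sum_{n\ge0}\frac1{n!}(0|X^nF|0)$. Let $N\ge0$, $\lambda_1,\dots,\lambda_N\in S$, let $f_k$ be holomorphic in $|x|<r_k$, and let $F$ be a functional such that $z\mapsto F\bigl(\sum_m z_m\xi(\lambda_m,\cdot),\sum_m z_m\tilde\xi(\lambda_m,\cdot)\bigr)$ is holomorphic on an open balanced set $D\subset\mathbb C^N$. For functions $g_1,\dots,g_N$ consider the system $$z_j=g_j\Bigl(\sum_m z_m\xi(\lambda_m,\lambda_j)\Bigr),\qquad j=1,\dots,N,\tag{1}$$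 and the matrix $$M_{jk}(g,z)=\delta_{jk}-\frac{\partial}{\partial z_j}g_k\Bigl(\sum_m z_m\xi(\lambda_m,\lambda_k)\Bigr).$$ **(i)** Let $\rho_1,\dots,\rho_N>0$ be such that $\sum_m\rho_m|\xi(\lambda_m,\lambda_k)|<r_k$ for all $k$, the closed polydisc $\{|z_k|\le\rho_k\}$ lies in $D$, and $$\Bigl|f_j\Bigl(\sum_m z_m\xi(\lambda_m,\lambda_j)\Bigr)\Bigr|<|z_j|\quad\text{for all } j \text{ whenever } |z_k|=\rho_k \text{ for all } k.$$ Then the system (1) with $g=f$ has exactly one solution $z^0$ in the closed polydisc; it satisfies $|z^0_k|<\rho_k$ and $\det M(f,z^0)\ne0$; the series defining both mean values below converge absolutely, and $$(0|\exp\Bigl\{\sum_{k}\psi'(\lambda_k)f_k(\phi(\lambda_k))\Bigr\}F([\phi],[\Phi])|0)=\frac{(0|\exp\bigl\{\sum_{k}\psi'(\lambda_k)z_k^0\bigr\}F([\phi],[\Phi])|0)}{\det M(f,z^0)}.$$ **(ii)** (Continuation in $\alpha$ after the replacement $f_k\to\alpha f_k$.) Let $U\subset\mathbb C$ be open and connected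 with $0\in U$, and let $z:U\to\mathbb C^N$ be continuous with $z(0)=0$ such that for all $\alpha\in U$: $z(\alpha)\in D$, $\bigl|\sum_m z_m(\alpha)\xi(\lambda_m,\lambda_k)\bigr|<r_k$ for all $k$, $z(\alpha)$ solves (1) with $g=\alpha f$, and $\det M(\alpha f,z(\alpha))\neq0$. Then there is a holomorphic function $A$ on $U$ such that * for all $\alpha$ near $0$, the series for $(0|\exp\{\sum_k\psi'(\lambda_k)\alpha f_k(\phi(\lambda_k))\}F|0)$ converges absolutely and its sum is $A(\alpha)$; * the same mean value equals $A(\alpha)$ for every $\alpha$ such that the segment $[0,\alpha]$ lies in $U$ and the series converges absolutely at $\alpha$ (in particular for $\alpha=1$ if $[0,1]\subset U$); * for every $\alpha\in U$ the series for $(0|\exp\{\sum_k\psi'(\lambda_k)z_k(\alpha)\}F|0)$ converges absolutely and $$A(\alpha)=\frac{(0|\exp\{\sum_k\psi'(\lambda_k)z_k(\alpha)\}F([\phi],[\Phi])|0)}{\det M(\alpha f,z(\alpha))}.$$ -/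

import Mathlib

open scoped Nat

noncomputable section

namespace DualFields

/-- `ξ(λ,μ) = 2ic / (c² + (λ-μ)²)`. -/
def xi (c : ℝ) (l m : ℂ) : ℂ := 2 * Complex.I * c / ((c : ℂ) ^ 2 + (l - m) ^ 2)

/-- `ξ̃(λ,μ) = 2(λ-μ) / ((λ-μ)² + c²)`. -/
def xiT (c : ℝ) (l m : ℂ) : ℂ := 2 * (l - m) / ((l - m) ^ 2 + (c : ℂ) ^ 2)

/-- `η(λ,μ) = (λ-μ+ic)⁻² + (λ-μ-ic)⁻²`. -/
def eta (c : ℝ) (l m : ℂ) : ℂ :=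
  (1 / (l - m + Complex.I * c)) ^ 2 + (1 / (l - m - Complex.I * c)) ^ 2

/-- Classical configurations `(u, v, w)` of the creation fields `(q_φ, q_Φ, q'_ψ)` on the set `S` of
spectral parameters. -/
abbrev Config (S : Set ℂ) : Type := (S → ℂ) × (S → ℂ) × (S → ℂ)

/-- Vectors of the auxiliary Fock space in the holomorphic (Bargmann) representation: functionals of
the classical creation fields. The creation operator `q(μ)` multiplies by the value at `μ` of the
corresponding classical field; an annihilation operator is a directional derivative. -/
abbrev Ket (S : Set ℂ) : Type := Config S → ℂ

/-- Annihilation operator: derivative of the functional in the direction `d`. -/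
def ann {S : Set ℂ} (d : Config S) (G : Ket S) : Ket S := fun e => lineDeriv ℂ G e d

/-- Creation operator: multiplication by a linear coordinate of the configuration. -/
def cre {S : Set ℂ} (a : Config S →ₗ[ℂ] ℂ) (G : Ket S) : Ket S := fun e => a e * G e

/-- The coordinates `u(μ)`, `v(μ)`, `w(μ)`. -/
def coordU {S : Set ℂ} (m : S) : Config S →ₗ[ℂ] ℂ :=
  LinearMap.proj m ∘ₗ LinearMap.fst ℂ _ _
def coordV {S : Set ℂ} (m : S) : Config S →ₗ[ℂ] ℂ :=
  LinearMap.proj m ∘ₗ LinearMap.fst ℂ _ _ ∘ₗ LinearMap.snd ℂ _ _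
def coordW {S : Set ℂ} (m : S) : Config S →ₗ[ℂ] ℂ :=
  LinearMap.proj m ∘ₗ LinearMap.snd ℂ _ _ ∘ₗ LinearMap.snd ℂ _ _

/-- Direction of `p'_ψ(λ)`: its entries are the commutators of `p'_ψ(λ)` with
`q_φ(μ)`, `q_Φ(μ)`, `q'_ψ(μ)`, namely `ξ(λ,μ)`, `ξ̃(λ,μ)`, `η(λ,μ)`. -/
def dirPsi {S : Set ℂ} (c : ℝ) (l : S) : Config S :=
  (fun m => xi c l m, fun m => xiT c l m, fun m => eta c l m)

/-- Direction of `p_φ(λ)`: the only nonzero commutator is `[p_φ(λ), q'_ψ(μ)] = ξ(λ,μ)`. -/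
def dirPhi {S : Set ℂ} (c : ℝ) (l : S) : Config S := (0, 0, fun m => xi c l m)

/-- Direction of `p_Φ(λ)`: the only nonzero commutator is
`[p_Φ(λ), q'_ψ(μ)] = 2(μ-λ)/((λ-μ)²+c²) = ξ̃(μ,λ)`. -/
def dirPhiBig {S : Set ℂ} (c : ℝ) (l : S) : Config S := (0, 0, fun m => xiT c m l)

/-- The field `ψ'(λ) = q'_ψ(λ) + p'_ψ(λ)`. -/
def psiD {S : Set ℂ} (c : ℝ) (l : S) (G : Ket S) : Ket S :=
  cre (coordW l) G + ann (dirPsi c l) G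

/-- The field `φ(λ) = q_φ(λ) + p_φ(λ)`. -/
def phi {S : Set ℂ} (c : ℝ) (l : S) (G : Ket S) : Ket S :=
  cre (coordU l) G + ann (dirPhi c l) G

/-- The field `Φ(λ) = q_Φ(λ) + p_Φ(λ)`. -/
def phiBig {S : Set ℂ} (c : ℝ) (l : S) (G : Ket S) : Ket S :=
  cre (coordV l) G + ann (dirPhiBig c l) G

/-- The vacuum `|0)`. -/
def vac {S : Set ℂ} : Ket S := fun _ => 1

/-- The dual vacuum `(0|`: evaluation at the zero configuration. -/
def dualVac {S : Set ℂ} (G : Ket S) : ℂ := G 0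

/-- The vector `F([φ],[Φ])|0) = F([q_φ],[q_Φ])|0)`. See `phi_functionalKet` and
`phiBig_functionalKet`: multiplying `F` by a field value is the action of the field. -/
def functionalKet {S : Set ℂ} (F : (S → ℂ) → (S → ℂ) → ℂ) : Ket S := fun e => F e.1 e.2.1

theorem ann_vac {S : Set ℂ} (d : Config S) : ann d vac = 0 := by
  ext e; simp [ann, vac, lineDeriv]

theorem dualVac_cre {S : Set ℂ} (a : Config S →ₗ[ℂ] ℂ) (G : Ket S) : dualVac (cre a G) = 0 := by
  simp [dualVac, cre]

theorem dualVac_vac {S : Set ℂ} : dualVac (vac : Ket S) = 1 := rfl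

/-- Canonical commutation relations: `[p, q]` is the coordinate of the direction of `p`. -/
theorem ann_cre {S : Set ℂ} (d : Config S) (a : Config S →ₗ[ℂ] ℂ) (G : Ket S) (e : Config S)
    (hG : LineDifferentiableAt ℂ G e d) :
    ann d (cre a G) e - cre a (ann d G) e = a d * G e := by
  have h1 : HasDerivAt (fun t : ℂ => a (e + t • d)) (a d) 0 := by
    have : (fun t : ℂ => a (e + t • d)) = fun t => a e + t * a d := by
      ext t; simp
    rw [this]
    simpa using ((hasDerivAt_id (0 : ℂ)).mul_const (a d)).const_add (a e)
  have h2 : HasDerivAt (fun t : ℂ => G (e + t • d)) (lineDeriv ℂ G e d) 0 := hG.hasLineDerivAt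
  have h4 : ann d (cre a G) e = a d * G e + a e * lineDeriv ℂ G e d := by
    refine (HasDerivAt.deriv (h1.mul h2)).trans ?_
    simp
  rw [h4]; simp [cre, ann]

theorem phi_functionalKet {S : Set ℂ} (c : ℝ) (m : S) (F : (S → ℂ) → (S → ℂ) → ℂ) :
    phi c m (functionalKet F) = functionalKet (fun u v => u m * F u v) := by
  ext e; simp [phi, cre, ann, coordU, dirPhi, functionalKet, lineDeriv]

theorem phiBig_functionalKet {S : Set ℂ} (c : ℝ) (m : S) (F : (S → ℂ) → (S → ℂ) → ℂ) :
    phiBig c m (functionalKet F) = functionalKet (fun u v => v m * F u v) := by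
  ext e; simp [phiBig, cre, ann, coordV, dirPhiBig, functionalKet, lineDeriv]

/-- `f(A)` for an operator `A`, as the Taylor series of `f` at `0`. -/
def taylorOp {S : Set ℂ} (f : ℂ → ℂ) (A : Ket S → Ket S) (G : Ket S) : Ket S :=
  fun e => ∑' n : ℕ, iteratedDeriv n f 0 / (n ! : ℂ) * (A^[n] G) e

/-- The operator `∑ₖ ψ'(λₖ) fₖ(φ(λₖ))`. -/
def fieldExponent {S : Set ℂ} {N : ℕ} (c : ℝ) (lam : Fin N → S) (f : Fin N → ℂ → ℂ)
    (G : Ket S) : Ket S :=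
  fun e => ∑ k, psiD c (lam k) (taylorOp (f k) (phi c (lam k)) G) e

/-- The operator `∑ₖ ψ'(λₖ) zₖ` with complex numbers `zₖ`. -/
def numberExponent {S : Set ℂ} {N : ℕ} (c : ℝ) (lam : Fin N → S) (z : Fin N → ℂ)
    (G : Ket S) : Ket S :=
  fun e => ∑ k, z k * psiD c (lam k) G e

/-- The `n`-th term `(0| Xⁿ G / n!` of the Taylor series of `(0| exp{X} G`. -/
def expTerm {S : Set ℂ} (X : Ket S → Ket S) (G : Ket S) (n : ℕ) : ℂ :=
  dualVac (X^[n] G) / (n ! : ℂ)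

/-- The mean value `(0| exp{X} G`. -/
def expMean {S : Set ℂ} (X : Ket S → Ket S) (G : Ket S) : ℂ := ∑' n, expTerm X G n

/-- `∑ₘ zₘ ξ(λₘ, μ)`. -/
def xiSum {S : Set ℂ} {N : ℕ} (c : ℝ) (lam : Fin N → S) (z : Fin N → ℂ) (m : S) : ℂ :=
  ∑ k, z k * xi c (lam k) m

/-- `∑ₘ zₘ ξ̃(λₘ, μ)`. -/
def xiTSum {S : Set ℂ} {N : ℕ} (c : ℝ) (lam : Fin N → S) (z : Fin N → ℂ) (m : S) : ℂ :=
  ∑ k, z k * xiT c (lam k) m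

/-- The system `z_j = f_j(∑ₘ zₘ ξ(λₘ, λ_j))`. -/
def SolvesSystem {S : Set ℂ} {N : ℕ} (c : ℝ) (lam : Fin N → S) (f : Fin N → ℂ → ℂ)
    (z : Fin N → ℂ) : Prop :=
  ∀ j, z j = f j (xiSum c lam z (lam j))

/-- `M_{jk} = δ_{jk} - ∂/∂z_j f_k(∑ₘ zₘ ξ(λₘ, λ_k))`. -/
def matM {S : Set ℂ} {N : ℕ} (c : ℝ) (lam : Fin N → S) (f : Fin N → ℂ → ℂ)
    (z : Fin N → ℂ) : Matrix (Fin N) (Fin N) ℂ :=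
  Matrix.of fun j k => (if j = k then 1 else 0) -
    deriv (fun t : ℂ => f k (xiSum c lam (Function.update z j t) (lam k))) (z j)

end DualFields

end

open scoped Nat

noncomputable section

/-! Only finitely many directions matter. On the configurations `conf (z, s)`, conjugation by the
exponential of the quadratic form `phase` turns `ψ'(λ_k)` into `∂/∂z_k` and `φ(λ_k)` into `∂/∂s_k`.
The phase is linear in `s`, the coefficient of `s_k` being `∑ z_m ξ(λ_m, λ_k)`, and the two kinds of
derivatives commute. Hence `f_k(φ(λ_k))` becomes multiplication by `g_k(z) = f_k(∑ z_m ξ(λ_m, λ_k))`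
underneath all `z`-derivatives already taken. The `n`-th term of the mean value is therefore `∑_{|m|
= n} [z^m] g^m K` with `K(z) = exp(½ ∑ z_j z_k η) F` (`expTerm_fieldExponent_of_represents`), and
`K(z)` is also the mean value with numbers `z_k` in place of the operators
(`hasSum_expTerm_numberExponent`).

What remains is the Lagrange–Good formula `Λ(K) = K(z⁰) / det M(z⁰)` for `Λ(K) = ∑_m [z^m] g^m K`.
An index shift gives `Λ(z_j K) = Λ(g_j K)`, and a coefficient identity gives `Λ(det(δ_jk - ∂_j g_k))
= 1` (`hasSum_lagrangeTerm_det`). When the derivatives of `g` are small, the first relation forces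
`z_j - z⁰_j` into the largest ideal killed by `Λ`. Modulo that ideal every function involved equals
its value at `z⁰`, so `det M(z⁰) Λ(K) = K(z⁰)` (`det_matM_mul_lagrangeSum`).

This settles small `α`. For the rest, a continuous solution branch with `det M ≠ 0` is holomorphic
by the implicit function theorem, and the mean value is a power series in `α`, so the identity
theorem and Abel's limit carry the formula along segments (`continuation`). On a polydisc as in (i),
the maximum principle makes the system strictly contracting with a factor `θ < 1`. A continuity
argument then gives exactly one solution for each `|α| < 1/θ`, a disc that contains `α = 1`
(`exists_unique_branch`). -/

namespace DualFields

/-! ### Taylor expansion along commuting derivations as an algebra homomorphism. -/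

section CommutingDerivations

variable {N : ℕ} {R : Type*} [CommRing R] [Algebra ℂ R]

/-- The differential monomial `∏ᵢ Dᵢ ^ mᵢ`, with the factors in increasing order. -/
def diffMonomial (D : Fin N → Derivation ℂ R R) (m : Fin N →₀ ℕ) : Module.End ℂ R :=
  ((List.finRange N).map fun i => (D i : R →ₗ[ℂ] R) ^ m i).prod

theorem diffMonomial_zero (D : Fin N → Derivation ℂ R R) : diffMonomial D 0 = 1 := by
  simp [diffMonomial]

theorem commute_of_comm {D : Fin N → Derivation ℂ R R}
    (hD : ∀ i j a, D i (D j a) = D j (D i a)) (i j : Fin N) :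
    Commute (D i : Module.End ℂ R) (D j : Module.End ℂ R) := by
  ext a
  exact hD i j a

theorem diffMonomial_add_single {D : Fin N → Derivation ℂ R R}
    (hD : ∀ i j a, D i (D j a) = D j (D i a)) (m : Fin N →₀ ℕ) (j : Fin N) :
    diffMonomial D (m + Finsupp.single j 1) = (D j : Module.End ℂ R) * diffMonomial D m := by
  -- The induction runs over arbitrary duplicate-free lists; the conditional factor records whether
  -- the place of `j` has been passed.
  have key : ∀ l : List (Fin N), l.Nodup →
      (l.map fun i => (D i : Module.End ℂ R) ^ (m + Finsupp.single j 1 : Fin N →₀ ℕ) i).prod =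
        (if j ∈ l then (D j : Module.End ℂ R) else 1) *
          (l.map fun i => (D i : Module.End ℂ R) ^ m i).prod := by
    intro l
    induction l with
    | nil => simp
    | cons a l ih =>
      intro hl
      rw [List.nodup_cons] at hl
      rw [List.map_cons, List.prod_cons, ih hl.2, List.map_cons, List.prod_cons]
      by_cases haj : a = j
      · subst haj
        simp [hl.1, pow_succ', mul_assoc]
      · have h1 : (m + Finsupp.single j 1 : Fin N →₀ ℕ) a = m a := by
          simp [Ne.symm haj]
        have h2 : (j ∈ a :: l) = (j ∈ l) := by simp [Ne.symm haj]
        rw [h1]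
        simp only [h2]
        split_ifs
        · rw [← mul_assoc, ← mul_assoc, ((commute_of_comm hD a j).pow_left _).eq]
        · simp
  have := key (List.finRange N) (List.nodup_finRange N)
  simpa [diffMonomial] using this

theorem diffMonomial_apply_comm {D : Fin N → Derivation ℂ R R}
    (hD : ∀ i j a, D i (D j a) = D j (D i a)) (m : Fin N →₀ ℕ) (j : Fin N) (a : R) :
    diffMonomial D m (D j a) = D j (diffMonomial D m a) := by
  have : Commute (D j : Module.End ℂ R) (diffMonomial D m) := by
    refine Commute.list_prod_right _ _ fun x hx => ?_
    obtain ⟨i, -, rfl⟩ := List.mem_map.1 hx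
    exact (commute_of_comm hD j i).pow_right _
  exact (LinearMap.congr_fun this.eq a).symm

theorem exists_eq_add_single_of_ne_zero {m : Fin N →₀ ℕ} (hm : m ≠ 0) :
    ∃ j m', m = m' + Finsupp.single j 1 := by
  obtain ⟨j, hj⟩ := Finsupp.ne_iff.1 hm
  refine ⟨j, m - Finsupp.single j 1, ?_⟩
  rw [tsub_add_cancel_of_le]
  simpa [Finsupp.single_le_iff, Nat.one_le_iff_ne_zero] using hj

theorem multiIndex_induction {p : (Fin N →₀ ℕ) → Prop} (h0 : p 0)
    (h1 : ∀ m j, p m → p (m + Finsupp.single j 1)) (m : Fin N →₀ ℕ) : p m := by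
  induction hn : m.degree generalizing m with
  | zero =>
    rw [Finsupp.degree_eq_zero_iff] at hn
    exact hn ▸ h0
  | succ n ih =>
    have hm : m ≠ 0 := by
      rintro rfl
      simp at hn
    obtain ⟨j, m', rfl⟩ := exists_eq_add_single_of_ne_zero hm
    refine h1 _ _ (ih _ ?_)
    simpa using hn

/-- The factorial `∏ᵢ mᵢ!` of a multi-index, as a complex number. -/
def multiFactorial (m : Fin N →₀ ℕ) : ℂ := ∏ i, ((m i)! : ℂ)

theorem multiFactorial_zero : multiFactorial (0 : Fin N →₀ ℕ) = 1 := by simp [multiFactorial]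

theorem multiFactorial_ne_zero (m : Fin N →₀ ℕ) : multiFactorial m ≠ 0 :=
  Finset.prod_ne_zero_iff.2 fun i _ => by exact_mod_cast (Nat.factorial_ne_zero _)

theorem multiFactorial_add_single (m : Fin N →₀ ℕ) (j : Fin N) :
    multiFactorial (m + Finsupp.single j 1) = (m j + 1) * multiFactorial m := by
  have : ∀ i, (((m + Finsupp.single j 1 : Fin N →₀ ℕ) i)! : ℂ) =
      (if i = j then (m j + 1 : ℂ) else 1) * ((m i)! : ℂ) := by
    intro i
    by_cases h : i = j
    · subst h; simp [Nat.factorial_succ]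
    · simp [h]
  simp only [multiFactorial, this, Finset.prod_mul_distrib]
  simp

/-- The Taylor series of `a` with respect to the commuting derivations `D`, at the character
`ev`. -/
def taylor (D : Fin N → Derivation ℂ R R) (ev : R →ₐ[ℂ] ℂ) (a : R) : MvPowerSeries (Fin N) ℂ :=
  fun m => ev (diffMonomial D m a) / multiFactorial m

theorem coeff_taylor (D : Fin N → Derivation ℂ R R) (ev : R →ₐ[ℂ] ℂ) (a : R) (m : Fin N →₀ ℕ) :
    MvPowerSeries.coeff m (taylor D ev a) = ev (diffMonomial D m a) / multiFactorial m := rfl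

theorem taylor_add (D : Fin N → Derivation ℂ R R) (ev : R →ₐ[ℂ] ℂ) (a b : R) :
    taylor D ev (a + b) = taylor D ev a + taylor D ev b := by
  ext m
  simp [coeff_taylor, add_div]

theorem taylor_deriv {D : Fin N → Derivation ℂ R R} (hD : ∀ i j a, D i (D j a) = D j (D i a))
    (ev : R →ₐ[ℂ] ℂ) (j : Fin N) (a : R) :
    taylor D ev (D j a) = MvPowerSeries.pderiv ℂ j (taylor D ev a) := by
  ext m
  rw [MvPowerSeries.coeff_pderiv, coeff_taylor, coeff_taylor, diffMonomial_add_single hD,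
    multiFactorial_add_single, diffMonomial_apply_comm hD]
  have h1 := multiFactorial_ne_zero m
  have h2 : (m j + 1 : ℂ) ≠ 0 := Nat.cast_add_one_ne_zero (m j)
  simp only [Module.End.mul_apply, Derivation.coeFn_coe]
  field_simp

/-- Up to the nonzero factor `m j + 1`, the coefficient at `m + single j 1` is the coefficient at
`m` of the `j`-th derivative. Both sides obey the same Leibniz rule, so induction on `m` avoids the
multinomial one. -/
theorem taylor_mul {D : Fin N → Derivation ℂ R R} (hD : ∀ i j a, D i (D j a) = D j (D i a))
    (ev : R →ₐ[ℂ] ℂ) (a b : R) :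
    taylor D ev (a * b) = taylor D ev a * taylor D ev b := by
  ext m
  induction m using multiIndex_induction generalizing a b with
  | h0 =>
    rw [MvPowerSeries.coeff_zero_eq_constantCoeff_apply,
      MvPowerSeries.coeff_zero_eq_constantCoeff_apply, map_mul,
      ← MvPowerSeries.coeff_zero_eq_constantCoeff_apply,
      ← MvPowerSeries.coeff_zero_eq_constantCoeff_apply,
      ← MvPowerSeries.coeff_zero_eq_constantCoeff_apply]
    simp [coeff_taylor, diffMonomial_zero, multiFactorial_zero]
  | h1 m j ih =>
    have h2 : (m j + 1 : ℂ) ≠ 0 := Nat.cast_add_one_ne_zero (m j)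
    apply mul_right_cancel₀ h2
    rw [← MvPowerSeries.coeff_pderiv, ← MvPowerSeries.coeff_pderiv, ← taylor_deriv hD,
      Derivation.leibniz, Derivation.leibniz, taylor_add, map_add, map_add, smul_eq_mul,
      smul_eq_mul, ih, ih, taylor_deriv hD, taylor_deriv hD, smul_eq_mul, smul_eq_mul]

theorem diffMonomial_algebraMap (D : Fin N → Derivation ℂ R R) {m : Fin N →₀ ℕ} (hm : m ≠ 0)
    (hD : ∀ i j a, D i (D j a) = D j (D i a)) (c : ℂ) :
    diffMonomial D m (algebraMap ℂ R c) = 0 := by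
  obtain ⟨j, m', rfl⟩ := exists_eq_add_single_of_ne_zero hm
  rw [diffMonomial_add_single hD, Module.End.mul_apply, Derivation.coeFn_coe,
    ← diffMonomial_apply_comm hD, Derivation.map_algebraMap, map_zero]

/-- Taylor expansion as an algebra homomorphism. -/
def taylorHom {D : Fin N → Derivation ℂ R R} (hD : ∀ i j a, D i (D j a) = D j (D i a))
    (ev : R →ₐ[ℂ] ℂ) : R →ₐ[ℂ] MvPowerSeries (Fin N) ℂ :=
  have hc : ∀ c, taylor D ev (algebraMap ℂ R c) = algebraMap ℂ _ c := by
    intro c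
    ext m
    rw [coeff_taylor, MvPowerSeries.algebraMap_apply, MvPowerSeries.coeff_C]
    split_ifs with h
    · subst h; simp [diffMonomial_zero, multiFactorial_zero]
    · rw [diffMonomial_algebraMap D h hD]; simp
  AlgHom.ofLinearMap
    { toFun := taylor D ev
      map_add' := taylor_add D ev
      map_smul' := fun c a => by
        rw [Algebra.smul_def, taylor_mul hD, hc, RingHom.id_apply, Algebra.smul_def] }
    (by
      show taylor D ev 1 = 1
      have := hc 1
      rwa [map_one, map_one] at this)
    (taylor_mul hD ev)

theorem coeff_taylorHom {D : Fin N → Derivation ℂ R R}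
    (hD : ∀ i j a, D i (D j a) = D j (D i a))
    (ev : R →ₐ[ℂ] ℂ) (a : R) (m : Fin N →₀ ℕ) :
    MvPowerSeries.coeff m (taylorHom hD ev a) = ev (diffMonomial D m a) / multiFactorial m := rfl

theorem taylorHom_deriv {D : Fin N → Derivation ℂ R R}
    (hD : ∀ i j a, D i (D j a) = D j (D i a)) (ev : R →ₐ[ℂ] ℂ) (j : Fin N) (a : R) :
    taylorHom hD ev (D j a) = MvPowerSeries.pderiv ℂ j (taylorHom hD ev a) :=
  taylor_deriv hD ev j a

end CommutingDerivations

/-! ### The coefficient identity for the Jacobian determinant. -/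

section Formal

open MvPowerSeries

variable {N : ℕ}

/-- The columns of `δ_{jk} - p_k(j) / n_k` are dependent when `∑ p_k = n ≠ 0`. -/
theorem det_one_sub_div_eq_zero {n : Fin N →₀ ℕ} (hn : n ≠ 0) (p : Fin N → Fin N →₀ ℕ)
    (hp : ∑ k, p k = n) (hp0 : ∀ k, n k = 0 → p k = 0) :
    (Matrix.of fun j k : Fin N => (if j = k then (1 : ℂ) else 0) - (p k j : ℂ) / n k).det = 0 := by
  rw [← Matrix.exists_mulVec_eq_zero_iff]
  -- The vector `n` lies in the kernel: weighting column `k` by `n k` leaves `n j - ∑ p k j = 0` in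
  -- row `j`.
  refine ⟨fun k => (n k : ℂ), ?_, ?_⟩
  · intro h
    apply hn
    ext k
    simpa using congrFun h k
  · ext j
    have h1 : ∀ k, ((if j = k then (1 : ℂ) else 0) - (p k j : ℂ) / n k) * n k =
        (if j = k then (n k : ℂ) else 0) - p k j := by
      intro k
      -- Division by `n k = 0` yields `0`; `hp0` makes `p k j` vanish too, so clearing the
      -- denominator stays valid.
      by_cases h : n k = 0
      · simp [h, hp0 k h]
      · have : (n k : ℂ) ≠ 0 := by exact_mod_cast h
        rw [sub_mul, div_mul_cancel₀ _ this]
        simp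
    simp only [Matrix.mulVec, dotProduct, Matrix.of_apply, h1, Finset.sum_sub_distrib]
    have : ∑ k, (p k j : ℂ) = n j := by
      rw [← hp]; simp [Finsupp.finsetSum_apply]
    simp [this]

theorem coeff_X_mul_pderiv (g : MvPowerSeries (Fin N) ℂ) (j : Fin N) (p : Fin N →₀ ℕ) :
    coeff p (X j * pderiv ℂ j g) = p j * coeff p g := by
  by_cases h : p j = 0
  · rw [h, Nat.cast_zero, zero_mul]
    rw [X, coeff_monomial_mul, if_neg]
    simp [Finsupp.single_le_iff, h]
  · obtain ⟨q, rfl⟩ : ∃ q, p = Finsupp.single j 1 + q :=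
      ⟨p - Finsupp.single j 1, by
        rw [add_tsub_cancel_of_le]
        simpa [Finsupp.single_le_iff, Nat.one_le_iff_ne_zero] using h⟩
    rw [X, coeff_add_monomial_mul, coeff_pderiv, one_mul, add_comm q, mul_comm]
    simp [add_comm]

/-- The coefficient identity behind the Lagrange–Good formula. -/
theorem coeff_det_lagrange (g : Fin N → MvPowerSeries (Fin N) ℂ) (n : Fin N →₀ ℕ) :
    coeff n (Matrix.of fun j k : Fin N => (if j = k then g k ^ n k else 0) -
      C ((n k : ℂ)⁻¹) * (X k * pderiv ℂ j (g k ^ n k))).det = if n = 0 then 1 else 0 := by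
  -- Conjugation by `diag(X_k)` replaces `X k` by `X j` without changing the determinant. Each entry
  -- then contains the Euler operator `X_j ∂_j`, which multiplies the coefficient at `p` by `p j`.
  have hconj : (Matrix.of fun j k : Fin N => (if j = k then g k ^ n k else 0) -
      C ((n k : ℂ)⁻¹) * (X k * pderiv ℂ j (g k ^ n k))).det =
      (Matrix.of fun j k : Fin N => (if j = k then g k ^ n k else 0) -
      C ((n k : ℂ)⁻¹) * (X j * pderiv ℂ j (g k ^ n k))).det := by
    set A := Matrix.of fun j k : Fin N => (if j = k then g k ^ n k else 0) -
      C ((n k : ℂ)⁻¹) * (X k * pderiv ℂ j (g k ^ n k))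
    set B := Matrix.of fun j k : Fin N => (if j = k then g k ^ n k else 0) -
      C ((n k : ℂ)⁻¹) * (X j * pderiv ℂ j (g k ^ n k))
    set Δ := Matrix.diagonal fun k : Fin N => (X k : MvPowerSeries (Fin N) ℂ)
    have h : Δ * A = B * Δ := by
      ext1 j k
      rw [Matrix.diagonal_mul, Matrix.mul_diagonal]
      simp only [A, B, Matrix.of_apply]
      by_cases hjk : j = k
      · subst hjk; ring
      · simp only [hjk, if_false]; ring
    have hΔ : Δ.det ≠ 0 := by
      rw [Matrix.det_diagonal]
      exact Finset.prod_ne_zero_iff.2 fun k _ h0 => by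
        simpa using congrArg (coeff (Finsupp.single k 1)) h0
    have := congrArg Matrix.det h
    rw [Matrix.det_mul, Matrix.det_mul, mul_comm] at this
    exact mul_right_cancel₀ hΔ this
  rw [hconj]
  have hentry : ∀ (j k : Fin N) (p : Fin N →₀ ℕ),
      coeff p ((if j = k then g k ^ n k else 0) -
        C ((n k : ℂ)⁻¹) * (X j * pderiv ℂ j (g k ^ n k))) =
      ((if j = k then (1 : ℂ) else 0) - (p j : ℂ) / n k) * coeff p (g k ^ n k) := by
    intro j k p
    rw [map_sub, coeff_C_mul, coeff_X_mul_pderiv]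
    split_ifs
    · ring
    · rw [map_zero]; ring
  rw [Matrix.det_apply', map_sum]
  -- Distribute the exponent `n` over the columns as `l`. For fixed `l` the scalar factors assemble,
  -- over all `σ`, into the determinant of `δ_jk - l_k(j) / n_k`.
  have hterm : ∀ σ : Equiv.Perm (Fin N),
      coeff n (((Equiv.Perm.sign σ : ℤ) : MvPowerSeries (Fin N) ℂ) * ∏ k, (Matrix.of fun j k : Fin N =>
        (if j = k then g k ^ n k else 0) -
        C ((n k : ℂ)⁻¹) * (X j * pderiv ℂ j (g k ^ n k))) (σ k) k) =
      ∑ l ∈ Finset.finsuppAntidiag Finset.univ n, (∏ k, coeff (l k) (g k ^ n k)) *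
        (((Equiv.Perm.sign σ : ℤ) : ℂ) * ∏ k, (Matrix.of fun j k : Fin N =>
          (if j = k then (1 : ℂ) else 0) - (l k j : ℂ) / n k) (σ k) k) := by
    intro σ
    have : ((Equiv.Perm.sign σ : ℤ) : MvPowerSeries (Fin N) ℂ) =
        C ((Equiv.Perm.sign σ : ℤ) : ℂ) := by simp
    rw [this, coeff_C_mul, coeff_prod, Finset.mul_sum]
    refine Finset.sum_congr rfl fun l _ => ?_
    simp only [Matrix.of_apply, hentry, Finset.prod_mul_distrib]
    ring
  simp only [hterm]
  rw [Finset.sum_comm]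
  simp only [← Finset.mul_sum, ← Matrix.det_apply']
  split_ifs with hn
  · subst hn
    rw [Finset.finsuppAntidiag_zero]
    simp [coeff_one]
    convert Matrix.det_one (n := Fin N) (R := ℂ) using 2
    ext j k
    simp [Matrix.one_apply]
  · refine Finset.sum_eq_zero fun l hl => ?_
    rw [Finset.mem_finsuppAntidiag] at hl
    -- In the other case some column is `g k ^ 0 = 1`, whose coefficient at `l k ≠ 0` is zero.
    by_cases h0 : ∀ k, n k = 0 → l k = 0
    · rw [det_one_sub_div_eq_zero hn (fun k => l k) hl.1 h0, mul_zero]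
    · push Not at h0
      obtain ⟨k, hk, hlk⟩ := h0
      rw [Finset.prod_eq_zero (Finset.mem_univ k), zero_mul]
      rw [hk, pow_zero, coeff_one, if_neg hlk]

end Formal

/-! ### The Lagrange–Good series over formal power series. -/

section FormalLagrange

open MvPowerSeries

variable {N : ℕ}

/-- The coefficient of `z ^ m` in `g ^ m * K`, the terms of the Lagrange–Good series. -/
def lagrangeTerm (g : Fin N → MvPowerSeries (Fin N) ℂ) (K : MvPowerSeries (Fin N) ℂ)
    (m : Fin N →₀ ℕ) : ℂ :=
  coeff m ((∏ k, g k ^ m k) * K)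

theorem prod_pow_add_single {R : Type*} [CommRing R] (g : Fin N → R) (m : Fin N →₀ ℕ) (j : Fin N) :
    ∏ k, g k ^ (m + Finsupp.single j 1 : Fin N →₀ ℕ) k = (∏ k, g k ^ m k) * g j := by
  simp only [Finsupp.add_apply, pow_add, Finset.prod_mul_distrib]
  congr 1
  rw [Finset.prod_eq_single j] <;> simp +contextual [eq_comm]

/-- The term at `m + single j 1` on the left is the term at `m` on the right: the extra `X j`
cancels the shift of the exponent and the extra power of `g j` remains. Terms with `m j = 0` vanish
on the left. Thus the sum cannot tell `z_j` from `g_j`, as if it evaluated at a solution. -/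
theorem tsum_lagrangeTerm_X_mul (g : Fin N → MvPowerSeries (Fin N) ℂ)
    (K : MvPowerSeries (Fin N) ℂ) (j : Fin N) :
    ∑' m, lagrangeTerm g (X j * K) m = ∑' m, lagrangeTerm g (g j * K) m := by
  have hinj : Function.Injective fun m : Fin N →₀ ℕ => m + Finsupp.single j 1 :=
    add_left_injective _
  rw [← hinj.tsum_eq]
  · refine tsum_congr fun m => ?_
    rw [lagrangeTerm, prod_pow_add_single, lagrangeTerm, X, mul_left_comm,
      add_comm, coeff_add_monomial_mul, one_mul, mul_assoc]
  · intro m hm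
    by_contra h
    apply hm
    rw [lagrangeTerm, X, mul_left_comm, coeff_monomial_mul, if_neg]
    intro hle
    exact h ⟨m - Finsupp.single j 1, tsub_add_cancel_of_le hle⟩

/-- The shift by the indicator of `t` that turns `g ^ m ∏_{k ∈ t} ∂_{σ k} g_k` into a product of
logarithmic-type factors. -/
theorem hasSum_shift_iff (g : Fin N → MvPowerSeries (Fin N) ℂ) (σ : Fin N → Fin N)
    (t : Finset (Fin N)) (s : ℂ) :
    HasSum (fun n : Fin N →₀ ℕ => coeff n ((∏ k ∈ Finset.univ \ t, g k ^ n k) *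
      ∏ k ∈ t, C ((n k : ℂ)⁻¹) * (X k * pderiv ℂ (σ k) (g k ^ n k)))) s ↔
    HasSum (lagrangeTerm g (∏ k ∈ t, pderiv ℂ (σ k) (g k))) s := by
  set d : Fin N →₀ ℕ := Finsupp.indicator t fun _ _ => 1 with hd
  have hdin : ∀ k ∈ t, d k = 1 := fun k hk => by simp [hd, hk]
  have hdout : ∀ k ∉ t, d k = 0 := fun k hk => by simp [hd, hk]
  have hX : ∏ k ∈ t, (X k : MvPowerSeries (Fin N) ℂ) = monomial d 1 := by
    have : d = ∑ k ∈ t, Finsupp.single k 1 := by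
      ext k
      simp [hd, Finsupp.indicator_apply, Finsupp.finsetSum_apply, Finsupp.single_apply]
    rw [this]
    simp only [X]
    rw [prod_monomial]
    simp
  have hinj : Function.Injective fun m : Fin N →₀ ℕ => d + m := add_right_injective _
  set w : (Fin N →₀ ℕ) → ℂ := fun n => coeff n ((∏ k ∈ Finset.univ \ t, g k ^ n k) *
      ∏ k ∈ t, C ((n k : ℂ)⁻¹) * (X k * pderiv ℂ (σ k) (g k ^ n k))) with hw
  have hshift : w ∘ (fun m : Fin N →₀ ℕ => d + m) =
      lagrangeTerm g (∏ k ∈ t, pderiv ℂ (σ k) (g k)) := by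
    funext m
    have h1 : ∏ k ∈ Finset.univ \ t, g k ^ (d + m) k = ∏ k ∈ Finset.univ \ t, g k ^ m k := by
      refine Finset.prod_congr rfl fun k hk => ?_
      rw [Finsupp.add_apply, hdout k (Finset.mem_sdiff.1 hk).2, zero_add]
    have h2 : ∏ k ∈ t, C ((((d + m) k : ℕ) : ℂ)⁻¹) *
          (X k * pderiv ℂ (σ k) (g k ^ (d + m) k)) =
        (∏ k ∈ t, X k) * ((∏ k ∈ t, g k ^ m k) * ∏ k ∈ t, pderiv ℂ (σ k) (g k)) := by
      rw [← Finset.prod_mul_distrib, ← Finset.prod_mul_distrib]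
      refine Finset.prod_congr rfl fun k hk => ?_
      have h3 : (d + m) k = m k + 1 := by rw [Finsupp.add_apply, hdin k hk, add_comm]
      have h4 : (C (((m k + 1 : ℕ) : ℂ)⁻¹) : MvPowerSeries (Fin N) ℂ) * ((m k + 1 : ℕ) : _) = 1 := by
        rw [← map_natCast (C : ℂ →+* MvPowerSeries (Fin N) ℂ), ← map_mul,
          inv_mul_cancel₀ (Nat.cast_ne_zero.2 (Nat.succ_ne_zero _)), map_one]
      rw [h3, Derivation.leibniz_pow, Nat.add_sub_cancel, nsmul_eq_mul, smul_eq_mul]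
      calc _ = (C (((m k + 1 : ℕ) : ℂ)⁻¹) * ((m k + 1 : ℕ) : MvPowerSeries (Fin N) ℂ)) *
            (X k * (g k ^ m k * pderiv ℂ (σ k) (g k))) := by ring
        _ = _ := by rw [h4, one_mul]
    simp only [Function.comp_apply, hw]
    rw [h1, h2, hX, mul_left_comm, coeff_add_monomial_mul, one_mul, lagrangeTerm, ← mul_assoc,
      Finset.prod_sdiff (Finset.subset_univ t)]
  rw [← hshift, hinj.hasSum_iff]
  · intro n hn
    -- Outside the range of the shift some `k ∈ t` has `n k = 0`, and the derivative of `g k ^ 0`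
    -- vanishes.
    obtain ⟨k, hk, hnk⟩ : ∃ k ∈ t, n k = 0 := by
      by_contra! h
      refine hn ⟨n - d, add_tsub_cancel_of_le fun k => ?_⟩
      by_cases hk : k ∈ t
      · rw [hdin k hk]; exact Nat.one_le_iff_ne_zero.2 (h k hk)
      · rw [hdout k hk]; exact Nat.zero_le _
    simp only [hw]
    rw [Finset.prod_eq_zero hk (by simp [hnk]), mul_zero, map_zero]

/-- The Lagrange–Good series of the Jacobian determinant is `1`. -/
theorem hasSum_lagrangeTerm_det (g : Fin N → MvPowerSeries (Fin N) ℂ)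
    (hs : ∀ (σ : Fin N → Fin N) (t : Finset (Fin N)),
      Summable (lagrangeTerm g (∏ k ∈ t, pderiv ℂ (σ k) (g k)))) :
    HasSum (lagrangeTerm g
      (Matrix.of fun j k : Fin N => (if j = k then 1 else 0) - pderiv ℂ j (g k)).det) 1 := by
  classical
  set cf : Equiv.Perm (Fin N) → Finset (Fin N) → ℂ := fun σ t =>
    ((Equiv.Perm.sign σ : ℤ) : ℂ) * ((-1) ^ t.card *
      ∏ k ∈ Finset.univ \ t, if σ k = k then 1 else 0) with hcf
  have hite : ∀ (j k : Fin N) (a : MvPowerSeries (Fin N) ℂ),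
      (if j = k then a else 0) = C (if j = k then 1 else 0) * a := by
    intro j k a; split_ifs <;> simp
  -- The set `t` consists of the columns in which the derivative term is chosen. The coefficients
  -- `cf` do not depend on `a` and `b`, so one expansion serves both determinants below.
  have hexp : ∀ (a : Fin N → MvPowerSeries (Fin N) ℂ) (b : Fin N → Fin N → MvPowerSeries (Fin N) ℂ),
      (Matrix.of fun j k : Fin N => (if j = k then a k else 0) - b j k).det =
        ∑ σ : Equiv.Perm (Fin N), ∑ t ∈ Finset.univ.powerset, C (cf σ t) *
          ((∏ k ∈ Finset.univ \ t, a k) * ∏ k ∈ t, b (σ k) k) := by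
    intro a b
    rw [Matrix.det_apply']
    refine Finset.sum_congr rfl fun σ _ => ?_
    simp only [Matrix.of_apply]
    rw [Finset.prod_sub, Finset.mul_sum]
    refine Finset.sum_congr rfl fun t _ => ?_
    simp only [hite _ _ (a _), Finset.prod_mul_distrib, hcf, map_mul, map_prod, map_pow, map_neg,
      map_one, map_intCast]
    ring
  have h1 : HasSum (lagrangeTerm g
      (Matrix.of fun j k : Fin N => (if j = k then 1 else 0) - pderiv ℂ j (g k)).det)
      (∑ σ : Equiv.Perm (Fin N), ∑ t ∈ Finset.univ.powerset, cf σ t *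
        ∑' m, lagrangeTerm g (∏ k ∈ t, pderiv ℂ (σ k) (g k)) m) := by
    have : lagrangeTerm g
        (Matrix.of fun j k : Fin N => (if j = k then 1 else 0) - pderiv ℂ j (g k)).det =
        fun m => ∑ σ : Equiv.Perm (Fin N), ∑ t ∈ Finset.univ.powerset, cf σ t *
          lagrangeTerm g (∏ k ∈ t, pderiv ℂ (σ k) (g k)) m := by
      funext m
      rw [lagrangeTerm, hexp (fun _ => 1), Finset.mul_sum, map_sum]
      refine Finset.sum_congr rfl fun σ _ => ?_
      rw [Finset.mul_sum, map_sum]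
      refine Finset.sum_congr rfl fun t _ => ?_
      rw [Finset.prod_const_one, one_mul, mul_left_comm, coeff_C_mul, lagrangeTerm]
    rw [this]
    exact hasSum_sum fun σ _ => hasSum_sum fun t _ => ((hs σ t).hasSum).mul_left _
  -- After the shift, each pair `(σ, t)` contributes the same sum to the coefficient identity. Hence
  -- the total obtained in `h1` is also the sum of the Kronecker delta at `0`.
  have h2 : HasSum (fun n : Fin N →₀ ℕ => if n = 0 then (1 : ℂ) else 0)
      (∑ σ : Equiv.Perm (Fin N), ∑ t ∈ Finset.univ.powerset, cf σ t *
        ∑' m, lagrangeTerm g (∏ k ∈ t, pderiv ℂ (σ k) (g k)) m) := by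
    have : (fun n : Fin N →₀ ℕ => if n = 0 then (1 : ℂ) else 0) =
        fun n => ∑ σ : Equiv.Perm (Fin N), ∑ t ∈ Finset.univ.powerset, cf σ t *
          coeff n ((∏ k ∈ Finset.univ \ t, g k ^ n k) *
            ∏ k ∈ t, C ((n k : ℂ)⁻¹) * (X k * pderiv ℂ (σ k) (g k ^ n k))) := by
      funext n
      rw [← coeff_det_lagrange g n, hexp (fun k => g k ^ n k), map_sum]
      refine Finset.sum_congr rfl fun σ _ => ?_
      rw [map_sum]
      refine Finset.sum_congr rfl fun t _ => ?_
      rw [coeff_C_mul]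
    rw [this]
    exact hasSum_sum fun σ _ => hasSum_sum fun t _ =>
      ((hasSum_shift_iff g σ t _).2 (hs σ t).hasSum).mul_left _
  have h3 : HasSum (fun n : Fin N →₀ ℕ => if n = 0 then (1 : ℂ) else 0) 1 :=
    hasSum_ite_eq 0 1
  rwa [h2.unique h3] at h1

end FormalLagrange

/-! ### Analytic functions on an open set and their directional derivatives. -/

section Holomorphic

open TopologicalSpace Topology

variable {E : Type*} [NormedAddCommGroup E] [NormedSpace ℂ E]

/-- The algebra of analytic functions on the open set `W`, as a subalgebra of all functions. -/
def holSubalgebra (W : Opens E) : Subalgebra ℂ (W → ℂ) where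
  carrier := {g | ∃ G : E → ℂ, AnalyticOnNhd ℂ G W ∧ ∀ e : W, g e = G e}
  mul_mem' := by
    rintro _ _ ⟨G, hG, h⟩ ⟨G', hG', h'⟩
    exact ⟨G * G', hG.mul hG', fun e => by simp [h e, h' e]⟩
  add_mem' := by
    rintro _ _ ⟨G, hG, h⟩ ⟨G', hG', h'⟩
    exact ⟨G + G', hG.add hG', fun e => by simp [h e, h' e]⟩
  algebraMap_mem' := fun c => ⟨fun _ => c, analyticOnNhd_const, fun _ => rfl⟩

/-- The algebra of analytic functions on the open set `W`. -/
def hol (W : Opens E) : Type _ := holSubalgebra W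

instance (W : Opens E) : CommRing (hol W) := inferInstanceAs (CommRing (holSubalgebra W))

instance (W : Opens E) : Algebra ℂ (hol W) := inferInstanceAs (Algebra ℂ (holSubalgebra W))

variable {W : Opens E}

/-- The restriction to `W` of a function that is analytic on `W`. -/
def holMk (G : E → ℂ) (hG : AnalyticOnNhd ℂ G W) : hol W := ⟨fun e => G e, G, hG, fun _ => rfl⟩

/-- Evaluation at a point of `W`. -/
def evalAt (e : W) : hol W →ₐ[ℂ] ℂ := (Pi.evalAlgHom ℂ (fun _ : W => ℂ) e).comp (holSubalgebra W).val

theorem evalAt_holMk (G : E → ℂ) (hG : AnalyticOnNhd ℂ G W) (e : W) :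
    evalAt e (holMk G hG) = G e := rfl

theorem hol_ext {a b : hol W} (h : ∀ e, evalAt e a = evalAt e b) : a = b :=
  Subtype.ext (funext h)

/-- The extension by zero. -/
def lift (a : hol W) : E → ℂ := Function.extend Subtype.val a.1 0

theorem lift_apply (a : hol W) (e : W) : lift a e = evalAt e a :=
  Subtype.val_injective.extend_apply _ _ _

theorem lift_eventuallyEq {a : hol W} {G : E → ℂ} (h : ∀ e : W, evalAt e a = G e) (e : W) :
    lift a =ᶠ[𝓝 (e : E)] G := by
  filter_upwards [W.isOpen.mem_nhds e.2] with x hx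
  exact (lift_apply a ⟨x, hx⟩).trans (h ⟨x, hx⟩)

theorem analyticOnNhd_lift (a : hol W) : AnalyticOnNhd ℂ (lift a) W := by
  obtain ⟨G, hG, h⟩ := a.2
  exact fun e he => (hG e he).congr (lift_eventuallyEq (a := a) h ⟨e, he⟩).symm

theorem analyticAt_lift (a : hol W) (e : W) : AnalyticAt ℂ (lift a) e :=
  analyticOnNhd_lift a e e.2

theorem hasFDerivAt_lift (a : hol W) (e : W) :
    HasFDerivAt (lift a) (fderiv ℂ (lift a) (e : E)) (e : E) :=
  (analyticAt_lift a e).differentiableAt.hasFDerivAt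

theorem analyticOnNhd_fderiv_lift (a : hol W) (d : E) :
    AnalyticOnNhd ℂ (fun e => fderiv ℂ (lift a) e d) W := fun e he =>
  ((ContinuousLinearMap.apply ℂ ℂ d).analyticAt _).comp ((analyticOnNhd_lift a).fderiv e he)

/-- The derivative in the direction `d`. -/
def holD (d : E) : Derivation ℂ (hol W) (hol W) :=
  Derivation.mk'
    { toFun := fun a => holMk _ (analyticOnNhd_fderiv_lift a d)
      map_add' := fun a b => hol_ext fun e => by
        rw [map_add, evalAt_holMk, evalAt_holMk, evalAt_holMk,
          (lift_eventuallyEq (G := lift a + lift b)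
            (fun e => by simp [lift_apply]) e).fderiv_eq,
          ((hasFDerivAt_lift a e).add (hasFDerivAt_lift b e)).fderiv]
        rfl
      map_smul' := fun c a => hol_ext fun e => by
        rw [map_smul, evalAt_holMk, evalAt_holMk,
          (lift_eventuallyEq (G := c • lift a) (fun e => by simp [lift_apply]) e).fderiv_eq,
          ((hasFDerivAt_lift a e).const_smul c).fderiv]
        rfl }
    fun a b => hol_ext fun e => by
      simp only [LinearMap.coe_mk, AddHom.coe_mk, smul_eq_mul, map_add, map_mul, evalAt_holMk]
      rw [(lift_eventuallyEq (G := lift a * lift b)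
          (fun e => by simp [lift_apply]) e).fderiv_eq,
        ((hasFDerivAt_lift a e).mul (hasFDerivAt_lift b e)).fderiv]
      simp [lift_apply]

theorem evalAt_holD (d : E) (a : hol W) (e : W) :
    evalAt e (holD d a) = fderiv ℂ (lift a) (e : E) d := rfl

theorem evalAt_holD_of_hasFDerivAt (d : E) {a : hol W} {e : W} {G : E → ℂ} {G' : E →L[ℂ] ℂ}
    (h : ∀ e : W, evalAt e a = G e) (hG : HasFDerivAt G G' (e : E)) :
    evalAt e (holD d a) = G' d := by
  rw [evalAt_holD, (lift_eventuallyEq h e).fderiv_eq, hG.fderiv]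

theorem holD_comm (d d' : E) (a : hol W) : holD d (holD d' a) = holD d' (holD d a) := by
  refine hol_ext fun e => ?_
  have h2 : HasFDerivAt (fderiv ℂ (lift a)) (fderiv ℂ (fderiv ℂ (lift a)) (e : E)) (e : E) :=
    (((analyticOnNhd_lift a).fderiv) e e.2).differentiableAt.hasFDerivAt
  have key : ∀ d d' : E, evalAt e (holD d (holD d' a)) =
      fderiv ℂ (fderiv ℂ (lift a)) (e : E) d d' := by
    intro d d'
    rw [evalAt_holD_of_hasFDerivAt d (fun e => evalAt_holD d' a e)
      (h2.clm_apply (hasFDerivAt_const d' (e : E)))]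
    simp
  rw [key, key]
  have hs : IsSymmSndFDerivAt ℂ (lift a) (e : E) :=
    ((analyticAt_lift a e).contDiffAt (n := 2)).isSymmSndFDerivAt (by simp)
  exact hs.eq d d'

/-- The family of derivatives in the directions `d i`. -/
def holDs {N : ℕ} (d : Fin N → E) (i : Fin N) : Derivation ℂ (hol W) (hol W) := holD (d i)

theorem holDs_comm {N : ℕ} (d : Fin N → E) (i j : Fin N) (a : hol W) :
    holDs d i (holDs d j a) = holDs d j (holDs d i a) :=
  holD_comm _ _ a

theorem hasDerivAt_lift_line (a : hol W) (e : W) (d : E) :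
    HasDerivAt (fun t : ℂ => lift a (e + t • d)) (evalAt e (holD d a)) 0 := by
  have h := hasFDerivAt_lift a e
  have h1 : HasDerivAt (fun t : ℂ => (e : E) + t • d) d 0 := by
    simpa using ((hasDerivAt_id (0 : ℂ)).smul_const d).const_add (e : E)
  have h2 : HasFDerivAt (lift a) (fderiv ℂ (lift a) (e : E)) ((e : E) + (0 : ℂ) • d) := by
    simpa using h
  exact h2.comp_hasDerivAt (0 : ℂ) h1

/-- The bridge to one complex variable, through which Taylor series and Cauchy estimates enter. -/
theorem iteratedDeriv_lift_line (b : hol W) (e d : E) (n : ℕ) (t : ℂ) (ht : e + t • d ∈ W) :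
    iteratedDeriv n (fun t : ℂ => lift b (e + t • d)) t =
      evalAt ⟨e + t • d, ht⟩ ((⇑(holD (W := W) d))^[n] b) := by
  induction n generalizing t with
  | zero =>
    rw [iteratedDeriv_zero]
    exact lift_apply b ⟨e + t • d, ht⟩
  | succ n ih =>
    have hU : IsOpen {t : ℂ | e + t • d ∈ W} :=
      W.isOpen.preimage (by fun_prop : Continuous fun t : ℂ => e + t • d)
    have hev : iteratedDeriv n (fun t : ℂ => lift b (e + t • d)) =ᶠ[𝓝 t]
        fun s => lift ((⇑(holD (W := W) d))^[n] b) (e + s • d) := by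
      filter_upwards [hU.mem_nhds ht] with s hs
      rw [ih s hs]
      exact (lift_apply _ ⟨e + s • d, hs⟩).symm
    rw [iteratedDeriv_succ, hev.deriv_eq, Function.iterate_succ_apply']
    have h1 := hasDerivAt_lift_line ((⇑(holD (W := W) d))^[n] b) ⟨e + t • d, ht⟩ d
    have h2 : HasDerivAt (fun s : ℂ => s - t) 1 t := (hasDerivAt_id t).sub_const t
    have h3 := HasDerivAt.scomp (h := fun s : ℂ => s - t) t (by simpa using h1) h2
    rw [one_smul] at h3
    refine (h3.congr_of_eventuallyEq (Filter.Eventually.of_forall fun s => ?_)).deriv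
    simp [add_assoc, ← add_smul]

variable {E' : Type*} [NormedAddCommGroup E'] [NormedSpace ℂ E'] {W' : Opens E'}

/-- Pullback of analytic functions along a continuous linear map. -/
def pullback (L : E' →L[ℂ] E) (hL : ∀ e ∈ W', L e ∈ W) : hol W →ₐ[ℂ] hol W' where
  toFun a := ⟨fun e => a.1 ⟨L e, hL e e.2⟩, lift a ∘ L,
    fun e he => (analyticOnNhd_lift a _ (hL e he)).comp (L.analyticAt e),
    fun e => (lift_apply a ⟨L e, hL e e.2⟩).symm⟩
  map_one' := rfl
  map_mul' _ _ := rfl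
  map_zero' := rfl
  map_add' _ _ := rfl
  commutes' _ := rfl

theorem evalAt_pullback (L : E' →L[ℂ] E) (hL : ∀ e ∈ W', L e ∈ W) (a : hol W) (e : W') :
    evalAt e (pullback L hL a) = evalAt ⟨L e, hL e e.2⟩ a := rfl

theorem holD_pullback (L : E' →L[ℂ] E) (hL : ∀ e ∈ W', L e ∈ W) (d : E') (a : hol W) :
    holD d (pullback L hL a) = pullback L hL (holD (L d) a) := by
  refine hol_ext fun e => ?_
  rw [evalAt_pullback, evalAt_holD_of_hasFDerivAt (G := lift a ∘ L) d
    (fun e => (lift_apply a ⟨L e, hL e e.2⟩).symm)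
    ((hasFDerivAt_lift a ⟨L e, hL e e.2⟩).comp (e : E') L.hasFDerivAt)]
  rfl

theorem diffMonomial_pullback {N : ℕ} (L : E' →L[ℂ] E) (hL : ∀ e ∈ W', L e ∈ W)
    (d : Fin N → E') (m : Fin N →₀ ℕ) (a : hol W) :
    diffMonomial (holDs d) m (pullback L hL a) =
      pullback L hL (diffMonomial (holDs (W := W) fun i => L (d i)) m a) := by
  revert m
  refine multiIndex_induction ?_ fun m j ih => ?_
  · rw [diffMonomial_zero, diffMonomial_zero, Module.End.one_apply, Module.End.one_apply]
  · rw [diffMonomial_add_single (holDs_comm d) m j, Module.End.mul_apply, ih,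
      diffMonomial_add_single (holDs_comm fun i => L (d i)) m j, Module.End.mul_apply]
    exact holD_pullback L hL (d j) _

end Holomorphic

/-! ### The fields as plain derivatives on a finite-dimensional slice. -/

section Operators

open TopologicalSpace Topology

variable {S : Set ℂ} {N : ℕ} (c : ℝ) (lam : Fin N → S)

theorem xi_comm (l m : ℂ) : xi c l m = xi c m l := by
  rw [xi, xi, ← neg_sub m l, neg_sq]

theorem eta_comm (l m : ℂ) : eta c l m = eta c m l := by
  have h1 : l - m + Complex.I * c = -(m - l - Complex.I * c) := by ring
  have h2 : l - m - Complex.I * c = -(m - l + Complex.I * c) := by ring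
  rw [eta, eta, h1, h2, one_div, one_div, one_div, one_div, inv_neg, inv_neg, neg_sq, neg_sq,
    add_comm]

/-- The configurations generated by the directions of `p'_ψ(λ_k)` and `p_φ(λ_k)`. -/
def conf : (Fin N → ℂ) × (Fin N → ℂ) →ₗ[ℂ] Config S :=
  (Fintype.linearCombination ℂ fun k => dirPsi c (lam k)).coprod
    (Fintype.linearCombination ℂ fun k => dirPhi c (lam k))

theorem conf_apply (e : (Fin N → ℂ) × (Fin N → ℂ)) :
    conf c lam e = ∑ k, e.1 k • dirPsi c (lam k) + ∑ k, e.2 k • dirPhi c (lam k) := by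
  simp [conf, Fintype.linearCombination_apply]

theorem conf_fst (e : (Fin N → ℂ) × (Fin N → ℂ)) : (conf c lam e).1 = xiSum c lam e.1 := by
  ext m
  simp [conf_apply, xiSum, dirPsi, dirPhi, Prod.fst_sum]

theorem conf_snd_fst (e : (Fin N → ℂ) × (Fin N → ℂ)) :
    (conf c lam e).2.1 = xiTSum c lam e.1 := by
  ext m
  simp [conf_apply, xiTSum, dirPsi, dirPhi, Prod.fst_sum, Prod.snd_sum]

theorem coordW_conf (e : (Fin N → ℂ) × (Fin N → ℂ)) (j : Fin N) :
    coordW (lam j) (conf c lam e) = ∑ k, e.1 k * eta c (lam k) (lam j) +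
      ∑ k, e.2 k * xi c (lam k) (lam j) := by
  simp [conf_apply, coordW, dirPsi, dirPhi, Prod.snd_sum]

theorem coordU_conf (e : (Fin N → ℂ) × (Fin N → ℂ)) (j : Fin N) :
    coordU (lam j) (conf c lam e) = xiSum c lam e.1 (lam j) := by
  rw [← conf_fst]; rfl

/-- The direction along which `p'_ψ(λ_j)` differentiates. -/
def dirZ (j : Fin N) : (Fin N → ℂ) × (Fin N → ℂ) := (Pi.single j 1, 0)

/-- The direction along which `p_φ(λ_j)` differentiates. -/
def dirS (j : Fin N) : (Fin N → ℂ) × (Fin N → ℂ) := (0, Pi.single j 1)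

theorem conf_dirZ (j : Fin N) : conf c lam (dirZ j) = dirPsi c (lam j) := by
  simp [conf_apply, dirZ, Pi.single_apply]

theorem conf_dirS (j : Fin N) : conf c lam (dirS j) = dirPhi c (lam j) := by
  simp [conf_apply, dirS, Pi.single_apply]

/-- The quadratic form whose exponential intertwines the fields with plain derivatives. -/
def phase (e : (Fin N → ℂ) × (Fin N → ℂ)) : ℂ :=
  ∑ j, ∑ m, (2⁻¹ * (e.1 j * e.1 m * eta c (lam j) (lam m)) +
    e.1 j * e.2 m * xi c (lam m) (lam j))

theorem hasDerivAt_phase_line (e d : (Fin N → ℂ) × (Fin N → ℂ)) :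
    HasDerivAt (fun t : ℂ => phase c lam (e + t • d))
      (∑ j, ∑ m, (2⁻¹ * ((d.1 j * e.1 m + e.1 j * d.1 m) * eta c (lam j) (lam m)) +
        (d.1 j * e.2 m + e.1 j * d.2 m) * xi c (lam m) (lam j))) 0 := by
  unfold phase
  refine HasDerivAt.fun_sum fun j _ => HasDerivAt.fun_sum fun m _ => ?_
  have h1 : ∀ a b : ℂ, HasDerivAt (fun t : ℂ => a + t * b) b 0 := fun a b => by
    simpa using ((hasDerivAt_id (0 : ℂ)).mul_const b).const_add a
  have h2 := ((((h1 (e.1 j) (d.1 j)).mul (h1 (e.1 m) (d.1 m))).mul_const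
    (eta c (lam j) (lam m))).const_mul (2⁻¹ : ℂ)).fun_add
    (((h1 (e.1 j) (d.1 j)).mul (h1 (e.2 m) (d.2 m))).mul_const (xi c (lam m) (lam j)))
  simpa using h2

/-- This dictates the form of `phase`: its `z_j`-derivative must be the multiplier of the creation
part of `ψ'(λ_j)`. The factor `½` is compensated by the symmetry of `η`. -/
theorem hasDerivAt_phase_dirZ (e : (Fin N → ℂ) × (Fin N → ℂ)) (j : Fin N) :
    HasDerivAt (fun t : ℂ => phase c lam (e + t • dirZ j))
      (coordW (lam j) (conf c lam e)) 0 := by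
  convert hasDerivAt_phase_line c lam e (dirZ j) using 1
  rw [coordW_conf]
  simp only [dirZ, Pi.zero_apply, mul_zero, add_zero, Finset.sum_add_distrib, add_mul, mul_add,
    Pi.single_apply, ite_mul, one_mul, zero_mul, mul_ite, mul_one]
  have hs : ∀ a : Fin N → Fin N → ℂ,
      ∑ i, ∑ k, (if i = j then a i k else 0) = ∑ k, a j k := fun a => by
    rw [Finset.sum_comm]; simp
  rw [hs fun i k => 2⁻¹ * (e.1 k * eta c (lam i) (lam k)),
    hs fun i k => e.2 k * xi c (lam k) (lam i)]
  simp only [Finset.sum_ite_eq', Finset.mem_univ, if_true]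
  have hη : ∑ k, e.1 k * eta c (lam k) (lam j) =
      ∑ k, 2⁻¹ * (e.1 k * eta c (lam j) (lam k)) +
        ∑ k, 2⁻¹ * (e.1 k * eta c (lam k) (lam j)) := by
    rw [← Finset.sum_add_distrib]
    refine Finset.sum_congr rfl fun k _ => ?_
    rw [eta_comm c (lam j) (lam k)]
    ring
  rw [hη]

theorem hasDerivAt_phase_dirS (e : (Fin N → ℂ) × (Fin N → ℂ)) (j : Fin N) :
    HasDerivAt (fun t : ℂ => phase c lam (e + t • dirS j))
      (xiSum c lam e.1 (lam j)) 0 := by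
  convert hasDerivAt_phase_line c lam e (dirS j) using 1
  simp [dirS, Pi.single_apply, xiSum, xi_comm c (lam j)]

theorem phase_zero : phase c lam 0 = 0 := by simp [phase]

theorem analyticAt_phase (e : (Fin N → ℂ) × (Fin N → ℂ)) : AnalyticAt ℂ (phase c lam) e := by
  have h1 : ∀ j, AnalyticAt ℂ (fun e : (Fin N → ℂ) × (Fin N → ℂ) => e.1 j) e := fun j =>
    ((ContinuousLinearMap.proj j : (Fin N → ℂ) →L[ℂ] ℂ).comp
      (ContinuousLinearMap.fst ℂ _ _)).analyticAt e
  have h2 : ∀ j, AnalyticAt ℂ (fun e : (Fin N → ℂ) × (Fin N → ℂ) => e.2 j) e := fun j =>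
    ((ContinuousLinearMap.proj j : (Fin N → ℂ) →L[ℂ] ℂ).comp
      (ContinuousLinearMap.snd ℂ _ _)).analyticAt e
  unfold phase
  refine Finset.analyticAt_fun_sum _ fun j _ => Finset.analyticAt_fun_sum _ fun m _ => ?_
  exact (analyticAt_const.mul (((h1 j).mul (h1 m)).mul analyticAt_const)).add
    (((h1 j).mul (h2 m)).mul analyticAt_const)

/-- The cylinder over `Ω`. -/
def cyl (Ω : Opens (Fin N → ℂ)) : Opens ((Fin N → ℂ) × (Fin N → ℂ)) :=
  ⟨{e | e.1 ∈ Ω}, Ω.isOpen.preimage continuous_fst⟩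

variable {Ω : Opens (Fin N → ℂ)}

/-- The exponential of the phase. -/
def expPhase : hol (cyl Ω) :=
  holMk (fun e => Complex.exp (phase c lam e)) fun e _ => (analyticAt_phase c lam e).cexp

/-- `G`, multiplied by the exponential of the phase, is represented by `a` on the configurations
over `Ω`. -/
def Represents (G : Ket S) (a : hol (cyl Ω)) : Prop :=
  ∀ e : cyl Ω, Complex.exp (phase c lam e) * G (conf c lam e) = evalAt e a

variable {c lam}

/-- With `P` the phase, `e^P (∂P + ∂) e^{-P} = ∂`: the creation part `w = ∂P` of a field is absorbed
by the conjugation. Differentiability of `G` along the slice comes from the analytic representative.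
-/
theorem Represents.exp_mul_ann {G : Ket S} {a : hol (cyl Ω)} (h : Represents c lam G a)
    (e : cyl Ω) (d : (Fin N → ℂ) × (Fin N → ℂ)) {w : ℂ}
    (hw : HasDerivAt (fun t : ℂ => phase c lam (e + t • d)) w 0) :
    Complex.exp (phase c lam e) * (w * G (conf c lam e) + ann (conf c lam d) G (conf c lam e)) =
      evalAt e (holD d a) := by
  have hcont : Filter.Tendsto (fun t : ℂ => (e : (Fin N → ℂ) × (Fin N → ℂ)) + t • d) (𝓝 0)
      (𝓝 (e : (Fin N → ℂ) × (Fin N → ℂ))) := by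
    have : Continuous fun t : ℂ => (e : (Fin N → ℂ) × (Fin N → ℂ)) + t • d := by fun_prop
    simpa using this.tendsto 0
  have hev : (fun t : ℂ => G (conf c lam e + t • conf c lam d)) =ᶠ[𝓝 0]
      fun t => Complex.exp (-phase c lam (e + t • d)) * lift a (e + t • d) := by
    filter_upwards [hcont ((cyl Ω).isOpen.mem_nhds e.2)] with t ht
    have := h ⟨_, ht⟩
    rw [← lift_apply] at this
    simp only at this
    rw [← this, ← mul_assoc, ← Complex.exp_add, neg_add_cancel, Complex.exp_zero, one_mul,
      map_add, map_smul]
  have hd := (hw.fun_neg.cexp).fun_mul (hasDerivAt_lift_line a e d)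
  have h2 : ann (conf c lam d) G (conf c lam e) = _ :=
    (hd.congr_of_eventuallyEq hev).deriv
  have h3 : lift a (e : (Fin N → ℂ) × (Fin N → ℂ)) =
      Complex.exp (phase c lam e) * G (conf c lam e) := by
    rw [lift_apply, h e]
  have h4 : Complex.exp (phase c lam e) * Complex.exp (-phase c lam e) = 1 := by
    rw [← Complex.exp_add, add_neg_cancel, Complex.exp_zero]
  rw [h2]
  simp only [zero_smul, add_zero, h3]
  linear_combination (evalAt e (holD d a) -
    w * Complex.exp (phase c lam e) * G (conf c lam e)) * h4

theorem Represents.psiD {G : Ket S} {a : hol (cyl Ω)} (h : Represents c lam G a) (j : Fin N) :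
    Represents c lam (psiD c (lam j) G) (holD (dirZ j) a) := fun e => by
  rw [← h.exp_mul_ann e (dirZ j) (hasDerivAt_phase_dirZ c lam e j), conf_dirZ]
  rfl

theorem Represents.phi {G : Ket S} {a : hol (cyl Ω)} (h : Represents c lam G a) (j : Fin N) :
    Represents c lam (phi c (lam j) G) (holD (dirS j) a) := fun e => by
  rw [← h.exp_mul_ann e (dirS j) (hasDerivAt_phase_dirS c lam e j), conf_dirS, ← coordU_conf]
  rfl

theorem Represents.sum {ι : Type*} (s : Finset ι) {G : ι → Ket S} {a : ι → hol (cyl Ω)}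
    (h : ∀ i ∈ s, Represents c lam (G i) (a i)) :
    Represents c lam (fun e => ∑ i ∈ s, G i e) (∑ i ∈ s, a i) := fun e => by
  rw [Finset.mul_sum, map_sum]
  exact Finset.sum_congr rfl fun i hi => h i hi e

theorem Represents.iterate_phi {G : Ket S} {a : hol (cyl Ω)} (h : Represents c lam G a)
    (j : Fin N) (p : ℕ) :
    Represents c lam ((DualFields.phi c (lam j))^[p] G) ((⇑(holD (dirS j)))^[p] a) := by
  induction p with
  | zero => exact h
  | succ p ih =>
    rw [Function.iterate_succ_apply', Function.iterate_succ_apply']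
    exact ih.phi j

theorem Represents.taylorOp {G : Ket S} {a b : hol (cyl Ω)} (h : Represents c lam G a)
    (j : Fin N) (f : ℂ → ℂ)
    (hb : ∀ e, HasSum (fun p : ℕ => iteratedDeriv p f 0 / (p ! : ℂ) *
      evalAt e ((⇑(holD (dirS j)))^[p] a)) (evalAt e b)) :
    Represents c lam (taylorOp f (DualFields.phi c (lam j)) G) b := fun e => by
  rw [← (hb e).tsum_eq, DualFields.taylorOp, ← tsum_mul_left]
  refine tsum_congr fun p => ?_
  rw [← h.iterate_phi j p e]
  ring

end Operators

/-! ### Powers of the field exponent. -/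

section FieldExponent

theorem hasSum_of_eq {ι : Type*} {u v : ι → ℂ} {a b : ℂ} (h : HasSum v b) (huv : ∀ p, u p = v p)
    (hab : a = b) : HasSum u a := by
  rw [hab, funext huv]
  exact h

open TopologicalSpace Topology

variable {S : Set ℂ} {N : ℕ} (c : ℝ) (lam : Fin N → S) {Ω : Opens (Fin N → ℂ)}

/-- `xiSum` as a continuous linear form. -/
def xiForm (m : S) : (Fin N → ℂ) →L[ℂ] ℂ :=
  ∑ k, xi c (lam k) m • (ContinuousLinearMap.proj k : (Fin N → ℂ) →L[ℂ] ℂ)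

theorem xiForm_apply (m : S) (z : Fin N → ℂ) : xiForm c lam m z = xiSum c lam z m := by
  simp [xiForm, xiSum, mul_comm]

theorem xiForm_single (m : S) (i : Fin N) :
    xiForm c lam m (Pi.single i 1) = xi c (lam i) m := by
  rw [xiForm_apply]
  simp [xiSum, Pi.single_apply]

theorem analyticAt_xiSum (m : S) (z : Fin N → ℂ) :
    AnalyticAt ℂ (fun z => xiSum c lam z m) z := by
  simp only [← xiForm_apply]
  exact (xiForm c lam m).analyticAt z

/-- The function `z ↦ f (∑ₘ zₘ ξ(λₘ, λ_j))`. -/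
def compXi (j : Fin N) {f : ℂ → ℂ} {r : ℝ} (hf : DifferentiableOn ℂ f (Metric.ball 0 r))
    (hΩ : ∀ z ∈ Ω, ‖xiSum c lam z (lam j)‖ < r) : hol Ω :=
  holMk (fun z => f (xiSum c lam z (lam j))) fun z hz =>
    AnalyticAt.fun_comp (hf.analyticAt (Metric.isOpen_ball.mem_nhds (by simpa using hΩ z hz)))
      (analyticAt_xiSum c lam (lam j) z)

/-- The function `z ↦ ∑ₘ zₘ ξ(λₘ, λ_j)`. -/
def xiHol (j : Fin N) : hol Ω :=
  holMk (fun z => xiSum c lam z (lam j)) fun z _ => analyticAt_xiSum c lam (lam j) z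

theorem holD_compXi (j i : Fin N) {f : ℂ → ℂ} {r : ℝ}
    (hf : DifferentiableOn ℂ f (Metric.ball 0 r))
    (hΩ : ∀ z ∈ Ω, ‖xiSum c lam z (lam j)‖ < r) :
    holD (Pi.single i 1) (compXi c lam j hf hΩ) = xi c (lam i) (lam j) •
      compXi c lam j (hf.deriv Metric.isOpen_ball) hΩ := by
  refine hol_ext fun z => ?_
  have h1 : HasDerivAt f (deriv f (xiForm c lam (lam j) z)) (xiForm c lam (lam j) z) :=
    (hf.differentiableAt (Metric.isOpen_ball.mem_nhds
      (by simpa [xiForm_apply] using hΩ z z.2))).hasDerivAt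
  rw [evalAt_holD_of_hasFDerivAt (G := f ∘ xiForm c lam (lam j)) (Pi.single i 1)
    (fun z => by rw [Function.comp_apply, xiForm_apply]; rfl)
    (h1.comp_hasFDerivAt (z : Fin N → ℂ) (xiForm c lam (lam j)).hasFDerivAt)]
  rw [map_smul, smul_apply, xiForm_single, smul_eq_mul, smul_eq_mul, mul_comm,
    xiForm_apply]
  rfl

theorem holD_xiHol (j i : Fin N) :
    holD (Pi.single i 1) (xiHol c lam j : hol Ω) = algebraMap ℂ _ (xi c (lam i) (lam j)) := by
  refine hol_ext fun z => ?_
  rw [evalAt_holD_of_hasFDerivAt (G := xiForm c lam (lam j)) (Pi.single i 1)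
    (fun z => by rw [xiForm_apply]; rfl) (xiForm c lam (lam j)).hasFDerivAt, xiForm_single]
  simp

theorem fst_mem_of_mem_cyl (e : (Fin N → ℂ) × (Fin N → ℂ)) (he : e ∈ cyl Ω) :
    ContinuousLinearMap.fst ℂ (Fin N → ℂ) (Fin N → ℂ) e ∈ Ω := he

/-- Functions on `Ω` as functions on the cylinder over `Ω`. -/
def toCyl : hol Ω →ₐ[ℂ] hol (cyl Ω) :=
  pullback (ContinuousLinearMap.fst ℂ (Fin N → ℂ) (Fin N → ℂ)) fst_mem_of_mem_cyl

theorem holD_dirS_toCyl (j : Fin N) (y : hol Ω) : holD (dirS j) (toCyl y) = 0 := by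
  refine (holD_pullback _ _ _ _).trans (hol_ext fun e => ?_)
  rw [evalAt_pullback, evalAt_holD]
  simp [dirS]

theorem holD_dirZ_toCyl (j : Fin N) (y : hol Ω) :
    holD (dirZ j) (toCyl y) = toCyl (holD (Pi.single j 1) y) :=
  holD_pullback _ _ _ _

theorem holD_dirS_expPhase (j : Fin N) :
    holD (dirS j) (expPhase c lam : hol (cyl Ω)) = toCyl (xiHol c lam j) * expPhase c lam := by
  refine hol_ext fun e => ?_
  have h1 := hasDerivAt_lift_line (expPhase c lam : hol (cyl Ω)) e (dirS j)
  have h2 := (hasDerivAt_phase_dirS c lam e j).cexp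
  have hcont : Filter.Tendsto (fun t : ℂ => (e : (Fin N → ℂ) × (Fin N → ℂ)) + t • dirS j) (𝓝 0)
      (𝓝 (e : (Fin N → ℂ) × (Fin N → ℂ))) := by
    have : Continuous fun t : ℂ => (e : (Fin N → ℂ) × (Fin N → ℂ)) + t • dirS j := by fun_prop
    simpa using this.tendsto 0
  have hev : (fun t : ℂ => lift (expPhase c lam : hol (cyl Ω)) (e + t • dirS j)) =ᶠ[𝓝 0]
      fun t => Complex.exp (phase c lam (e + t • dirS j)) := by
    filter_upwards [hcont ((cyl Ω).isOpen.mem_nhds e.2)] with t ht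
    exact lift_apply _ ⟨_, ht⟩
  rw [h1.unique (h2.congr_of_eventuallyEq hev), map_mul, mul_comm]
  simp only [zero_smul, add_zero]
  rfl

/-- The `s`-derivative commutes with the `z`-derivatives, does not see functions of `z`, and brings
down `∑ z_m ξ(λ_m, λ_j)` from the exponential. So powers of `φ(λ_j)` become multiplications
performed before all `z`-derivatives. -/
theorem iterate_holD_dirS (j : Fin N) (m : Fin N →₀ ℕ) (y : hol Ω) (p : ℕ) :
    (⇑(holD (W := cyl Ω) (dirS j)))^[p] (diffMonomial (holDs dirZ) m
      (expPhase c lam * toCyl y)) =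
      diffMonomial (holDs dirZ) m (toCyl (xiHol c lam j) ^ p * (expPhase c lam * toCyl y)) := by
  have hcomm : ∀ (m : Fin N →₀ ℕ) (a : hol (cyl Ω)), holD (dirS j) (diffMonomial (holDs dirZ) m a) =
      diffMonomial (holDs dirZ) m (holD (dirS j) a) := by
    intro m a
    induction m using multiIndex_induction with
    | h0 => rw [diffMonomial_zero]; rfl
    | h1 m i ih =>
      rw [diffMonomial_add_single (holDs_comm dirZ), Module.End.mul_apply, Module.End.mul_apply,
        ← ih]
      exact holD_comm _ _ _
  induction p with
  | zero => simp
  | succ p ih =>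
    rw [Function.iterate_succ_apply', ih, hcomm]
    congr 1
    simp only [Derivation.leibniz, Derivation.leibniz_pow, holD_dirS_toCyl, holD_dirS_expPhase,
      smul_eq_mul]
    ring

variable {c lam}

/-- Termwise differentiation of the Taylor series of `f`, without uniform convergence: one
derivative of `f(∑ z_m ξ) Q` reduces the claim for `m + single i 1` to the claim at `m` for `(f, ∂_i
Q)` and `(f', Q)`. Hence `f` and `Q` stay general in the induction. -/
theorem hasSum_diffMonomial_compXi (j : Fin N) {r : ℝ}
    (hΩ : ∀ z ∈ Ω, ‖xiSum c lam z (lam j)‖ < r) (m : Fin N →₀ ℕ) (e : cyl Ω) {f : ℂ → ℂ}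
    (hf : DifferentiableOn ℂ f (Metric.ball 0 r)) (Q : hol (cyl Ω)) :
    HasSum (fun p : ℕ => iteratedDeriv p f 0 / (p ! : ℂ) *
      evalAt e (diffMonomial (holDs dirZ) m (toCyl (xiHol c lam j) ^ p * Q)))
      (evalAt e (diffMonomial (holDs dirZ) m (toCyl (compXi c lam j hf hΩ) * Q))) := by
  induction m using multiIndex_induction generalizing f Q with
  | h0 =>
    have h1 : xiSum c lam (e : (Fin N → ℂ) × (Fin N → ℂ)).1 (lam j) ∈ Metric.ball (0 : ℂ) r := by
      simpa using hΩ _ e.2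
    have h2 := (Complex.hasSum_taylorSeries_on_ball hf h1).mul_right (evalAt e Q)
    simp only [diffMonomial_zero, Module.End.one_apply, map_mul, map_pow]
    refine hasSum_of_eq h2 (fun p => ?_) rfl
    have : evalAt e (toCyl (xiHol c lam j)) =
      xiSum c lam (e : (Fin N → ℂ) × (Fin N → ℂ)).1 (lam j) := rfl
    rw [this, sub_zero, smul_eq_mul, smul_eq_mul]
    ring
  | h1 m i ih =>
    have hstep : ∀ a : hol (cyl Ω), diffMonomial (holDs dirZ) (m + Finsupp.single i 1) a =
        diffMonomial (holDs dirZ) m (holD (dirZ i) a) := by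
      intro a
      rw [diffMonomial_add_single (holDs_comm dirZ)]
      exact (diffMonomial_apply_comm (holDs_comm dirZ) m i a).symm
    have h1 := ih hf (holD (dirZ i) Q)
    have h2 := (ih (hf.deriv Metric.isOpen_ball) Q).mul_left (xi c (lam i) (lam j))
    have h3 : HasSum (fun p : ℕ => iteratedDeriv p f 0 / (p ! : ℂ) * (xi c (lam i) (lam j) *
        (p * evalAt e (diffMonomial (holDs dirZ) m (toCyl (xiHol c lam j) ^ (p - 1) * Q)))))
        (xi c (lam i) (lam j) * evalAt e (diffMonomial (holDs dirZ) m
          (toCyl (compXi c lam j (hf.deriv Metric.isOpen_ball) hΩ) * Q))) := by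
      -- The `p = 0` term carries the factor `p`, so the truncated `p - 1` is harmless there;
      -- dropping it turns the series of `f` into that of `f'`.
      rw [← hasSum_nat_add_iff' 1]
      simp only [Finset.range_one, Finset.sum_singleton, Nat.cast_zero, zero_mul, mul_zero,
        sub_zero, Nat.add_sub_cancel]
      refine hasSum_of_eq h2 (fun p => ?_) rfl
      rw [← iteratedDeriv_succ', Nat.factorial_succ]
      have hp : (p ! : ℂ) ≠ 0 := Nat.cast_ne_zero.2 (Nat.factorial_ne_zero _)
      have hp1 : ((p + 1 : ℕ) : ℂ) ≠ 0 := Nat.cast_ne_zero.2 (Nat.succ_ne_zero _)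
      rw [Nat.cast_mul]
      field_simp
    simp only [hstep]
    refine hasSum_of_eq (h1.add h3) (fun p => ?_) ?_
    · rw [Derivation.leibniz, Derivation.leibniz_pow, holD_dirZ_toCyl, holD_xiHol,
        AlgHom.commutes, smul_eq_mul, smul_eq_mul, smul_eq_mul, map_add, map_add]
      have : Q * (p • (toCyl (xiHol c lam j) ^ (p - 1) *
          algebraMap ℂ (hol (cyl Ω)) (xi c (lam i) (lam j)))) =
          ((p : ℂ) * xi c (lam i) (lam j)) • (toCyl (xiHol c lam j) ^ (p - 1) * Q) := by
        rw [nsmul_eq_mul, Algebra.smul_def, map_mul, map_natCast]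
        ring
      rw [this, map_smul, map_smul, smul_eq_mul]
      ring
    · rw [Derivation.leibniz, holD_dirZ_toCyl, holD_compXi, map_smul, smul_eq_mul, smul_eq_mul,
        map_add, map_add, mul_smul_comm, map_smul, map_smul, smul_eq_mul, mul_comm Q]

variable (c lam)

/-- The linear map that sends the monomial `X ^ m` to `∂^m (exp(phase) g ^ m y)`. -/
def symbolMap (g : Fin N → hol Ω) (y : hol Ω) : MvPolynomial (Fin N) ℂ →ₗ[ℂ] hol (cyl Ω) :=
  (MvPolynomial.basisMonomials (Fin N) ℂ).constr ℂ fun m =>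
    diffMonomial (holDs dirZ) m (expPhase c lam * toCyl ((∏ k, g k ^ m k) * y))

theorem symbolMap_monomial (g : Fin N → hol Ω) (y : hol Ω) (m : Fin N →₀ ℕ) (a : ℂ) :
    symbolMap c lam g y (MvPolynomial.monomial m a) =
      a • diffMonomial (holDs dirZ) m (expPhase c lam * toCyl ((∏ k, g k ^ m k) * y)) := by
  have : MvPolynomial.monomial m a = a • MvPolynomial.basisMonomials (Fin N) ℂ m := by
    rw [MvPolynomial.coe_basisMonomials, MvPolynomial.smul_monomial, smul_eq_mul, mul_one]
  rw [this, map_smul, symbolMap, Module.Basis.constr_basis]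

/-- The factor `f_k(φ(λ_k))` replaces `y` by `g k * y` and `ψ'(λ_k)` differentiates in `z_k`;
together they multiply the symbol by `X k`. The `n`-th power of the field exponent thus has symbol
`(∑ X k) ^ n`. -/
theorem holD_symbolMap (g : Fin N → hol Ω) (y : hol Ω) (k : Fin N) (p : MvPolynomial (Fin N) ℂ) :
    holD (dirZ k) (symbolMap c lam g (g k * y) p) =
      symbolMap c lam g y (MvPolynomial.X k * p) := by
  induction p using MvPolynomial.induction_on' with
  | monomial m a =>
    rw [MvPolynomial.X, MvPolynomial.monomial_mul, one_mul, symbolMap_monomial,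
      symbolMap_monomial, Derivation.map_smul, add_comm, diffMonomial_add_single (holDs_comm dirZ),
      prod_pow_add_single, mul_assoc]
    rfl
  | add p q hp hq => rw [map_add, map_add, hp, hq, mul_add, map_add]

variable {c lam}

theorem hasSum_symbolMap {r : Fin N → ℝ} (hΩ : ∀ k, ∀ z ∈ Ω, ‖xiSum c lam z (lam k)‖ < r k)
    {f : Fin N → ℂ → ℂ} (hf : ∀ k, DifferentiableOn ℂ (f k) (Metric.ball 0 (r k))) (y : hol Ω)
    (k : Fin N) (p : MvPolynomial (Fin N) ℂ) (e : cyl Ω) :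
    HasSum (fun q : ℕ => iteratedDeriv q (f k) 0 / (q ! : ℂ) *
      evalAt e ((⇑(holD (dirS k)))^[q]
        (symbolMap c lam (fun k => compXi c lam k (hf k) (hΩ k)) y p)))
      (evalAt e (symbolMap c lam (fun k => compXi c lam k (hf k) (hΩ k))
        (compXi c lam k (hf k) (hΩ k) * y) p)) := by
  have hlin : ∀ q, (⇑(holD (W := cyl Ω) (dirS k)))^[q] =
      ⇑(((holD (W := cyl Ω) (dirS k) : hol (cyl Ω) →ₗ[ℂ] hol (cyl Ω)) :
        Module.End ℂ (hol (cyl Ω))) ^ q) := fun q => by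
    rw [Module.End.coe_pow]; rfl
  induction p using MvPolynomial.induction_on' with
  | monomial m a =>
    rw [symbolMap_monomial, symbolMap_monomial, map_smul, smul_eq_mul]
    have h := (hasSum_diffMonomial_compXi k (hΩ k) m e (hf k) (expPhase c lam *
      toCyl ((∏ k, compXi c lam k (hf k) (hΩ k) ^ m k) * y))).mul_left a
    refine hasSum_of_eq h (fun q => ?_) ?_
    · rw [← iterate_holD_dirS, hlin, map_smul, map_smul, smul_eq_mul]
      ring
    · congr 3
      simp only [map_mul]
      ring
  | add p q hp hq =>
    simp only [hlin, map_add, mul_add] at hp hq ⊢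
    exact hp.add hq

theorem Represents.iterate_fieldExponent {r : Fin N → ℝ}
    (hΩ : ∀ k, ∀ z ∈ Ω, ‖xiSum c lam z (lam k)‖ < r k)
    {f : Fin N → ℂ → ℂ} (hf : ∀ k, DifferentiableOn ℂ (f k) (Metric.ball 0 (r k))) {y : hol Ω}
    {G : Ket S} (hG : Represents c lam G (expPhase c lam * toCyl y)) (n : ℕ) :
    Represents c lam ((fieldExponent c lam f)^[n] G)
      (symbolMap c lam (fun k => compXi c lam k (hf k) (hΩ k)) y
        ((∑ k, MvPolynomial.X k) ^ n)) := by
  induction n with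
  | zero =>
    rw [pow_zero, Function.iterate_zero_apply, ← MvPolynomial.C_1, MvPolynomial.C_apply,
      symbolMap_monomial]
    simpa [diffMonomial_zero] using hG
  | succ n ih =>
    rw [Function.iterate_succ_apply', pow_succ', Finset.sum_mul, map_sum]
    refine Represents.sum _ fun k _ => ?_
    rw [← holD_symbolMap]
    exact (ih.taylorOp k (f k) fun e => hasSum_symbolMap hΩ hf y k _ e).psiD k

end FieldExponent

/-! ### Mean values as Taylor coefficients at the origin. -/

section MeanValues

open TopologicalSpace Topology

variable {S : Set ℂ} {N : ℕ} (c : ℝ) (lam : Fin N → S) {Ω : Opens (Fin N → ℂ)}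

theorem mem_cyl_of_mem (z : Fin N → ℂ) (hz : z ∈ Ω) :
    ContinuousLinearMap.inl ℂ (Fin N → ℂ) (Fin N → ℂ) z ∈ cyl Ω := hz

/-- Restriction of functions on the cylinder over `Ω` to `Ω × {0}`. -/
def ofCyl : hol (cyl Ω) →ₐ[ℂ] hol Ω :=
  pullback (ContinuousLinearMap.inl ℂ (Fin N → ℂ) (Fin N → ℂ)) mem_cyl_of_mem

theorem ofCyl_toCyl (y : hol Ω) : ofCyl (toCyl y) = y := rfl

/-- The coordinate directions of `ℂ^N`. -/
def coordDir (i : Fin N) : Fin N → ℂ := Pi.single i 1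

theorem ofCyl_diffMonomial (m : Fin N →₀ ℕ) (a : hol (cyl Ω)) :
    ofCyl (diffMonomial (holDs dirZ) m a) = diffMonomial (holDs coordDir) m (ofCyl a) :=
  (diffMonomial_pullback _ _ _ _ _).symm

/-- The Taylor series at the origin of a function on `Ω`. -/
def taylorZero (h0 : (0 : Fin N → ℂ) ∈ Ω) : hol Ω →ₐ[ℂ] MvPowerSeries (Fin N) ℂ :=
  taylorHom (holDs_comm coordDir) (evalAt ⟨0, h0⟩)

/-- The function `z ↦ exp(½ ∑ z_j z_k η(λ_j, λ_k))` times `y`: the mean value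
`(0| exp{∑ z_k ψ'(λ_k)} F |0)` when `y` comes from `F`. -/
def gaussMul (y : hol Ω) : hol Ω := ofCyl (expPhase c lam) * y

variable {c lam}

theorem Represents.dualVac_eq {G : Ket S} {a : hol (cyl Ω)} (h : Represents c lam G a)
    (h0 : (0 : Fin N → ℂ) ∈ Ω) : dualVac G = evalAt ⟨0, h0⟩ (ofCyl a) := by
  have h1 := h ⟨0, h0⟩
  simp only [phase_zero, Complex.exp_zero, one_mul, map_zero] at h1
  exact h1

/-- By the multinomial theorem `(∑ X_k)^n / n!` is the sum of `X^m / m!` over `|m| = n`, and `∂^m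
(g^m K)(0) / m!` is the coefficient of `z^m` in `g^m K`. -/
theorem expTerm_fieldExponent_of_represents {r : Fin N → ℝ}
    (hΩ : ∀ k, ∀ z ∈ Ω, ‖xiSum c lam z (lam k)‖ < r k)
    {f : Fin N → ℂ → ℂ} (hf : ∀ k, DifferentiableOn ℂ (f k) (Metric.ball 0 (r k))) {y : hol Ω}
    {G : Ket S} (hG : Represents c lam G (expPhase c lam * toCyl y))
    (h0 : (0 : Fin N → ℂ) ∈ Ω) (n : ℕ) :
    expTerm (fieldExponent c lam f) G n =
      ∑ m ∈ Finset.piAntidiag Finset.univ n,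
        lagrangeTerm (fun k => taylorZero h0 (compXi c lam k (hf k) (hΩ k)))
          (taylorZero h0 (gaussMul c lam y)) (Finsupp.equivFunOnFinite.symm m) := by
  rw [expTerm, (Represents.iterate_fieldExponent hΩ hf hG n).dualVac_eq h0,
    Finset.sum_pow_eq_sum_piAntidiag, map_sum, map_sum, map_sum, Finset.sum_div]
  refine Finset.sum_congr rfl fun m hm => ?_
  set m' : Fin N →₀ ℕ := Finsupp.equivFunOnFinite.symm m with hm'
  have hmon : (Nat.multinomial Finset.univ m : MvPolynomial (Fin N) ℂ) *
      ∏ i, MvPolynomial.X i ^ m i =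
      MvPolynomial.monomial m' (Nat.multinomial Finset.univ m : ℂ) := by
    rw [MvPolynomial.monomial_eq, map_natCast]
    congr 1
    rw [Finsupp.prod_fintype _ _ (by simp)]
    rfl
  have hfac : multiFactorial m' * (Nat.multinomial Finset.univ m : ℂ) = (n ! : ℂ) := by
    have := Nat.multinomial_spec Finset.univ m
    rw [(Finset.mem_piAntidiag.1 hm).1] at this
    rw [← this, Nat.cast_mul, Nat.cast_prod]
    rfl
  have hn : (n ! : ℂ) ≠ 0 := Nat.cast_ne_zero.2 (Nat.factorial_ne_zero _)
  have hm0 := multiFactorial_ne_zero m'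
  rw [hmon, symbolMap_monomial, map_smul, map_smul, ofCyl_diffMonomial, lagrangeTerm]
  simp only [← map_pow, ← map_prod, ← map_mul]
  rw [taylorZero, coeff_taylorHom]
  have harg : ofCyl (expPhase c lam *
      toCyl ((∏ k, compXi c lam k (hf k) (hΩ k) ^ m' k) * y)) =
      (∏ k, compXi c lam k (hf k) (hΩ k) ^ m' k) * gaussMul c lam y := by
    rw [map_mul, ofCyl_toCyl, gaussMul]
    ring
  rw [harg, smul_eq_mul, div_eq_div_iff hn hm0, ← hfac]
  ring

theorem represents_functionalKet (F : (S → ℂ) → (S → ℂ) → ℂ)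
    (hF : AnalyticOnNhd ℂ (fun z : Fin N → ℂ => F (xiSum c lam z) (xiTSum c lam z)) Ω) :
    Represents c lam (functionalKet F) (expPhase c lam * toCyl (holMk _ hF)) := fun e => by
  rw [functionalKet, conf_fst, conf_snd_fst, map_mul]
  rfl

theorem Represents.iterate_numberExponent {G : Ket S} {a : hol (cyl Ω)}
    (h : Represents c lam G a) (z : Fin N → ℂ) (n : ℕ) :
    Represents c lam ((numberExponent c lam z)^[n] G) ((⇑(holD (W := cyl Ω) (z, 0)))^[n] a) := by
  have hz : ∀ a : hol (cyl Ω), holD (z, 0) a = ∑ k, z k • holD (dirZ k) a := by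
    intro a
    refine hol_ext fun e => ?_
    have hzd : ((z, 0) : (Fin N → ℂ) × (Fin N → ℂ)) = ∑ k, z k • dirZ k := by
      ext i <;> simp [dirZ, Prod.fst_sum, Prod.snd_sum, Finset.sum_apply, Pi.single_apply]
    simp only [map_sum, map_smul, evalAt_holD]
    rw [hzd, map_sum]
    simp only [map_smul]
  induction n with
  | zero => exact h
  | succ n ih =>
    rw [Function.iterate_succ_apply', Function.iterate_succ_apply', hz]
    refine Represents.sum _ fun k _ e => ?_
    rw [map_smul, ← ih.psiD k e, smul_eq_mul]
    ring

theorem ofCyl_iterate_holD (z : Fin N → ℂ) (n : ℕ) (a : hol (cyl Ω)) :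
    ofCyl ((⇑(holD (W := cyl Ω) (z, 0)))^[n] a) = (⇑(holD (W := Ω) z))^[n] (ofCyl a) := by
  induction n with
  | zero => rfl
  | succ n ih =>
    rw [Function.iterate_succ_apply', Function.iterate_succ_apply', ← ih]
    exact (holD_pullback _ _ _ _).symm

/-- The mean value of the exponential of a numerical combination of the fields `ψ'`. -/
theorem hasSum_expTerm_numberExponent (F : (S → ℂ) → (S → ℂ) → ℂ)
    (hF : AnalyticOnNhd ℂ (fun z : Fin N → ℂ => F (xiSum c lam z) (xiTSum c lam z)) Ω)
    (hΩ : Balanced ℂ (Ω : Set (Fin N → ℂ))) (z : Fin N → ℂ) (hz : z ∈ Ω) :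
    HasSum (expTerm (numberExponent c lam z) (functionalKet F))
      (Complex.exp (phase c lam (z, 0)) * F (xiSum c lam z) (xiTSum c lam z)) := by
  have h0 : (0 : Fin N → ℂ) ∈ Ω := by
    simpa using hΩ.smul_mem (a := (0 : ℂ)) (by simp) hz
  set b : hol Ω := gaussMul c lam (holMk _ hF) with hb
  -- The exponent acts as the derivative in the direction `z`, so the terms are those of the Taylor
  -- series of `t ↦ b (t • z)` at `t = 1`. Openness gives `(1 + ε/2) • z ∈ Ω`, and balancedness then
  -- gives a disc of analyticity with `1` in its interior.
  have hU : IsOpen {t : ℂ | t • z ∈ Ω} :=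
    Ω.isOpen.preimage (by fun_prop : Continuous fun t : ℂ => t • z)
  obtain ⟨ε, hε, hball⟩ := Metric.isOpen_iff.1 hU 1 (by simpa using hz)
  have ht0 : ((1 + ε / 2 : ℝ) : ℂ) • z ∈ Ω := by
    apply hball
    rw [Metric.mem_ball, dist_eq_norm]
    push_cast
    rw [add_sub_cancel_left, show (ε / 2 : ℂ) = ((ε / 2 : ℝ) : ℂ) by push_cast; ring,
      Complex.norm_real, Real.norm_of_nonneg (by positivity)]
    linarith
  have hmem : ∀ t ∈ Metric.ball (0 : ℂ) (1 + ε / 2), t • z ∈ Ω := by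
    intro t ht
    have hne : ((1 + ε / 2 : ℝ) : ℂ) ≠ 0 := by exact_mod_cast (by positivity : 1 + ε / 2 ≠ 0)
    have h1 : t • z = (t / ((1 + ε / 2 : ℝ) : ℂ)) • (((1 + ε / 2 : ℝ) : ℂ) • z) := by
      rw [smul_smul, div_mul_cancel₀ _ hne]
    rw [h1]
    refine hΩ.smul_mem ?_ ht0
    rw [norm_div, Complex.norm_real, Real.norm_of_nonneg (by positivity)]
    exact div_le_one_of_le₀ (le_of_lt (by simpa using ht)) (by positivity)
  have hd : DifferentiableOn ℂ (fun t : ℂ => lift b (t • z)) (Metric.ball 0 (1 + ε / 2)) := by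
    intro t ht
    have h1 : DifferentiableAt ℂ (lift b) (t • z) :=
      (analyticAt_lift b ⟨t • z, hmem t ht⟩).differentiableAt
    exact (h1.comp t (by fun_prop : DifferentiableAt ℂ (fun t : ℂ => t • z) t)).differentiableWithinAt
  have hiter : ∀ n, iteratedDeriv n (fun t : ℂ => lift b (t • z)) 0 =
      evalAt ⟨0, h0⟩ ((⇑(holD (W := Ω) z))^[n] b) := by
    intro n
    simpa using iteratedDeriv_lift_line b 0 z n 0 (by simpa using h0)
  have hsum := Complex.hasSum_taylorSeries_on_ball hd (z := 1)
    (by simpa using by linarith)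
  refine hasSum_of_eq hsum (fun n => ?_) ?_
  · rw [expTerm, ((represents_functionalKet F hF).iterate_numberExponent z n).dualVac_eq h0,
      ofCyl_iterate_holD, hiter n]
    simp only [sub_zero, one_pow, one_mul, smul_eq_mul]
    rw [map_mul, ofCyl_toCyl, div_eq_inv_mul]
    rfl
  · rw [one_smul]
    exact (lift_apply b ⟨z, hz⟩).symm

end MeanValues

/-! ### Cauchy estimates on polydiscs and sums over multi-indices. -/

section CauchyEstimates

open TopologicalSpace Topology

variable {N : ℕ} {Ω : Opens (Fin N → ℂ)}

/-- The closed polydisc of polyradius `ρ`. -/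
def polydisc (ρ : Fin N → ℝ) : Set (Fin N → ℂ) := {z | ∀ k, ‖z k‖ ≤ ρ k}

theorem zero_mem_polydisc {ρ : Fin N → ℝ} (hρ : ∀ k, 0 < ρ k) : (0 : Fin N → ℂ) ∈ polydisc ρ :=
  fun k => by simpa using (hρ k).le

theorem isCompact_polydisc (ρ : Fin N → ℝ) : IsCompact (polydisc ρ) := by
  have : polydisc ρ = Set.univ.pi fun k => Metric.closedBall (0 : ℂ) (ρ k) := by
    ext z; simp [polydisc]
  rw [this]
  exact isCompact_univ_pi fun k => isCompact_closedBall _ _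

/-- The one-variable Cauchy estimate, one coordinate at a time. The coordinates still in the list
vanish at `z`, so a full disc of radius `ρ i` in direction `i` stays in the polydisc. -/
theorem norm_list_prod_holD_le {ρ : Fin N → ℝ} (hρ : ∀ k, 0 < ρ k) (hP : polydisc ρ ⊆ Ω)
    (b : hol Ω) {B : ℝ} (hb : ∀ z : Ω, (z : Fin N → ℂ) ∈ polydisc ρ → ‖evalAt z b‖ ≤ B)
    (m : Fin N →₀ ℕ) (l : List (Fin N)) (hl : l.Nodup) (z : Ω)
    (hz : (z : Fin N → ℂ) ∈ polydisc ρ) (hzl : ∀ i ∈ l, (z : Fin N → ℂ) i = 0) :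
    ‖evalAt z ((l.map fun i => ((holDs (W := Ω) coordDir i : hol Ω →ₗ[ℂ] hol Ω) : Module.End ℂ (hol Ω)) ^ m i).prod b)‖ ≤
      B * (l.map fun i => ((m i)! : ℝ) / ρ i ^ m i).prod := by
  induction l generalizing z with
  | nil => simpa using hb z hz
  | cons i l ih =>
    rw [List.nodup_cons] at hl
    set Q : hol Ω := (l.map fun i => ((holDs (W := Ω) coordDir i : hol Ω →ₗ[ℂ] hol Ω) : Module.End ℂ (hol Ω)) ^ m i).prod b with hQ
    have hmem : ∀ t : ℂ, ‖t‖ ≤ ρ i → (z : Fin N → ℂ) + t • coordDir i ∈ polydisc ρ := by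
      intro t ht k
      by_cases hk : k = i
      · subst hk
        simpa [coordDir, hzl k (by simp)] using ht
      · simpa [coordDir, hk] using hz k
    have hline : ∀ t : ℂ, ‖t‖ ≤ ρ i → ‖lift Q ((z : Fin N → ℂ) + t • coordDir i)‖ ≤
        B * (l.map fun i => ((m i)! : ℝ) / ρ i ^ m i).prod := by
      intro t ht
      rw [lift_apply Q ⟨_, hP (hmem t ht)⟩]
      refine ih hl.2 _ (hmem t ht) fun k hk => ?_
      have hki : k ≠ i := fun h => hl.1 (h ▸ hk)
      simpa [coordDir, hki] using hzl k (by simp [hk])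
    have hd : DiffContOnCl ℂ (fun t : ℂ => lift Q ((z : Fin N → ℂ) + t • coordDir i))
        (Metric.ball 0 (ρ i)) := by
      refine DifferentiableOn.diffContOnCl fun t ht => ?_
      rw [closure_ball _ (hρ i).ne', Metric.mem_closedBall, dist_zero_right] at ht
      have h1 := (analyticAt_lift Q ⟨_, hP (hmem t ht)⟩).differentiableAt
      exact (h1.comp t (by fun_prop : DifferentiableAt ℂ
        (fun t : ℂ => (z : Fin N → ℂ) + t • coordDir i) t)).differentiableWithinAt
    have hc := Complex.norm_iteratedDeriv_le_of_forall_mem_sphere_norm_le (m i) (hρ i) hd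
      fun t ht => hline t (mem_sphere_zero_iff_norm.1 ht).le
    have h0 : (z : Fin N → ℂ) + (0 : ℂ) • coordDir i ∈ Ω := by simp
    rw [iteratedDeriv_lift_line Q _ _ _ _ h0] at hc
    have hz0 : (⟨(z : Fin N → ℂ) + (0 : ℂ) • coordDir i, h0⟩ : Ω) = z := Subtype.ext (by simp)
    rw [hz0] at hc
    rw [List.map_cons, List.prod_cons, List.map_cons, List.prod_cons, Module.End.mul_apply,
      Module.End.pow_apply]
    refine hc.trans (le_of_eq ?_)
    ring

/-- Cauchy's estimate for the Taylor coefficients on a polydisc. -/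
theorem norm_coeff_taylorZero_le {ρ : Fin N → ℝ} (hρ : ∀ k, 0 < ρ k) (hP : polydisc ρ ⊆ Ω)
    (h0 : (0 : Fin N → ℂ) ∈ Ω)
    (b : hol Ω) {B : ℝ} (hb : ∀ z : Ω, (z : Fin N → ℂ) ∈ polydisc ρ → ‖evalAt z b‖ ≤ B)
    (m : Fin N →₀ ℕ) :
    ‖MvPowerSeries.coeff m (taylorZero h0 b)‖ ≤ B / ∏ k, ρ k ^ m k := by
  have h := norm_list_prod_holD_le hρ hP b hb m (List.finRange N) (List.nodup_finRange N) ⟨0, h0⟩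
    (zero_mem_polydisc hρ) fun _ _ => rfl
  have hp : ((List.finRange N).map fun i => ((m i)! : ℝ) / ρ i ^ m i).prod =
      ∏ k, ((m k)! : ℝ) / ρ k ^ m k := by
    rw [← List.ofFn_eq_map, List.prod_ofFn]
  rw [hp] at h
  rw [taylorZero, coeff_taylorHom, norm_div]
  have hm : ‖multiFactorial m‖ = ∏ k, ((m k)! : ℝ) := by
    simp [multiFactorial]
  have hpos : 0 < ∏ k, ((m k)! : ℝ) :=
    Finset.prod_pos fun k _ => by exact_mod_cast Nat.factorial_pos _
  rw [hm, div_le_iff₀ hpos]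
  refine h.trans (le_of_eq ?_)
  rw [Finset.prod_div_distrib]
  ring

theorem summable_prod_pow_fin {θ : ℝ} (h0 : 0 ≤ θ) (h1 : θ < 1) (n : ℕ) :
    Summable fun m : Fin n → ℕ => ∏ k, θ ^ m k := by
  induction n with
  | zero => exact (hasSum_fintype _).summable
  | succ n ih =>
    have h := (summable_geometric_of_lt_one h0 h1).mul_of_nonneg ih (fun _ => by positivity)
      fun m => by positivity
    rw [← (Fin.consEquiv fun _ : Fin (n + 1) => ℕ).summable_iff]
    refine h.congr fun p => ?_
    simp [Fin.prod_univ_succ, Fin.consEquiv]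

theorem summable_prod_pow {θ : ℝ} (h0 : 0 ≤ θ) (h1 : θ < 1) :
    Summable fun m : Fin N →₀ ℕ => ∏ k, θ ^ m k :=
  (Finsupp.equivFunOnFinite.summable_iff (f := fun m : Fin N → ℕ => ∏ k, θ ^ m k)).2
    (summable_prod_pow_fin h0 h1 N)

theorem hasSum_piAntidiag {u : (Fin N →₀ ℕ) → ℂ} {s : ℂ} (h : HasSum u s) :
    HasSum (fun n => ∑ m ∈ Finset.piAntidiag Finset.univ n,
      u (Finsupp.equivFunOnFinite.symm m)) s := by
  have h1 : HasSum (u ∘ Finsupp.equivFunOnFinite.symm) s :=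
    (Finsupp.equivFunOnFinite.symm.hasSum_iff).2 h
  have h2 := h1.tsum_fiberwise fun m : Fin N → ℕ => ∑ k, m k
  refine hasSum_of_eq h2 (fun n => ?_) rfl
  have hset : (fun m : Fin N → ℕ => ∑ k, m k) ⁻¹' {n} =
      (Finset.piAntidiag Finset.univ n : Finset (Fin N → ℕ)) := by
    ext m; simp
  rw [hset, Finset.tsum_subtype']
  rfl

end CauchyEstimates

/-! ### The Lagrange–Good sum as a functional, and the ideal it annihilates. -/

section LagrangeFunctional

open TopologicalSpace Topology

variable {N : ℕ} {Ω : Opens (Fin N → ℂ)}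

/-- The map `g` sends the closed polydisc of polyradius `ρ`, contained in `Ω`, into the polydisc of
polyradius `θ ρ`, where `θ < 1`. -/
structure Contracting (g : Fin N → hol Ω) (ρ : Fin N → ℝ) (θ : ℝ) : Prop where
  pos : ∀ k, 0 < ρ k
  subset : polydisc ρ ⊆ Ω
  nonneg : 0 ≤ θ
  lt_one : θ < 1
  bound : ∀ k, ∀ z : Ω, (z : Fin N → ℂ) ∈ polydisc ρ → ‖evalAt z (g k)‖ ≤ θ * ρ k

theorem exists_bound_on_polydisc {ρ : Fin N → ℝ} (hP : polydisc ρ ⊆ Ω) (K : hol Ω) :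
    ∃ B, 0 ≤ B ∧ ∀ z : Ω, (z : Fin N → ℂ) ∈ polydisc ρ → ‖evalAt z K‖ ≤ B := by
  have hc : ContinuousOn (lift K) (polydisc ρ) := fun z hz =>
    (analyticAt_lift K ⟨z, hP hz⟩).continuousAt.continuousWithinAt
  obtain ⟨B, hB⟩ := (isCompact_polydisc ρ).exists_bound_of_continuousOn hc
  refine ⟨max B 0, le_max_right _ _, fun z hz => ?_⟩
  rw [← lift_apply]
  exact (hB z hz).trans (le_max_left _ _)

/-- The sum of the Lagrange–Good series `∑ₘ [z ^ m] (g ^ m K)`. -/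
def lagrangeSum (h0 : (0 : Fin N → ℂ) ∈ Ω) (g : Fin N → hol Ω) (K : hol Ω) : ℂ :=
  ∑' m, lagrangeTerm (fun k => taylorZero h0 (g k)) (taylorZero h0 K) m

variable {g : Fin N → hol Ω} {ρ : Fin N → ℝ} {θ : ℝ}

namespace Contracting

theorem zero_mem (h : Contracting g ρ θ) : (0 : Fin N → ℂ) ∈ Ω :=
  h.subset (zero_mem_polydisc h.pos)

/-- On the polydisc `g^m K` is bounded by `(θρ)^m B`; Cauchy's estimate divides by `ρ^m`. -/
theorem norm_lagrangeTerm_le (h : Contracting g ρ θ) (K : hol Ω) {B : ℝ}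
    (hB : ∀ z : Ω, (z : Fin N → ℂ) ∈ polydisc ρ → ‖evalAt z K‖ ≤ B) (m : Fin N →₀ ℕ) :
    ‖lagrangeTerm (fun k => taylorZero h.zero_mem (g k)) (taylorZero h.zero_mem K) m‖ ≤
      B * ∏ k, θ ^ m k := by
  rw [lagrangeTerm]
  simp only [← map_pow, ← map_prod, ← map_mul]
  have hpos : 0 < ∏ k, ρ k ^ m k := Finset.prod_pos fun k _ => pow_pos (h.pos k) _
  refine (norm_coeff_taylorZero_le h.pos h.subset h.zero_mem _ (B := (∏ k, (θ * ρ k) ^ m k) * B)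
    (fun z hz => ?_) m).trans (le_of_eq ?_)
  · rw [map_mul, map_prod, norm_mul, norm_prod]
    refine mul_le_mul ?_ (hB z hz) (norm_nonneg _) ?_
    · refine Finset.prod_le_prod (fun k _ => norm_nonneg _) fun k _ => ?_
      rw [map_pow, norm_pow]
      exact pow_le_pow_left₀ (norm_nonneg _) (h.bound k z hz) _
    · exact Finset.prod_nonneg fun k _ => pow_nonneg (mul_nonneg h.nonneg (h.pos k).le) _
  · simp only [mul_pow, Finset.prod_mul_distrib]
    field_simp

theorem summable_lagrangeTerm (h : Contracting g ρ θ) (K : hol Ω) :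
    Summable (lagrangeTerm (fun k => taylorZero h.zero_mem (g k)) (taylorZero h.zero_mem K)) := by
  obtain ⟨B, -, hB⟩ := exists_bound_on_polydisc h.subset K
  exact Summable.of_norm_bounded ((summable_prod_pow h.nonneg h.lt_one).mul_left B)
    (h.norm_lagrangeTerm_le K hB)

theorem norm_lagrangeSum_le (h : Contracting g ρ θ) (K : hol Ω) {B : ℝ}
    (hB : ∀ z : Ω, (z : Fin N → ℂ) ∈ polydisc ρ → ‖evalAt z K‖ ≤ B) :
    ‖lagrangeSum h.zero_mem g K‖ ≤ (∑' m : Fin N →₀ ℕ, ∏ k, θ ^ m k) * B := by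
  rw [mul_comm, ← tsum_mul_left]
  exact tsum_of_norm_bounded ((summable_prod_pow h.nonneg h.lt_one).mul_left B).hasSum
    (h.norm_lagrangeTerm_le K hB)

theorem lagrangeSum_add (h : Contracting g ρ θ) (K K' : hol Ω) :
    lagrangeSum h.zero_mem g (K + K') =
      lagrangeSum h.zero_mem g K + lagrangeSum h.zero_mem g K' := by
  rw [lagrangeSum, lagrangeSum, lagrangeSum,
    ← (h.summable_lagrangeTerm K).tsum_add (h.summable_lagrangeTerm K')]
  refine tsum_congr fun m => ?_
  simp only [lagrangeTerm, map_add, mul_add]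

theorem lagrangeSum_smul (h : Contracting g ρ θ) (a : ℂ) (K : hol Ω) :
    lagrangeSum h.zero_mem g (a • K) = a * lagrangeSum h.zero_mem g K := by
  rw [lagrangeSum, lagrangeSum, ← tsum_mul_left]
  refine tsum_congr fun m => ?_
  rw [lagrangeTerm, map_smul, mul_smul_comm, map_smul, smul_eq_mul, lagrangeTerm]

theorem lagrangeSum_zero (h : Contracting g ρ θ) : lagrangeSum h.zero_mem g 0 = 0 := by
  simpa using h.lagrangeSum_smul 0 0

theorem lagrangeSum_sub (h : Contracting g ρ θ) (K K' : hol Ω) :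
    lagrangeSum h.zero_mem g (K - K') =
      lagrangeSum h.zero_mem g K - lagrangeSum h.zero_mem g K' := by
  have := h.lagrangeSum_add (K - K') K'
  rw [sub_add_cancel] at this
  rw [this, add_sub_cancel_right]

theorem lagrangeSum_sum (h : Contracting g ρ θ) {ι : Type*} (s : Finset ι) (K : ι → hol Ω) :
    lagrangeSum h.zero_mem g (∑ i ∈ s, K i) = ∑ i ∈ s, lagrangeSum h.zero_mem g (K i) := by
  classical
  induction s using Finset.induction_on with
  | empty => simpa using h.lagrangeSum_zero
  | insert i s hi ih => rw [Finset.sum_insert hi, Finset.sum_insert hi, h.lagrangeSum_add, ih]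

/-- The largest ideal on which the Lagrange–Good sum vanishes. -/
def ideal (h : Contracting g ρ θ) : Ideal (hol Ω) where
  carrier := {K | ∀ K', lagrangeSum h.zero_mem g (K * K') = 0}
  add_mem' := fun {a b} ha hb K' => by
    rw [add_mul, h.lagrangeSum_add, ha, hb, add_zero]
  zero_mem' := fun K' => by rw [zero_mul, h.lagrangeSum_zero]
  smul_mem' := fun a K hK K' => by
    rw [smul_eq_mul, mul_comm a, mul_assoc]
    exact hK _

theorem lagrangeSum_of_mem_ideal (h : Contracting g ρ θ) {K : hol Ω} (hK : K ∈ h.ideal) :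
    lagrangeSum h.zero_mem g K = 0 := by
  simpa using hK 1

end Contracting

/-- The coordinate function `z_j`. -/
def coordHol (j : Fin N) : hol Ω :=
  holMk (fun z => z j) fun z _ =>
    (ContinuousLinearMap.proj j : (Fin N → ℂ) →L[ℂ] ℂ).analyticAt z

theorem holD_coordHol (i j : Fin N) :
    holDs coordDir i (coordHol j : hol Ω) = algebraMap ℂ _ (if i = j then 1 else 0) := by
  refine hol_ext fun z => ?_
  have := evalAt_holD_of_hasFDerivAt (a := (coordHol j : hol Ω)) (e := z)
    (G := (ContinuousLinearMap.proj j : (Fin N → ℂ) →L[ℂ] ℂ)) (coordDir i) (fun _ => rfl)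
    (ContinuousLinearMap.proj j : (Fin N → ℂ) →L[ℂ] ℂ).hasFDerivAt
  refine this.trans ?_
  simp [coordDir, Pi.single_apply, eq_comm]

theorem taylorZero_coordHol (h0 : (0 : Fin N → ℂ) ∈ Ω) (j : Fin N) :
    taylorZero h0 (coordHol j) = MvPowerSeries.X j := by
  apply MvPowerSeries.pderiv.ext (R := ℂ)
  · intro i
    rw [taylorZero, ← taylorHom_deriv, holD_coordHol, AlgHom.commutes, MvPowerSeries.pderiv_X]
    simp [Pi.single_apply, apply_ite, eq_comm]
  · rw [← MvPowerSeries.coeff_zero_eq_constantCoeff_apply, taylorZero, coeff_taylorHom,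
      diffMonomial_zero, multiFactorial_zero, div_one, MvPowerSeries.constantCoeff_X]
    rfl

theorem Contracting.coordHol_sub_mem_ideal (h : Contracting g ρ θ) (j : Fin N) :
    coordHol j - g j ∈ h.ideal := fun K => by
  rw [sub_mul, h.lagrangeSum_sub, sub_eq_zero, lagrangeSum, lagrangeSum, map_mul,
    taylorZero_coordHol, tsum_lagrangeTerm_X_mul, map_mul]

theorem Contracting.lagrangeSum_det (h : Contracting g ρ θ) :
    lagrangeSum h.zero_mem g
      (Matrix.of fun j k : Fin N => (if j = k then 1 else 0) - holD (coordDir j) (g k)).det = 1 := by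
  have hD : ∀ j (a : hol Ω), taylorZero h.zero_mem (holD (coordDir j) a) =
      MvPowerSeries.pderiv ℂ j (taylorZero h.zero_mem a) := fun j a =>
    taylorHom_deriv (holDs_comm coordDir) _ j a
  rw [lagrangeSum, AlgHom.map_det]
  have hm : (taylorZero h.zero_mem).mapMatrix
      (Matrix.of fun j k : Fin N => (if j = k then 1 else 0) - holD (coordDir j) (g k)) =
      Matrix.of fun j k : Fin N => (if j = k then 1 else 0) -
        MvPowerSeries.pderiv ℂ j (taylorZero h.zero_mem (g k)) := by
    ext1 j k
    rw [AlgHom.mapMatrix_apply, Matrix.map_apply, Matrix.of_apply, Matrix.of_apply, map_sub, hD,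
      apply_ite (taylorZero h.zero_mem), map_one, map_zero]
  rw [hm]
  refine (hasSum_lagrangeTerm_det _ fun σ t => ?_).tsum_eq
  have : ∏ k ∈ t, MvPowerSeries.pderiv ℂ (σ k) (taylorZero h.zero_mem (g k)) =
      taylorZero h.zero_mem (∏ k ∈ t, holD (coordDir (σ k)) (g k)) := by
    rw [map_prod]
    exact Finset.prod_congr rfl fun k _ => (hD _ _).symm
  rw [this]
  exact h.summable_lagrangeTerm _

/-- A system of relations `e ≡ d e` with a small matrix `d` forces `e` into the ideal. -/
theorem Contracting.mem_ideal_of_small (h : Contracting g ρ θ) (e : Fin N → hol Ω)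
    (d : Fin N → Fin N → hol Ω) (hed : ∀ j, e j - ∑ m, d j m * e m ∈ h.ideal)
    (δ : Fin N → Fin N → ℝ)
    (hd : ∀ j m, ∀ z : Ω, (z : Fin N → ℂ) ∈ polydisc ρ → ‖evalAt z (d j m)‖ ≤ δ j m)
    {q : ℝ} (hq0 : 0 ≤ q) (hq : q < 1) (hδ : ∀ j, ∑ m, δ j m ≤ q) (j : Fin N) :
    e j ∈ h.ideal := by
  choose Eb hEb0 hEb using fun j => exists_bound_on_polydisc h.subset (e j)
  set A : ℝ := (∑' m : Fin N →₀ ℕ, ∏ k, θ ^ m k) * ∑ j, Eb j with hA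
  have hT : 0 ≤ ∑' m : Fin N →₀ ℕ, ∏ k, θ ^ m k :=
    tsum_nonneg fun m => Finset.prod_nonneg fun k _ => pow_nonneg h.nonneg _
  -- Each use of the relation moves a factor `d j m` into `K`, so the bound must hold for all `K` at
  -- once; the row sums of `δ` contribute one factor `q`. Letting `n → ∞` afterwards kills the sum.
  have key : ∀ (n : ℕ) (j : Fin N) (K : hol Ω) (B : ℝ), 0 ≤ B →
      (∀ z : Ω, (z : Fin N → ℂ) ∈ polydisc ρ → ‖evalAt z K‖ ≤ B) →
      ‖lagrangeSum h.zero_mem g (e j * K)‖ ≤ q ^ n * (A * B) := by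
    intro n
    induction n with
    | zero =>
      intro j K B hB hK
      refine (h.norm_lagrangeSum_le _ (B := (∑ j, Eb j) * B) fun z hz => ?_).trans
        (le_of_eq (by rw [hA]; ring))
      rw [map_mul, norm_mul]
      refine mul_le_mul ((hEb j z hz).trans ?_) (hK z hz) (norm_nonneg _)
        (Finset.sum_nonneg fun j _ => hEb0 j)
      exact Finset.single_le_sum (fun j _ => hEb0 j) (Finset.mem_univ j)
    | succ n ih =>
      intro j K B hB hK
      have h1 := hed j K
      rw [sub_mul, h.lagrangeSum_sub, sub_eq_zero, Finset.sum_mul, h.lagrangeSum_sum] at h1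
      have hA0 : 0 ≤ A := mul_nonneg hT (Finset.sum_nonneg fun j _ => hEb0 j)
      have hδ0 : ∀ m, 0 ≤ δ j m := fun m => (norm_nonneg _).trans
        (hd j m ⟨0, h.zero_mem⟩ (zero_mem_polydisc h.pos))
      rw [h1]
      calc ‖∑ m, lagrangeSum h.zero_mem g (d j m * e m * K)‖
          ≤ ∑ m, q ^ n * (A * (δ j m * B)) := by
            refine norm_sum_le_of_le _ fun m _ => ?_
            rw [mul_comm (d j m), mul_assoc]
            refine ih m _ _ (mul_nonneg (hδ0 m) hB) fun z hz => ?_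
            rw [map_mul, norm_mul]
            exact mul_le_mul (hd j m z hz) (hK z hz) (norm_nonneg _) (hδ0 m)
        _ = (∑ m, δ j m) * (q ^ n * (A * B)) := by
            rw [Finset.sum_mul]
            exact Finset.sum_congr rfl fun m _ => by ring
        _ ≤ q * (q ^ n * (A * B)) := by
            refine mul_le_mul_of_nonneg_right (hδ j) ?_
            positivity
        _ = q ^ (n + 1) * (A * B) := by ring
  intro K
  obtain ⟨B, hB, hK⟩ := exists_bound_on_polydisc h.subset K
  have hlim : Filter.Tendsto (fun n : ℕ => q ^ n * (A * B)) Filter.atTop (𝓝 0) := by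
    simpa using (tendsto_pow_atTop_nhds_zero_of_lt_one hq0 hq).mul_const (A * B)
  have h0 := ge_of_tendsto' hlim fun n => key n j K B hB hK
  exact norm_le_zero_iff.1 h0

end LagrangeFunctional

/-! ### The Lagrange–Good formula at weak coupling. -/

section LocalFormula

open TopologicalSpace Topology

variable {S : Set ℂ} {N : ℕ} {c : ℝ} {lam : Fin N → S}

theorem shift_apply_diag {V : Type*} [NormedAddCommGroup V] [NormedSpace ℂ V]
    (p : FormalMultilinearSeries ℂ V ℂ) (n : ℕ) (y : V) :
    (p.shift n fun _ => y) y = p (n + 1) fun _ => y := by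
  rw [FormalMultilinearSeries.shift]
  show p (n + 1) (Fin.snoc (fun _ : Fin n => y) y) = _
  congr 1
  funext i
  induction i using Fin.lastCases with
  | last => exact Fin.snoc_last _ _
  | cast i => exact Fin.snoc_castSucc _ _ _

/-- Hadamard's lemma for a convergent power series. -/
theorem exists_hadamard {V : Type*} [NormedAddCommGroup V] [NormedSpace ℂ V] {G : V → ℂ}
    {p : FormalMultilinearSeries ℂ V ℂ} {R : ENNReal} (hG : HasFPowerSeriesOnBall G p 0 R)
    (z₀ : V) (hz₀ : ‖z₀‖ₑ < R) :
    ∃ L : V → V →L[ℂ] ℂ, AnalyticOnNhd ℂ L (Metric.eball z₀ (R - ‖z₀‖ₑ)) ∧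
      ∀ z ∈ Metric.eball z₀ (R - ‖z₀‖ₑ), G z = G z₀ + L z (z - z₀) := by
  -- Expand about `z₀`. Dropping the constant term and splitting off one argument of each remaining
  -- term leaves a series of linear forms, whose sum is `L`.
  have hG' := hG.changeOrigin (y := z₀) hz₀
  rw [zero_add] at hG'
  generalize p.changeOrigin z₀ = p' at hG'
  have hpos : 0 < R - ‖z₀‖ₑ := tsub_pos_of_lt hz₀
  have hrad : R - ‖z₀‖ₑ ≤ p'.shift.radius := by
    rw [FormalMultilinearSeries.radius_shift]
    exact hG'.r_le
  have hL := ((p'.shift.hasFPowerSeriesOnBall (hpos.trans_le hrad)).mono hpos hrad).comp_sub z₀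
  rw [zero_add] at hL
  refine ⟨_, hL.analyticOnNhd, fun z hz => ?_⟩
  have h1 := hG'.hasSum_sub hz
  have h2 := hL.hasSum_sub hz
  have h3 := (ContinuousLinearMap.apply ℂ ℂ (z - z₀)).hasSum h2
  rw [← hasSum_nat_add_iff' 1] at h1
  have h4 : HasSum (fun n => p' (n + 1) fun _ => z - z₀) (p'.shift.sum (z - z₀) (z - z₀)) :=
    hasSum_of_eq h3 (fun n => (shift_apply_diag p' n _).symm) rfl
  have h5 := h4.unique h1
  rw [Finset.range_one, Finset.sum_singleton, hG'.coeff_zero] at h5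
  exact (add_eq_of_eq_sub' h5).symm

theorem norm_dslope_le {f : ℂ → ℂ} {r C : ℝ} (hf : DifferentiableOn ℂ f (Metric.ball 0 r))
    {s : ℝ} (hs : s < r) (hC : ∀ w ∈ Metric.closedBall (0 : ℂ) s, ‖deriv f w‖ ≤ C)
    {a w : ℂ} (ha : a ∈ Metric.closedBall (0 : ℂ) s) (hw : w ∈ Metric.closedBall (0 : ℂ) s) :
    ‖dslope f a w‖ ≤ C := by
  by_cases h : w = a
  · rw [h, dslope_same]; exact hC a ha
  · rw [dslope_of_ne _ h, slope_def_field, norm_div, div_le_iff₀ (norm_pos_iff.2 (sub_ne_zero.2 h))]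
    exact (convex_closedBall (0 : ℂ) s).norm_image_sub_le_of_norm_deriv_le
      (fun x hx => hf.differentiableAt (Metric.isOpen_ball.mem_nhds
        (Metric.closedBall_subset_ball hs hx))) hC ha hw

theorem xiSum_update (z : Fin N → ℂ) (j : Fin N) (t : ℂ) (m : S) :
    xiSum c lam (Function.update z j t) m = xiSum c lam z m + (t - z j) * xi c (lam j) m := by
  have : ∀ k, Function.update z j t k * xi c (lam k) m =
      z k * xi c (lam k) m + if k = j then (t - z j) * xi c (lam j) m else 0 := by
    intro k
    by_cases h : k = j
    · subst h; simp; ring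
    · simp [h]
  simp only [xiSum, this, Finset.sum_add_distrib]
  simp

theorem matM_apply {f : Fin N → ℂ → ℂ} {z : Fin N → ℂ} {k : Fin N}
    (hf : DifferentiableAt ℂ (f k) (xiSum c lam z (lam k))) (j : Fin N) :
    matM c lam f z j k = (if j = k then 1 else 0) -
      xi c (lam j) (lam k) * deriv (f k) (xiSum c lam z (lam k)) := by
  rw [matM, Matrix.of_apply]
  congr 1
  have h1 : HasDerivAt (fun t : ℂ => xiSum c lam (Function.update z j t) (lam k))
      (xi c (lam j) (lam k)) (z j) := by
    simp only [xiSum_update]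
    simpa using (((hasDerivAt_id (z j)).sub_const (z j)).mul_const
      (xi c (lam j) (lam k))).const_add (xiSum c lam z (lam k))
  have h2 : HasDerivAt (f k) (deriv (f k) (xiSum c lam z (lam k)))
      (xiSum c lam (Function.update z j (z j)) (lam k)) := by
    rw [Function.update_eq_self]; exact hf.hasDerivAt
  exact (h2.comp (z j) h1).deriv.trans (mul_comm _ _)

end LocalFormula

section LocalFormula

open TopologicalSpace Topology

variable {S : Set ℂ} {N : ℕ} {c : ℝ} {lam : Fin N → S} {Ω : Opens (Fin N → ℂ)}

theorem xiSum_sub (z z₀ : Fin N → ℂ) (m : S) :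
    xiSum c lam z m - xiSum c lam z₀ m = ∑ k, (z k - z₀ k) * xi c (lam k) m := by
  simp only [xiSum, ← Finset.sum_sub_distrib, sub_mul]

theorem evalAt_coordHol (z : Ω) (j : Fin N) : evalAt z (coordHol j) = (z : Fin N → ℂ) j := rfl

theorem evalAt_compXi {j : Fin N} {f : ℂ → ℂ} {r : ℝ}
    (hf : DifferentiableOn ℂ f (Metric.ball 0 r))
    (hΩ : ∀ z ∈ Ω, ‖xiSum c lam z (lam j)‖ < r) (z : Ω) :
    evalAt z (compXi c lam j hf hΩ) = f (xiSum c lam z (lam j)) := rfl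

/-- The Lagrange–Good formula for a system with small derivatives. -/
theorem det_matM_mul_lagrangeSum {r : Fin N → ℝ}
    (hΩ : ∀ k, ∀ z ∈ Ω, ‖xiSum c lam z (lam k)‖ < r k)
    {f : Fin N → ℂ → ℂ} (hf : ∀ k, DifferentiableOn ℂ (f k) (Metric.ball 0 (r k)))
    {ρ : Fin N → ℝ} {θ : ℝ}
    (hc : Contracting (fun k => compXi c lam k (hf k) (hΩ k)) ρ θ)
    (z₀ : Ω) (hz₀ : SolvesSystem c lam f z₀) (C : Fin N → ℝ)
    (hC : ∀ k, ∀ z : Ω, ‖dslope (f k) (xiSum c lam z₀ (lam k)) (xiSum c lam z (lam k))‖ ≤ C k)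
    {q : ℝ} (hq0 : 0 ≤ q) (hq : q < 1) (hCq : ∀ j, ∑ m, ‖xi c (lam m) (lam j)‖ * C j ≤ q)
    (H : hol Ω) (K : Fin N → hol Ω)
    (hK : ∀ z : Ω, evalAt z H = evalAt z₀ H +
      ∑ j, ((z : Fin N → ℂ) j - (z₀ : Fin N → ℂ) j) * evalAt z (K j)) :
    (matM c lam f z₀).det *
      lagrangeSum hc.zero_mem (fun k => compXi c lam k (hf k) (hΩ k)) H = evalAt z₀ H := by
  have ha : ∀ k, Metric.ball (0 : ℂ) (r k) ∈ 𝓝 (xiSum c lam (z₀ : Fin N → ℂ) (lam k)) := fun k =>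
    Metric.isOpen_ball.mem_nhds (by simpa using hΩ k z₀ z₀.2)
  set e : Fin N → hol Ω := fun j => coordHol j - algebraMap ℂ _ ((z₀ : Fin N → ℂ) j) with he
  have heval : ∀ (z : Ω) j, evalAt z (e j) = (z : Fin N → ℂ) j - (z₀ : Fin N → ℂ) j := by
    intro z j
    rw [he, map_sub, evalAt_coordHol, AlgHom.commutes]
    rfl
  have hslope : ∀ (u : ℂ → ℂ) (k : Fin N) (z : Ω),
      u (xiSum c lam z (lam k)) - u (xiSum c lam z₀ (lam k)) =
        ∑ m, xi c (lam m) (lam k) * dslope u (xiSum c lam z₀ (lam k)) (xiSum c lam z (lam k)) *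
          evalAt z (e m) := by
    intro u k z
    have := sub_smul_dslope u (xiSum c lam z₀ (lam k)) (xiSum c lam z (lam k))
    rw [← this, xiSum_sub, smul_eq_mul, Finset.sum_mul]
    refine Finset.sum_congr rfl fun m _ => ?_
    rw [heval]
    ring
  -- Modulo the ideal `z_j ≡ g_j`, while `g_j - z₀_j` is a combination of the `e m` with
  -- coefficients `ξ` times a difference quotient of `f j`. So `e ≡ d e` with a small matrix `d`.
  have heJ : ∀ j, e j ∈ hc.ideal := by
    refine hc.mem_ideal_of_small e (fun j m => xi c (lam m) (lam j) •
      compXi c lam j ((Complex.differentiableOn_dslope (ha j)).2 (hf j)) (hΩ j)) (fun j => ?_)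
      (fun j m => ‖xi c (lam m) (lam j)‖ * C j) (fun j m z _ => ?_) hq0 hq hCq
    · convert hc.coordHol_sub_mem_ideal j using 1
      refine hol_ext fun z => ?_
      have h1 := hslope (f j) j z
      rw [map_sub (evalAt z) (e j), heval, map_sum, map_sub, evalAt_coordHol]
      simp only [map_mul, map_smul, evalAt_compXi, smul_eq_mul]
      rw [← h1, ← hz₀ j]
      ring
    · rw [map_smul, norm_smul, evalAt_compXi]
      exact mul_le_mul_of_nonneg_left (hC j z) (norm_nonneg _)
  have hcompJ : ∀ (k : Fin N) {u : ℂ → ℂ} (hu : DifferentiableOn ℂ u (Metric.ball 0 (r k))),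
      compXi c lam k hu (hΩ k) - algebraMap ℂ _ (u (xiSum c lam z₀ (lam k))) ∈ hc.ideal := by
    intro k u hu
    have : compXi c lam k hu (hΩ k) - algebraMap ℂ _ (u (xiSum c lam z₀ (lam k))) =
        ∑ m, (xi c (lam m) (lam k) •
          compXi c lam k ((Complex.differentiableOn_dslope (ha k)).2 hu) (hΩ k)) * e m := by
      refine hol_ext fun z => ?_
      rw [map_sub, map_sum, AlgHom.commutes, evalAt_compXi]
      simp only [map_mul, map_smul, evalAt_compXi, smul_eq_mul]
      exact hslope u k z
    rw [this]
    exact Ideal.sum_mem _ fun m _ => Ideal.mul_mem_left _ _ (heJ m)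
  have hHJ : H - algebraMap ℂ _ (evalAt z₀ H) ∈ hc.ideal := by
    have : H - algebraMap ℂ _ (evalAt z₀ H) = ∑ j, K j * e j := by
      refine hol_ext fun z => ?_
      rw [map_sub, map_sum, AlgHom.commutes, hK z]
      simp only [map_mul, heval]
      rw [show algebraMap ℂ ℂ (evalAt z₀ H) = evalAt z₀ H from rfl, add_sub_cancel_left]
      exact Finset.sum_congr rfl fun j _ => mul_comm _ _
    rw [this]
    exact Ideal.sum_mem _ fun m _ => Ideal.mul_mem_left _ _ (heJ m)
  set Δ : hol Ω := (Matrix.of fun j k : Fin N => (if j = k then 1 else 0) -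
    holD (coordDir j) (compXi c lam k (hf k) (hΩ k))).det with hΔ
  -- The determinants are compared in the quotient ring, where each entry equals its value at `z₀`.
  have hΔJ : Δ - algebraMap ℂ _ (matM c lam f z₀).det ∈ hc.ideal := by
    rw [← Ideal.Quotient.eq, hΔ, RingHom.map_det, RingHom.map_det, RingHom.map_det]
    congr 1
    ext1 j k
    simp only [RingHom.mapMatrix_apply, Matrix.map_apply, Matrix.of_apply]
    rw [matM_apply (hf k |>.differentiableAt (ha k)), Ideal.Quotient.eq]
    have hD : holD (coordDir j) (compXi c lam k (hf k) (hΩ k)) = xi c (lam j) (lam k) •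
        compXi c lam k ((hf k).deriv Metric.isOpen_ball) (hΩ k) :=
      holD_compXi c lam k j (hf k) (hΩ k)
    have h1 := Ideal.mul_mem_left hc.ideal (-algebraMap ℂ _ (xi c (lam j) (lam k)))
      (hcompJ k ((hf k).deriv Metric.isOpen_ball))
    convert h1 using 1
    rw [hD, Algebra.smul_def, map_sub, map_mul, apply_ite (algebraMap ℂ (hol Ω)), map_one, map_zero]
    ring
  -- Both products are congruent to the constant `det M(z₀) H(z₀)`, and the sum of `Δ` is `1`.
  have hfin : (matM c lam f z₀).det • H - evalAt z₀ H • Δ ∈ hc.ideal := by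
    have : (matM c lam f z₀).det • H - evalAt z₀ H • Δ =
        algebraMap ℂ _ (matM c lam f z₀).det * (H - algebraMap ℂ _ (evalAt z₀ H)) -
        algebraMap ℂ _ (evalAt z₀ H) * (Δ - algebraMap ℂ _ (matM c lam f z₀).det) := by
      rw [Algebra.smul_def, Algebra.smul_def]
      ring
    rw [this]
    exact Ideal.sub_mem _ (Ideal.mul_mem_left _ _ hHJ) (Ideal.mul_mem_left _ _ hΔJ)
  have hzero := hc.lagrangeSum_of_mem_ideal hfin
  rw [hc.lagrangeSum_sub, hc.lagrangeSum_smul, hc.lagrangeSum_smul, hΔ, hc.lagrangeSum_det,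
    mul_one, sub_eq_zero] at hzero
  exact hzero

end LocalFormula

section LocalFormula

open TopologicalSpace Topology

variable {S : Set ℂ} {N : ℕ} {c : ℝ} {lam : Fin N → S}

variable (c lam) in
/-- The mean value `(0| exp{∑ z_k ψ'(λ_k)} F |0)` in closed form. -/
def gaussMean (F : (S → ℂ) → (S → ℂ) → ℂ) (z : Fin N → ℂ) : ℂ :=
  Complex.exp (phase c lam (z, 0)) * F (xiSum c lam z) (xiTSum c lam z)

theorem analyticAt_gaussMean {F : (S → ℂ) → (S → ℂ) → ℂ} {z : Fin N → ℂ}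
    (hF : AnalyticAt ℂ (fun z : Fin N → ℂ => F (xiSum c lam z) (xiTSum c lam z)) z) :
    AnalyticAt ℂ (gaussMean c lam F) z := by
  have h1 : AnalyticAt ℂ (fun z : Fin N → ℂ => phase c lam (z, 0)) z :=
    AnalyticAt.fun_comp (analyticAt_phase c lam _)
      ((ContinuousLinearMap.inl ℂ (Fin N → ℂ) (Fin N → ℂ)).analyticAt z)
  exact h1.cexp.mul hF

/-- The mean value of the exponential of the fields is a Lagrange–Good sum. -/
theorem hasSum_expTerm_fieldExponent {Ω : Opens (Fin N → ℂ)} {r : Fin N → ℝ}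
    (hΩ : ∀ k, ∀ z ∈ Ω, ‖xiSum c lam z (lam k)‖ < r k)
    {f : Fin N → ℂ → ℂ} (hf : ∀ k, DifferentiableOn ℂ (f k) (Metric.ball 0 (r k)))
    {F : (S → ℂ) → (S → ℂ) → ℂ}
    (hF : AnalyticOnNhd ℂ (fun z : Fin N → ℂ => F (xiSum c lam z) (xiTSum c lam z)) Ω)
    {ρ : Fin N → ℝ} {θ : ℝ}
    (hc : Contracting (fun k => compXi c lam k (hf k) (hΩ k)) ρ θ) :
    HasSum (expTerm (fieldExponent c lam f) (functionalKet F))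
      (lagrangeSum hc.zero_mem (fun k => compXi c lam k (hf k) (hΩ k))
        (gaussMul c lam (holMk _ hF))) := by
  refine hasSum_of_eq (hasSum_piAntidiag (hc.summable_lagrangeTerm _).hasSum) (fun n => ?_) rfl
  exact expTerm_fieldExponent_of_represents hΩ hf (represents_functionalKet F hF) hc.zero_mem n

theorem exists_bound_closedBall_half {f : ℂ → ℂ} {r : ℝ} (hr : 0 < r)
    (hf : DifferentiableOn ℂ f (Metric.ball 0 r)) :
    ∃ C, 0 ≤ C ∧ ∀ w ∈ Metric.closedBall (0 : ℂ) (r / 2), ‖f w‖ ≤ C := by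
  obtain ⟨C, hC⟩ := (isCompact_closedBall (0 : ℂ) (r / 2)).exists_bound_of_continuousOn
    (hf.continuousOn.mono (Metric.closedBall_subset_ball (half_lt_self hr)))
  exact ⟨max C 0, le_max_right _ _, fun w hw => (hC w hw).trans (le_max_left _ _)⟩

theorem exists_small_ball {r : Fin N → ℝ} (hr : ∀ k, 0 < r k) {F : (S → ℂ) → (S → ℂ) → ℂ}
    (hF : AnalyticAt ℂ (fun z : Fin N → ℂ => F (xiSum c lam z) (xiTSum c lam z)) 0)
    {R : ℝ} (hR : 0 < R) :
    ∃ s > 0, s ≤ R ∧ (∀ k, ∀ z ∈ Metric.ball (0 : Fin N → ℂ) s,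
        ‖xiSum c lam z (lam k)‖ < r k / 2) ∧
      AnalyticOnNhd ℂ (fun z : Fin N → ℂ => F (xiSum c lam z) (xiTSum c lam z))
        (Metric.ball 0 s) := by
  have h1 : ∀ᶠ z in 𝓝 (0 : Fin N → ℂ), ∀ k, ‖xiSum c lam z (lam k)‖ < r k / 2 := by
    refine Filter.eventually_all.2 fun k => ?_
    have hc : ContinuousAt (fun z : Fin N → ℂ => ‖xiSum c lam z (lam k)‖) 0 :=
      (analyticAt_xiSum c lam (lam k) 0).continuousAt.norm
    refine hc.eventually_lt continuousAt_const ?_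
    simpa [xiSum] using hr k
  obtain ⟨s, hs, hball⟩ := Metric.eventually_nhds_iff_ball.1 (h1.and hF.eventually_analyticAt)
  exact ⟨min s R, lt_min hs hR, min_le_right _ _,
    fun k z hz => (hball z (Metric.ball_subset_ball (min_le_left _ _) hz)).1 k,
    fun z hz => (hball z (Metric.ball_subset_ball (min_le_left _ _) hz)).2⟩

/-- The formula for weak coupling. -/
theorem exists_local_formula {f : Fin N → ℂ → ℂ} {r : Fin N → ℝ} (hr : ∀ k, 0 < r k)
    (hf : ∀ k, DifferentiableOn ℂ (f k) (Metric.ball 0 (r k)))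
    {F : (S → ℂ) → (S → ℂ) → ℂ}
    (hF : AnalyticAt ℂ (fun z : Fin N → ℂ => F (xiSum c lam z) (xiTSum c lam z)) 0) :
    ∃ δ > 0, ∃ ε > 0, ∀ α : ℂ, ‖α‖ < ε →
      Summable (expTerm (fieldExponent c lam fun k w => α * f k w) (functionalKet F)) ∧
      ∀ z₀ : Fin N → ℂ, ‖z₀‖ < δ → SolvesSystem c lam (fun k w => α * f k w) z₀ →
        (matM c lam (fun k w => α * f k w) z₀).det *
          expMean (fieldExponent c lam fun k w => α * f k w) (functionalKet F) =
          gaussMean c lam F z₀ := by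
  obtain ⟨p, R₀, hp⟩ := analyticAt_gaussMean hF
  obtain ⟨R, hR, hRR⟩ := ENNReal.lt_iff_exists_nnreal_btwn.1 hp.r_pos
  replace hp := hp.mono hR hRR.le
  have hR' : 0 < (R : ℝ) := by exact_mod_cast hR
  -- For `‖z‖ < s` and `‖z₀‖ < s/2`, one has `‖z - z₀‖ + ‖z₀‖ < 2s ≤ 2R/3 < R`, as the expansion
  -- about `z₀` requires.
  obtain ⟨s, hs, hsR, hx, hFs⟩ := exists_small_ball hr hF (R := R / 3) (by positivity)
  set Ω : Opens (Fin N → ℂ) := ⟨Metric.ball 0 s, Metric.isOpen_ball⟩ with hΩdef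
  have hΩ : ∀ k, ∀ z ∈ Ω, ‖xiSum c lam z (lam k)‖ < r k := fun k z hz =>
    (hx k z hz).trans (half_lt_self (hr k))
  have hhalf : ∀ k, ∀ z ∈ Ω, xiSum c lam z (lam k) ∈ Metric.closedBall (0 : ℂ) (r k / 2) :=
    fun k z hz => by simpa using (hx k z hz).le
  choose M hM0 hM using fun k => exists_bound_closedBall_half (hr k) (hf k)
  choose C hC0 hC using fun k => exists_bound_closedBall_half (hr k)
    ((hf k).deriv Metric.isOpen_ball)
  set δ := s / 2 with hδ
  have hδ0 : 0 < δ := half_pos hs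
  set A := ∑ k, M k with hA
  set B := ∑ j, ∑ m, ‖xi c (lam m) (lam j)‖ * C j with hB
  have hA0 : 0 ≤ A := Finset.sum_nonneg fun k _ => hM0 k
  have hB0 : 0 ≤ B := Finset.sum_nonneg fun j _ => Finset.sum_nonneg fun m _ =>
    mul_nonneg (norm_nonneg _) (hC0 j)
  -- The first bound makes `αf` contract the polydisc of radius `δ` with factor `1/2`; the second
  -- makes the row sums of difference quotients at most `1/2`. Adding `1` keeps the denominators
  -- positive.
  refine ⟨δ, hδ0, min (δ / (2 * (A + 1))) (1 / (2 * (B + 1))), by positivity, fun α hα => ?_⟩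
  have hαA : ‖α‖ * A ≤ δ / 2 := by
    have h1 : ‖α‖ ≤ δ / (2 * (A + 1)) := (hα.trans_le (min_le_left _ _)).le
    rw [le_div_iff₀ (by positivity)] at h1
    nlinarith [norm_nonneg α]
  have hαB : ‖α‖ * B ≤ 1 / 2 := by
    have h1 : ‖α‖ ≤ 1 / (2 * (B + 1)) := (hα.trans_le (min_le_right _ _)).le
    rw [le_div_iff₀ (by positivity)] at h1
    nlinarith [norm_nonneg α]
  have hαf : ∀ k, DifferentiableOn ℂ (fun w => α * f k w) (Metric.ball 0 (r k)) := fun k =>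
    (hf k).const_mul α
  have hpoly : polydisc (fun _ : Fin N => δ) ⊆ (Ω : Set (Fin N → ℂ)) := by
    intro z hz
    have : ‖z‖ ≤ δ := (pi_norm_le_iff_of_nonneg hδ0.le).2 hz
    show z ∈ Metric.ball 0 s
    rw [mem_ball_zero_iff]
    linarith
  have hcon : Contracting (fun k => compXi c lam k (hαf k) (hΩ k)) (fun _ => δ) (1 / 2) :=
    { pos := fun _ => hδ0
      subset := hpoly
      nonneg := by norm_num
      lt_one := by norm_num
      bound := fun k z _ => by
        rw [evalAt_compXi, norm_mul]
        have h1 := hM k _ (hhalf k z z.2)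
        have h2 : M k ≤ A := Finset.single_le_sum (fun k _ => hM0 k) (Finset.mem_univ k)
        have h3 := mul_le_mul_of_nonneg_left (h1.trans h2) (norm_nonneg α)
        linarith }
  have hsum := hasSum_expTerm_fieldExponent hΩ hαf hFs hcon
  refine ⟨hsum.summable, fun z₀ hz₀ hsol => ?_⟩
  have hz₀Ω : z₀ ∈ Ω := by
    show z₀ ∈ Metric.ball 0 s
    rw [mem_ball_zero_iff]
    linarith
  have hEball : ∀ z ∈ Ω, z ∈ Metric.eball z₀ ((R : ENNReal) - ‖z₀‖ₑ) := by
    intro z hz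
    have hz' : ‖z‖ < s := mem_ball_zero_iff.1 hz
    rw [Metric.mem_eball, lt_tsub_iff_right, edist_eq_enorm_sub]
    have h1 : ‖z - z₀‖ + ‖z₀‖ < R := by
      have := norm_sub_le z z₀
      linarith
    simp only [enorm_eq_nnnorm]
    exact_mod_cast h1
  have hz₀R : ‖z₀‖ₑ < (R : ENNReal) := by
    have h1 : ‖z₀‖ < R := by linarith
    simp only [enorm_eq_nnnorm]
    exact_mod_cast h1
  obtain ⟨L, hL, hLz⟩ := exists_hadamard hp z₀ hz₀R
  have hLa : ∀ j : Fin N, AnalyticOnNhd ℂ (fun z => L z (coordDir j)) Ω := fun j z hz =>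
    ((ContinuousLinearMap.apply ℂ ℂ (coordDir j)).analyticAt _).comp (hL z (hEball z hz))
  have key := det_matM_mul_lagrangeSum hΩ hαf hcon ⟨z₀, hz₀Ω⟩ hsol (fun k => ‖α‖ * C k)
    (fun k z => norm_dslope_le (hαf k) (half_lt_self (hr k)) (fun w hw => by
      rw [deriv_const_mul_field, norm_mul]
      exact mul_le_mul_of_nonneg_left (hC k w hw) (norm_nonneg _))
      (hhalf k z₀ hz₀Ω) (hhalf k z z.2)) (q := 1 / 2) (by norm_num) (by norm_num)
    (fun j => by
      have h1 : ∑ m, ‖xi c (lam m) (lam j)‖ * (‖α‖ * C j) =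
          ‖α‖ * ∑ m, ‖xi c (lam m) (lam j)‖ * C j := by
        rw [Finset.mul_sum]
        exact Finset.sum_congr rfl fun m _ => by ring
      rw [h1]
      refine le_trans (mul_le_mul_of_nonneg_left ?_ (norm_nonneg _)) hαB
      exact Finset.single_le_sum (f := fun j => ∑ m, ‖xi c (lam m) (lam j)‖ * C j)
        (fun j _ => Finset.sum_nonneg fun m _ => mul_nonneg (norm_nonneg _) (hC0 j))
        (Finset.mem_univ j))
    (gaussMul c lam (holMk _ hFs)) (fun j => holMk _ (hLa j)) (fun z => by
      have h1 : gaussMean c lam F z = gaussMean c lam F z₀ + L z (z - z₀) :=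
        hLz z (hEball z z.2)
      have h2 : (z : Fin N → ℂ) - z₀ = ∑ j, ((z : Fin N → ℂ) j - z₀ j) • coordDir j := by
        ext i
        simp [coordDir, Finset.sum_apply, Pi.single_apply]
      have h3 : L z (z - z₀) = ∑ j, ((z : Fin N → ℂ) j - z₀ j) * L z (coordDir j) := by
        rw [h2, map_sum]
        simp only [map_smul, smul_eq_mul]
      rw [h3] at h1
      exact h1)
  rw [expMean, hsum.tsum_eq]
  exact key

end LocalFormula

/-! ### Analytic continuation in the coupling constant. -/

section Continuation

open TopologicalSpace Topology

variable {S : Set ℂ} {N : ℕ} {c : ℝ} {lam : Fin N → S}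

theorem solvesSystem_iff {f : Fin N → ℂ → ℂ} {z : Fin N → ℂ} :
    SolvesSystem c lam f z ↔ (fun j => z j - f j (xiSum c lam z (lam j))) = 0 := by
  simp only [SolvesSystem, funext_iff, Pi.zero_apply, sub_eq_zero]

/-- The implicit function theorem for the system `z_j = α f_j(∑ z_m ξ(λ_m, λ_j))`. -/
theorem exists_implicit_solution {f : Fin N → ℂ → ℂ} {r : Fin N → ℝ}
    (hf : ∀ k, DifferentiableOn ℂ (f k) (Metric.ball 0 (r k))) {α₀ : ℂ} {z₀ : Fin N → ℂ}
    (hz₀ : ∀ k, ‖xiSum c lam z₀ (lam k)‖ < r k)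
    (hsol : SolvesSystem c lam (fun k w => α₀ * f k w) z₀)
    (hdet : (matM c lam (fun k w => α₀ * f k w) z₀).det ≠ 0) :
    ∃ ζ : ℂ → Fin N → ℂ, DifferentiableAt ℂ ζ α₀ ∧ ζ α₀ = z₀ ∧
      (∀ᶠ α in 𝓝 α₀, SolvesSystem c lam (fun k w => α * f k w) (ζ α)) ∧
      ∀ᶠ v : ℂ × (Fin N → ℂ) in 𝓝 (α₀, z₀),
        SolvesSystem c lam (fun k w => v.1 * f k w) v.2 → v.2 = ζ v.1 := by
  have hfa : ∀ k, AnalyticAt ℂ (f k) (xiSum c lam z₀ (lam k)) := fun k =>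
    (hf k).analyticAt (Metric.isOpen_ball.mem_nhds (by simpa using hz₀ k))
  set Q : ℂ × (Fin N → ℂ) → Fin N → ℂ := fun v j =>
    v.2 j - v.1 * f j (xiSum c lam v.2 (lam j)) with hQ
  have hQa : AnalyticAt ℂ Q (α₀, z₀) := by
    rw [analyticAt_pi_iff]
    intro j
    have h2 : AnalyticAt ℂ (fun v : ℂ × (Fin N → ℂ) => v.2) (α₀, z₀) := analyticAt_snd
    have h3 : AnalyticAt ℂ (fun v : ℂ × (Fin N → ℂ) => v.2 j) (α₀, z₀) :=
      AnalyticAt.fun_comp ((ContinuousLinearMap.proj j :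
        (Fin N → ℂ) →L[ℂ] ℂ).analyticAt _) h2
    have h4 : AnalyticAt ℂ (fun v : ℂ × (Fin N → ℂ) => xiSum c lam v.2 (lam j)) (α₀, z₀) :=
      AnalyticAt.fun_comp (g := fun z : Fin N → ℂ => xiSum c lam z (lam j))
        (analyticAt_xiSum c lam (lam j) z₀) h2
    exact h3.sub (analyticAt_fst.mul (AnalyticAt.fun_comp (hfa j) h4))
  have hQs := hQa.hasStrictFDerivAt
  set Q' := fderiv ℂ Q (α₀, z₀) with hQ'
  -- The partial derivative in `z` is `v ↦ v M`, because the rows of `M` are indexed by the variable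
  -- of differentiation.
  have hpart : ∀ v, (Q' ∘L .inr ℂ ℂ (Fin N → ℂ)) v =
      Matrix.vecMul v (matM c lam (fun k w => α₀ * f k w) z₀) := by
    intro v
    ext j
    have h1 : HasFDerivAt (fun z => Q (α₀, z) j)
        ((ContinuousLinearMap.proj j : (Fin N → ℂ) →L[ℂ] ℂ) ∘L
          (Q' ∘L .inr ℂ ℂ (Fin N → ℂ))) z₀ :=
      (ContinuousLinearMap.proj j : (Fin N → ℂ) →L[ℂ] ℂ).hasFDerivAt.comp z₀
        (hQs.hasFDerivAt.comp z₀ (hasFDerivAt_prodMk_right α₀ z₀))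
    have hd : DifferentiableAt ℂ (fun w => α₀ * f j w) (xiSum c lam z₀ (lam j)) :=
      (hfa j).differentiableAt.const_mul α₀
    have h2 : HasFDerivAt (fun z => Q (α₀, z) j)
        ((ContinuousLinearMap.proj j : (Fin N → ℂ) →L[ℂ] ℂ) -
          deriv (fun w => α₀ * f j w) (xiSum c lam z₀ (lam j)) • xiForm c lam (lam j)) z₀ := by
      have h3 : HasDerivAt (fun w => α₀ * f j w)
          (deriv (fun w => α₀ * f j w) (xiSum c lam z₀ (lam j))) (xiForm c lam (lam j) z₀) := by
        rw [xiForm_apply]; exact hd.hasDerivAt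
      have h4 := h3.comp_hasFDerivAt z₀ (xiForm c lam (lam j)).hasFDerivAt
      have h5 := (ContinuousLinearMap.proj j : (Fin N → ℂ) →L[ℂ] ℂ).hasFDerivAt.fun_sub
        (x := z₀) h4
      refine h5.congr_of_eventuallyEq (Filter.Eventually.of_forall fun z => ?_)
      simp [hQ, xiForm_apply]
    have h6 := congrArg (fun L : (Fin N → ℂ) →L[ℂ] ℂ => L v) (h1.unique h2)
    refine (show _ = _ from h6).trans ?_
    simp only [Matrix.vecMul, dotProduct, matM_apply (f := fun k w => α₀ * f k w) (k := j) hd]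
    simp [xiForm_apply, xiSum, mul_sub, Finset.sum_sub_distrib, Finset.mul_sum]
    exact Finset.sum_congr rfl fun k _ => by ring
  have hinj : Function.Injective (Q' ∘L .inr ℂ ℂ (Fin N → ℂ)) := by
    rw [injective_iff_map_eq_zero]
    intro v hv
    rw [hpart] at hv
    exact Matrix.eq_zero_of_vecMul_eq_zero hdet hv
  have hinv : (Q' ∘L .inr ℂ ℂ (Fin N → ℂ)).IsInvertible :=
    ⟨(LinearEquiv.ofInjectiveEndo (Q' ∘L .inr ℂ ℂ (Fin N → ℂ) :
      (Fin N → ℂ) →L[ℂ] (Fin N → ℂ)).toLinearMap hinj).toContinuousLinearEquiv, by ext; rfl⟩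
  have hzero : Q (α₀, z₀) = 0 := solvesSystem_iff.1 hsol
  have hiff := hQs.eventually_apply_eq_iff_implicitFunctionOfProdDomain hinv
  refine ⟨hQs.implicitFunctionOfProdDomain hinv, ?_, ?_, ?_, ?_⟩
  · exact (hQs.hasStrictFDerivAt_implicitFunctionOfProdDomain hinv).differentiableAt
  · exact hiff.self_of_nhds.1 rfl
  · filter_upwards [hQs.eventually_apply_implicitFunctionOfProdDomain hinv] with α hα
    exact solvesSystem_iff.2 (hα.trans hzero)
  · filter_upwards [hiff] with v hv hs
    exact (hv.1 ((solvesSystem_iff.1 hs).trans hzero.symm)).symm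

/-- Continuity keeps `z α` in the neighbourhood where the implicit function is the only solution, so
the two agree near `α₀`. -/
theorem differentiableAt_of_solves {f : Fin N → ℂ → ℂ} {r : Fin N → ℝ}
    (hf : ∀ k, DifferentiableOn ℂ (f k) (Metric.ball 0 (r k))) {z : ℂ → Fin N → ℂ} {α₀ : ℂ}
    (hz₀ : ∀ k, ‖xiSum c lam (z α₀) (lam k)‖ < r k)
    (hdet : (matM c lam (fun k w => α₀ * f k w) (z α₀)).det ≠ 0)
    (hcont : ContinuousAt z α₀)
    (hsol : ∀ᶠ α in 𝓝 α₀, SolvesSystem c lam (fun k w => α * f k w) (z α)) :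
    DifferentiableAt ℂ z α₀ := by
  obtain ⟨ζ, hζ, -, -, huniq⟩ := exists_implicit_solution hf hz₀ hsol.self_of_nhds hdet
  have h1 : Filter.Tendsto (fun α => (α, z α)) (𝓝 α₀) (𝓝 (α₀, z α₀)) :=
    (continuousAt_id.prodMk hcont).tendsto
  refine hζ.congr_of_eventuallyEq ?_
  filter_upwards [h1.eventually huniq, hsol] with α h2 h3
  exact h2 h3

theorem differentiableAt_det_matM {f : Fin N → ℂ → ℂ} {r : Fin N → ℝ}
    (hf : ∀ k, DifferentiableOn ℂ (f k) (Metric.ball 0 (r k))) {z : ℂ → Fin N → ℂ} {α₀ : ℂ}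
    (hz₀ : ∀ k, ‖xiSum c lam (z α₀) (lam k)‖ < r k) (hz : DifferentiableAt ℂ z α₀) :
    DifferentiableAt ℂ (fun α => (matM c lam (fun k w => α * f k w) (z α)).det) α₀ := by
  have hx : ∀ k, DifferentiableAt ℂ (fun α => xiSum c lam (z α) (lam k)) α₀ := fun k =>
    DifferentiableAt.comp (g := fun z : Fin N → ℂ => xiSum c lam z (lam k)) α₀
      (analyticAt_xiSum c lam (lam k) (z α₀)).differentiableAt hz
  have hmem : ∀ k, Metric.ball (0 : ℂ) (r k) ∈ 𝓝 (xiSum c lam (z α₀) (lam k)) := fun k =>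
    Metric.isOpen_ball.mem_nhds (by simpa using hz₀ k)
  have hev : ∀ᶠ α in 𝓝 α₀, ∀ k, xiSum c lam (z α) (lam k) ∈ Metric.ball (0 : ℂ) (r k) :=
    Filter.eventually_all.2 fun k => (hx k).continuousAt (hmem k)
  have hentry : ∀ j k, DifferentiableAt ℂ
      (fun α => matM c lam (fun k w => α * f k w) (z α) j k) α₀ := by
    intro j k
    have h1 : (fun α => matM c lam (fun k w => α * f k w) (z α) j k) =ᶠ[𝓝 α₀]
        fun α => (if j = k then 1 else 0) -
          xi c (lam j) (lam k) * (α * deriv (f k) (xiSum c lam (z α) (lam k))) := by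
      filter_upwards [hev] with α hα
      rw [matM_apply (((hf k).differentiableAt
        (Metric.isOpen_ball.mem_nhds (hα k))).const_mul α), deriv_const_mul_field]
    have h2 : DifferentiableAt ℂ (fun α => deriv (f k) (xiSum c lam (z α) (lam k))) α₀ :=
      DifferentiableAt.comp (g := deriv (f k)) α₀
        (((hf k).deriv Metric.isOpen_ball).differentiableAt (hmem k)) (hx k)
    refine DifferentiableAt.congr_of_eventuallyEq ?_ h1
    fun_prop
  simp only [Matrix.det_apply']
  fun_prop

/-- The `n`-th term involves only `g^m` with `|m| = n`, hence is homogeneous of degree `n` in `f`.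
This makes the mean value a power series in `α`. -/
theorem expTerm_fieldExponent_smul {f : Fin N → ℂ → ℂ} {r : Fin N → ℝ} (hr : ∀ k, 0 < r k)
    (hf : ∀ k, DifferentiableOn ℂ (f k) (Metric.ball 0 (r k)))
    {F : (S → ℂ) → (S → ℂ) → ℂ}
    (hF : AnalyticAt ℂ (fun z : Fin N → ℂ => F (xiSum c lam z) (xiTSum c lam z)) 0)
    (α : ℂ) (n : ℕ) :
    expTerm (fieldExponent c lam fun k w => α * f k w) (functionalKet F) n =
      α ^ n * expTerm (fieldExponent c lam f) (functionalKet F) n := by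
  obtain ⟨s, hs, -, hx, hFs⟩ := exists_small_ball hr hF one_pos
  set Ω : Opens (Fin N → ℂ) := ⟨Metric.ball 0 s, Metric.isOpen_ball⟩ with hΩdef
  have hΩ : ∀ k, ∀ z ∈ Ω, ‖xiSum c lam z (lam k)‖ < r k := fun k z hz =>
    (hx k z hz).trans (half_lt_self (hr k))
  have h0 : (0 : Fin N → ℂ) ∈ Ω := Metric.mem_ball_self hs
  have hrep := represents_functionalKet (Ω := Ω) F hFs
  rw [expTerm_fieldExponent_of_represents hΩ (fun k => (hf k).const_mul α) hrep h0,
    expTerm_fieldExponent_of_represents hΩ hf hrep h0, Finset.mul_sum]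
  refine Finset.sum_congr rfl fun m hm => ?_
  have h1 : ∀ k, compXi c lam k ((hf k).const_mul α) (hΩ k) =
      α • compXi c lam k (hf k) (hΩ k) := fun k => hol_ext fun z => by
    rw [map_smul, smul_eq_mul, evalAt_compXi, evalAt_compXi]
  have hm' : ∑ k, m k = n := (Finset.mem_piAntidiag.1 hm).1
  simp only [lagrangeTerm, h1, map_smul, smul_pow, Finsupp.equivFunOnFinite_symm_apply_apply]
  rw [Finset.prod_smul, Finset.prod_pow_eq_pow_sum, hm', smul_mul_assoc, map_smul, smul_eq_mul]

/-- Abel's theorem for an absolutely convergent power series, along a segment on which its germ at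
the origin continues analytically. -/
theorem tsum_eq_of_analytic_on_segment {a : ℕ → ℂ} {A : ℂ → ℂ} {α : ℂ}
    (hA : AnalyticOnNhd ℂ A (segment ℝ 0 α))
    (h0 : ∀ᶠ β in 𝓝 (0 : ℂ), HasSum (fun n => β ^ n * a n) (A β))
    (hs : Summable fun n => α ^ n * a n) : ∑' n, α ^ n * a n = A α := by
  have hs' : Summable fun n => ‖α ^ n * a n‖ := hs.norm
  -- Absolute convergence at `t = 1` dominates the series on the closed unit disc: `P` is
  -- holomorphic inside and continuous up to the boundary. The identity theorem gives equality on
  -- `[0, 1)`, continuity at `t = 1`.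
  set P : ℂ → ℂ := fun t => ∑' n, (t * α) ^ n * a n with hP
  have hbound : ∀ (n : ℕ) (t : ℂ), t ∈ Metric.closedBall (0 : ℂ) 1 →
      ‖(t * α) ^ n * a n‖ ≤ ‖α ^ n * a n‖ := by
    intro n t ht
    rw [mul_pow, mul_assoc, norm_mul, norm_pow]
    exact mul_le_of_le_one_left (norm_nonneg _)
      (pow_le_one₀ (norm_nonneg _) (by simpa using ht))
  have hPd : DifferentiableOn ℂ P (Metric.ball 0 1) :=
    Complex.differentiableOn_tsum_of_summable_norm hs'
      (fun n => by fun_prop) Metric.isOpen_ball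
      fun n t ht => hbound n t (Metric.ball_subset_closedBall ht)
  have hPc : ContinuousOn P (Metric.closedBall 0 1) :=
    continuousOn_tsum (fun n => by fun_prop) hs' hbound
  have hseg : ∀ t : ℝ, t ∈ Set.Icc (0 : ℝ) 1 → (t : ℂ) * α ∈ segment ℝ 0 α := by
    intro t ht
    refine ⟨1 - t, t, by linarith [ht.2], ht.1, by ring, ?_⟩
    simp
  have hB : ∀ t : ℝ, t ∈ Set.Icc (0 : ℝ) 1 → AnalyticAt ℂ (fun s : ℂ => A (s * α)) t :=
    fun t ht => AnalyticAt.fun_comp (hA _ (hseg t ht)) (analyticAt_id.mul analyticAt_const)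
  have hcast : ∀ t ∈ Set.Icc (0 : ℝ) 1, (t : ℂ) ∈ Metric.closedBall (0 : ℂ) 1 := by
    intro t ht
    simpa [abs_of_nonneg ht.1] using ht.2
  have hpre : IsPreconnected ((fun t : ℝ => (t : ℂ)) '' Set.Ico 0 1) :=
    isPreconnected_Ico.image _ Complex.continuous_ofReal.continuousOn
  have heq : Set.EqOn P (fun s => A (s * α)) ((fun t : ℝ => (t : ℂ)) '' Set.Ico 0 1) := by
    refine AnalyticOnNhd.eqOn_of_preconnected_of_eventuallyEq (𝕜 := ℂ) (z₀ := 0) ?_ ?_ hpre ?_ ?_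
    · rintro _ ⟨t, ht, rfl⟩
      refine hPd.analyticAt (Metric.isOpen_ball.mem_nhds ?_)
      simpa [abs_of_nonneg ht.1] using ht.2
    · rintro _ ⟨t, ht, rfl⟩
      exact hB t ⟨ht.1, ht.2.le⟩
    · exact ⟨0, ⟨le_rfl, one_pos⟩, by simp⟩
    · have hc : Filter.Tendsto (fun s : ℂ => s * α) (𝓝 0) (𝓝 0) := by
        have : Continuous fun s : ℂ => s * α := by fun_prop
        simpa using this.tendsto 0
      filter_upwards [hc.eventually h0] with s hs
      exact hs.tsum_eq
  have hEq : Set.EqOn (fun t : ℝ => P t) (fun t : ℝ => A (t * α)) (Set.Icc 0 1) := by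
    refine Set.EqOn.of_subset_closure (s := Set.Ico 0 1)
      (fun t ht => heq (Set.mem_image_of_mem _ ht)) ?_ ?_ Set.Ico_subset_Icc_self ?_
    · exact hPc.comp Complex.continuous_ofReal.continuousOn hcast
    · exact fun t ht => ((hB t ht).continuousAt.comp
        Complex.continuous_ofReal.continuousAt).continuousWithinAt
    · rw [closure_Ico zero_ne_one]
  have := hEq (Set.right_mem_Icc.2 zero_le_one)
  simpa [hP] using this

/-- The continuation of the mean value in the coupling constant. -/
theorem continuation {f : Fin N → ℂ → ℂ} {r : Fin N → ℝ}
    (hf : ∀ k, DifferentiableOn ℂ (f k) (Metric.ball 0 (r k)))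
    {F : (S → ℂ) → (S → ℂ) → ℂ} {D : Set (Fin N → ℂ)} (hDo : IsOpen D) (hDb : Balanced ℂ D)
    (hF : AnalyticOnNhd ℂ (fun z : Fin N → ℂ => F (xiSum c lam z) (xiTSum c lam z)) D)
    {U : Set ℂ} {z : ℂ → Fin N → ℂ} (hU : IsOpen U) (h0U : (0 : ℂ) ∈ U)
    (hzc : ContinuousOn z U) (hz0 : z 0 = 0)
    (hz : ∀ α ∈ U, z α ∈ D ∧ (∀ k, ‖xiSum c lam (z α) (lam k)‖ < r k) ∧
      SolvesSystem c lam (fun k w => α * f k w) (z α) ∧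
      (matM c lam (fun k w => α * f k w) (z α)).det ≠ 0) :
    ∃ A : ℂ → ℂ, AnalyticOnNhd ℂ A U ∧
      (∀ᶠ α in 𝓝 (0 : ℂ),
        HasSum (expTerm (fieldExponent c lam (fun k w => α * f k w)) (functionalKet F)) (A α)) ∧
      (∀ α : ℂ, segment ℝ 0 α ⊆ U →
        Summable (expTerm (fieldExponent c lam (fun k w => α * f k w)) (functionalKet F)) →
        expMean (fieldExponent c lam (fun k w => α * f k w)) (functionalKet F) = A α) ∧
      ∀ α ∈ U,
        Summable (expTerm (numberExponent c lam (z α)) (functionalKet F)) ∧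
        A α = expMean (numberExponent c lam (z α)) (functionalKet F) /
          (matM c lam (fun k w => α * f k w) (z α)).det := by
  have hr : ∀ k, 0 < r k := fun k => (norm_nonneg _).trans_lt ((hz 0 h0U).2.1 k)
  have hF0 : AnalyticAt ℂ (fun z : Fin N → ℂ => F (xiSum c lam z) (xiTSum c lam z)) 0 :=
    hF 0 (hz0 ▸ (hz 0 h0U).1)
  -- The continuation is defined by the right-hand side of the formula; the weak-coupling result
  -- identifies its germ at `0`.
  set A : ℂ → ℂ := fun α => gaussMean c lam F (z α) /
    (matM c lam (fun k w => α * f k w) (z α)).det with hA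
  have hAa : AnalyticOnNhd ℂ A U := by
    refine DifferentiableOn.analyticOnNhd (fun α hα => ?_) hU
    have hd : DifferentiableAt ℂ z α := differentiableAt_of_solves hf (hz α hα).2.1
      (hz α hα).2.2.2 (hzc.continuousAt (hU.mem_nhds hα))
      (by filter_upwards [hU.mem_nhds hα] with β hβ using (hz β hβ).2.2.1)
    exact (DifferentiableAt.fun_div
      (DifferentiableAt.comp (g := gaussMean c lam F) α
        (analyticAt_gaussMean (hF _ (hz α hα).1)).differentiableAt hd)
      (differentiableAt_det_matM hf (hz α hα).2.1 hd) (hz α hα).2.2.2).differentiableWithinAt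
  have hnear : ∀ᶠ α in 𝓝 (0 : ℂ),
      HasSum (expTerm (fieldExponent c lam (fun k w => α * f k w)) (functionalKet F)) (A α) := by
    obtain ⟨δ, hδ, ε, hε, hloc⟩ := exists_local_formula hr hf hF0
    have hzt : ∀ᶠ α in 𝓝 (0 : ℂ), ‖z α‖ < δ := by
      have h1 : ContinuousAt (fun α => ‖z α‖) 0 := (hzc.continuousAt (hU.mem_nhds h0U)).norm
      exact h1.eventually_lt continuousAt_const (by simpa [hz0] using hδ)
    filter_upwards [hzt, hU.mem_nhds h0U, Metric.ball_mem_nhds (0 : ℂ) hε] with α h1 h2 h3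
    obtain ⟨h4, h5⟩ := hloc α (by simpa using h3)
    have h6 := h5 (z α) h1 (hz α h2).2.2.1
    have h7 : A α = expMean (fieldExponent c lam fun k w => α * f k w) (functionalKet F) := by
      rw [hA]
      simp only
      rw [← h6, mul_div_cancel_left₀ _ (hz α h2).2.2.2]
    rw [h7]
    exact h4.hasSum
  refine ⟨A, hAa, hnear, fun α hseg hsum => ?_, fun α hα => ?_⟩
  · have hterm : ∀ β : ℂ, expTerm (fieldExponent c lam fun k w => β * f k w) (functionalKet F) =
        fun n => β ^ n * expTerm (fieldExponent c lam f) (functionalKet F) n := fun β =>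
      funext fun n => expTerm_fieldExponent_smul hr hf hF0 β n
    simp only [hterm] at hnear hsum
    rw [expMean, hterm]
    exact tsum_eq_of_analytic_on_segment (hAa.mono hseg) hnear hsum
  · have hsum := hasSum_expTerm_numberExponent (Ω := ⟨D, hDo⟩) F hF hDb (z α) (hz α hα).1
    refine ⟨hsum.summable, ?_⟩
    rw [expMean, hsum.tsum_eq]
    rfl

end Continuation

/-! ### The maximum principle and fixed points on a polydisc. -/

section Polydisc

open Topology

variable {N : ℕ} {ρ : Fin N → ℝ}

/-- The maximum principle on a polydisc: a bound on the distinguished boundary holds inside. -/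
theorem norm_le_of_norm_le_on_torus (hρ : ∀ k, 0 < ρ k) {h : (Fin N → ℂ) → ℂ}
    (hd : ∀ z ∈ polydisc ρ, DifferentiableAt ℂ h z) {C : ℝ}
    (hC : ∀ z : Fin N → ℂ, (∀ k, ‖z k‖ = ρ k) → ‖h z‖ ≤ C) :
    ∀ z ∈ polydisc ρ, ‖h z‖ ≤ C := by
  -- Coordinates are released from their circles one at a time, each by the one-variable maximum
  -- principle.
  suffices H : ∀ s : Finset (Fin N), ∀ z ∈ polydisc ρ, (∀ k ∉ s, ‖z k‖ = ρ k) → ‖h z‖ ≤ C from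
    fun z hz => H Finset.univ z hz fun k hk => absurd (Finset.mem_univ k) hk
  intro s
  induction s using Finset.induction_on with
  | empty => exact fun z _ hz => hC z fun k => hz k (Finset.notMem_empty k)
  | insert i s _ ih =>
    intro z hz hzs
    have hmem : ∀ t ∈ Metric.closedBall (0 : ℂ) (ρ i), Function.update z i t ∈ polydisc ρ := by
      intro t ht k
      by_cases hk : k = i
      · subst hk
        simpa using ht
      · simpa [hk] using hz k
    have hdc : DiffContOnCl ℂ (fun t => h (Function.update z i t)) (Metric.ball 0 (ρ i)) := by
      refine DifferentiableOn.diffContOnCl_ball (U := Metric.closedBall 0 (ρ i)) ?_ subset_rfl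
      intro t ht
      exact (DifferentiableAt.comp t (hd _ (hmem t ht))
        (hasDerivAt_update z i t).differentiableAt).differentiableWithinAt
    have hcl : z i ∈ closure (Metric.ball (0 : ℂ) (ρ i)) := by
      rw [closure_ball _ (hρ i).ne']
      simpa using hz i
    have := Complex.norm_le_of_forall_mem_frontier_norm_le Metric.isBounded_ball hdc
      (C := C) (fun t ht => ?_) hcl
    · simpa using this
    · rw [frontier_ball _ (hρ i).ne'] at ht
      refine ih _ (hmem t (Metric.sphere_subset_closedBall ht)) fun k hk => ?_
      by_cases hki : k = i
      · subst hki
        simpa using ht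
      · simpa [hki] using hzs k (by simp [hki, hk])

theorem polydisc_mem_nhds {a : Fin N → ℂ} (ha : ∀ k, ‖a k‖ < ρ k) : polydisc ρ ∈ 𝓝 a := by
  have h : ∀ k, ∀ᶠ z : Fin N → ℂ in 𝓝 a, ‖z k‖ < ρ k := fun k =>
    ContinuousAt.eventually_lt (continuousAt_apply k a).norm continuousAt_const (ha k)
  filter_upwards [Filter.eventually_all.2 h] with z hz k using (hz k).le

/-- The derivative at a fixed point of a holomorphic map of a polydisc into a smaller one does not
have the eigenvalue `1`. -/
theorem eq_zero_of_fixed_by_fderiv {G : (Fin N → ℂ) → Fin N → ℂ} {θ : ℝ}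
    (hρ : ∀ k, 0 < ρ k) (hθ : θ < 1)
    (hd : ∀ z ∈ polydisc ρ, DifferentiableAt ℂ G z)
    (hb : ∀ z ∈ polydisc ρ, ∀ k, ‖G z k‖ ≤ θ * ρ k) {a : Fin N → ℂ} (ha : a ∈ polydisc ρ)
    (hfix : G a = a) {L : (Fin N → ℂ) →L[ℂ] (Fin N → ℂ)} (hL : HasFDerivAt G L a)
    {v : Fin N → ℂ} (hv : L v = v) : v = 0 := by
  have hak : ∀ k, ‖a k‖ ≤ θ * ρ k := fun k => by simpa [hfix] using hb a ha k
  -- There is room to dilate `G` about `a` by `q = 1 + ε`: the dilated map `E` preserves the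
  -- polydisc because `(1 + ε)θ + εθ = 1 - (1 - θ)² ≤ 1`.
  set ε : ℝ := (1 - θ) / 2 with hε
  have hεpos : 0 < ε := by rw [hε]; linarith
  set q : ℂ := ((1 + ε : ℝ) : ℂ) with hq
  have hqn : ‖q‖ = 1 + ε := by
    rw [hq, Complex.norm_real, Real.norm_of_nonneg (by linarith)]
  set E : (Fin N → ℂ) → Fin N → ℂ := fun z => a + q • (G z - a) with hE
  have hEd : ∀ z ∈ polydisc ρ, DifferentiableAt ℂ E z := fun z hz =>
    (((hd z hz).sub_const a).const_smul q).const_add a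
  have hEL : HasFDerivAt E (q • L) a := ((hL.sub_const a).const_smul q).const_add a
  have hEa : E a = a := by simp [hE, hfix]
  have hEm : Set.MapsTo E (polydisc ρ) (polydisc ρ) := by
    intro z hz k
    have h1 : E z k = q * G z k - (ε : ℂ) * a k := by
      simp only [hE, hq, Pi.add_apply, Pi.smul_apply, Pi.sub_apply, smul_eq_mul]
      push_cast
      ring
    have h2 : ‖(ε : ℂ) * a k‖ ≤ ε * (θ * ρ k) := by
      rw [norm_mul, Complex.norm_real, Real.norm_of_nonneg hεpos.le]
      exact mul_le_mul_of_nonneg_left (hak k) hεpos.le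
    have h3 : ‖q * G z k‖ ≤ (1 + ε) * (θ * ρ k) := by
      rw [norm_mul, hqn]
      exact mul_le_mul_of_nonneg_left (hb z hz k) (by linarith)
    have h4 : (1 + ε) * θ + ε * θ ≤ 1 := by
      rw [hε]; nlinarith [sq_nonneg (1 - θ)]
    rw [h1]
    calc _ ≤ ‖q * G z k‖ + ‖(ε : ℂ) * a k‖ := norm_sub_le _ _
      _ ≤ ((1 + ε) * θ + ε * θ) * ρ k := by linarith
      _ ≤ ρ k := mul_le_of_le_one_left (hρ k).le h4
  have hitm : ∀ n, Set.MapsTo E^[n] (polydisc ρ) (polydisc ρ) := fun n => hEm.iterate n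
  have hitd : ∀ n, ∀ z ∈ polydisc ρ, DifferentiableAt ℂ E^[n] z := by
    intro n
    induction n with
    | zero => exact fun z _ => differentiableAt_id
    | succ n ih =>
      intro z hz
      rw [Function.iterate_succ']
      exact (hEd _ (hitm n hz)).comp z (ih z hz)
  have hpow : ∀ n, ((q • L) ^ n) v = q ^ n • v := by
    intro n
    induction n with
    | zero => simp
    | succ n ih =>
      rw [pow_succ', mul_apply_eq_comp, ih, map_smul]
      simp [hv, smul_smul, pow_succ]
  have hline : Continuous fun t : ℂ => a + t • v := by fun_prop
  have hnhds : polydisc ρ ∈ 𝓝 (a + (0 : ℂ) • v) := by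
    rw [zero_smul, add_zero]
    exact polydisc_mem_nhds fun k =>
      (hak k).trans_lt (by nlinarith [hρ k])
  obtain ⟨δ, hδ, hsub⟩ := Metric.nhds_basis_closedBall.mem_iff.1
    (hline.continuousAt.preimage_mem_nhds hnhds)
  -- A vector fixed by `L` is multiplied by `q^n` under the derivative of the `n`-th iterate of `E`,
  -- while all iterates are bounded by `ρ`; Cauchy's estimate is uniform in `n`.
  have hcauchy : ∀ (n : ℕ) (j : Fin N), (1 + ε) ^ n * ‖v j‖ ≤ ρ j / δ := by
    intro n j
    have hdc : DiffContOnCl ℂ (fun t : ℂ => E^[n] (a + t • v) j) (Metric.ball 0 δ) := by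
      refine DifferentiableOn.diffContOnCl_ball (U := Metric.closedBall 0 δ) ?_ subset_rfl
      intro t ht
      have h1 : DifferentiableAt ℂ (fun t : ℂ => E^[n] (a + t • v)) t :=
        DifferentiableAt.comp t (hitd n _ (hsub ht)) (by fun_prop)
      exact (differentiableAt_pi.1 h1 j).differentiableWithinAt
    have hder : HasDerivAt (fun t : ℂ => E^[n] (a + t • v) j) (q ^ n * v j) 0 := by
      have h1 : HasDerivAt (fun t : ℂ => a + t • v) v 0 := by
        simpa using ((hasDerivAt_id (0 : ℂ)).smul_const v).const_add a
      have h2 : HasFDerivAt E^[n] ((q • L) ^ n) (a + (0 : ℂ) • v) := by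
        simpa using hEL.iterate hEa n
      have h3 := hasDerivAt_pi.1 (h2.comp_hasDerivAt (0 : ℂ) h1) j
      rw [hpow] at h3
      exact h3
    have := Complex.norm_deriv_le_of_forall_mem_sphere_norm_le hδ hdc (C := ρ j) fun t ht =>
      hitm n (hsub (Metric.sphere_subset_closedBall ht)) j
    rwa [hder.deriv, norm_mul, norm_pow, hqn] at this
  ext j
  by_contra hj
  have hpos : 0 < ‖v j‖ := norm_pos_iff.2 hj
  obtain ⟨n, hn⟩ := pow_unbounded_of_one_lt (ρ j / δ / ‖v j‖) (by linarith : 1 < 1 + ε)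
  rw [div_lt_iff₀ hpos] at hn
  exact absurd (hcauchy n j) (not_le.2 hn)

end Polydisc

/-! ### Existence, uniqueness and continuity of the solution in a polydisc. -/

section FixedPoint

open Topology

variable {S : Set ℂ} {N : ℕ} {c : ℝ} {lam : Fin N → S} {ρ : Fin N → ℝ}

theorem norm_xiSum_le {z : Fin N → ℂ} (hz : z ∈ polydisc ρ) (k : Fin N) :
    ‖xiSum c lam z (lam k)‖ ≤ ∑ m, ρ m * ‖xi c (lam m) (lam k)‖ := by
  refine (norm_sum_le _ _).trans (Finset.sum_le_sum fun m _ => ?_)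
  rw [norm_mul]
  exact mul_le_mul_of_nonneg_right (hz m) (norm_nonneg _)

/-- A left null vector of `M` is fixed by the derivative at `a` of the map whose fixed points solve
the system. -/
theorem det_matM_ne_zero {g : Fin N → ℂ → ℂ} {θ : ℝ}
    (hρ : ∀ k, 0 < ρ k) (hθ : θ < 1)
    (hd : ∀ k, ∀ z ∈ polydisc ρ, DifferentiableAt ℂ (g k) (xiSum c lam z (lam k)))
    (hb : ∀ k, ∀ z ∈ polydisc ρ, ‖g k (xiSum c lam z (lam k))‖ ≤ θ * ρ k)
    {a : Fin N → ℂ} (ha : a ∈ polydisc ρ) (hsol : SolvesSystem c lam g a) :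
    (matM c lam g a).det ≠ 0 := by
  intro hdet
  obtain ⟨v, hv0, hv⟩ := Matrix.exists_vecMul_eq_zero_iff.2 hdet
  have hG : ∀ z ∈ polydisc ρ, HasFDerivAt (fun z j => g j (xiSum c lam z (lam j)))
      (ContinuousLinearMap.pi fun j =>
        deriv (g j) (xiSum c lam z (lam j)) • xiForm c lam (lam j)) z := by
    intro z hz
    refine hasFDerivAt_pi.2 fun j => ?_
    have h1 : HasDerivAt (g j) (deriv (g j) (xiSum c lam z (lam j))) (xiForm c lam (lam j) z) := by
      rw [xiForm_apply]; exact (hd j z hz).hasDerivAt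
    have h2 := h1.comp_hasFDerivAt z (xiForm c lam (lam j)).hasFDerivAt
    refine h2.congr_of_eventuallyEq (Filter.Eventually.of_forall fun w => ?_)
    simp [xiForm_apply]
  refine hv0 (eq_zero_of_fixed_by_fderiv hρ hθ (fun z hz => (hG z hz).differentiableAt)
    (fun z hz k => hb k z hz) ha (funext fun j => (hsol j).symm) (hG a ha) ?_)
  ext j
  have h1 := congrFun hv j
  simp only [Matrix.vecMul, dotProduct, matM_apply (hd j a ha), mul_sub, Finset.sum_sub_distrib,
    Pi.zero_apply, mul_ite, mul_one, mul_zero, Finset.sum_ite_eq', Finset.mem_univ, if_true,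
    sub_eq_zero] at h1
  rw [h1]
  simp only [ContinuousLinearMap.pi_apply, smul_apply, xiForm_apply, xiSum,
    smul_eq_mul, Finset.mul_sum]
  exact Finset.sum_congr rfl fun k _ => by ring

/-- A strict bound on the distinguished boundary is uniform on the polydisc. -/
theorem exists_contraction_factor {f : Fin N → ℂ → ℂ} (hρ : ∀ k, 0 < ρ k)
    (hd : ∀ k, ∀ z ∈ polydisc ρ, DifferentiableAt ℂ (f k) (xiSum c lam z (lam k)))
    (hb : ∀ z : Fin N → ℂ, (∀ k, ‖z k‖ = ρ k) → ∀ j, ‖f j (xiSum c lam z (lam j))‖ < ‖z j‖) :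
    ∃ θ : ℝ, 0 < θ ∧ θ < 1 ∧
      ∀ k, ∀ z ∈ polydisc ρ, ‖f k (xiSum c lam z (lam k))‖ ≤ θ * ρ k := by
  have hdf : ∀ k, ∀ z ∈ polydisc ρ,
      DifferentiableAt ℂ (fun z => f k (xiSum c lam z (lam k))) z := fun k z hz =>
    DifferentiableAt.comp z (hd k z hz) (analyticAt_xiSum c lam (lam k) z).differentiableAt
  -- On the compact torus the strict bound is attained at some point, hence uniform; the maximum
  -- principle spreads it. A common `θ < 1` exists because there are finitely many `k`.
  have hsingle : ∀ k, ∃ C < ρ k, ∀ z ∈ polydisc ρ, ‖f k (xiSum c lam z (lam k))‖ ≤ C := by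
    intro k
    set T : Set (Fin N → ℂ) := {z | ∀ k, ‖z k‖ = ρ k} with hT
    have hTsub : T ⊆ polydisc ρ := fun z hz k => (hz k).le
    have hTc : IsCompact T := (isCompact_polydisc ρ).of_isClosed_subset (by
      simp only [hT, Set.ofPred_forall]
      exact isClosed_iInter fun k => isClosed_eq (by fun_prop) continuous_const) hTsub
    have hTn : T.Nonempty := ⟨fun k => (ρ k : ℂ), fun k => by
      rw [Complex.norm_real, Real.norm_of_nonneg (hρ k).le]⟩
    obtain ⟨w, hw, hmax⟩ := hTc.exists_isMaxOn hTn
      (f := fun z => ‖f k (xiSum c lam z (lam k))‖)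
      fun z hz => (hdf k z (hTsub hz)).continuousAt.norm.continuousWithinAt
    refine ⟨_, (hb w hw k).trans_eq (hw k), norm_le_of_norm_le_on_torus hρ (hdf k) ?_⟩
    exact fun z hz => hmax hz
  choose C hC hCb using hsingle
  have hev : ∀ᶠ θ in 𝓝[<] (1 : ℝ), 0 < θ ∧ θ < 1 ∧ ∀ k, C k ≤ θ * ρ k := by
    have h1 : ∀ k, ∀ᶠ θ in 𝓝[<] (1 : ℝ), C k ≤ θ * ρ k := fun k => by
      have h2 : ∀ᶠ θ in 𝓝 (1 : ℝ), C k < θ * ρ k :=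
        continuousAt_const.eventually_lt (by fun_prop) (by simpa using hC k)
      filter_upwards [nhdsWithin_le_nhds h2] with θ hθ using hθ.le
    filter_upwards [Filter.eventually_all.2 h1, self_mem_nhdsWithin,
      nhdsWithin_le_nhds (lt_mem_nhds (zero_lt_one : (0 : ℝ) < 1))] with θ h2 h3 h4
    exact ⟨h4, h3, h2⟩
  obtain ⟨θ, h0, h1, h2⟩ := hev.exists
  exact ⟨θ, h0, h1, fun k z hz => (hCb k z hz).trans (h2 k)⟩

theorem eventually_not_solvesSystem {f : Fin N → ℂ → ℂ} {α₀ : ℂ} {z₀ : Fin N → ℂ}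
    (hd : ∀ k, ContinuousAt (f k) (xiSum c lam z₀ (lam k)))
    (hsol : ¬ SolvesSystem c lam (fun k w => α₀ * f k w) z₀) :
    ∀ᶠ v : ℂ × (Fin N → ℂ) in 𝓝 (α₀, z₀),
      ¬ SolvesSystem c lam (fun k w => v.1 * f k w) v.2 := by
  obtain ⟨j, hj⟩ := not_forall.1 hsol
  have h1 : ContinuousAt (fun v : ℂ × (Fin N → ℂ) => xiSum c lam v.2 (lam j)) (α₀, z₀) :=
    ContinuousAt.comp (g := fun z : Fin N → ℂ => xiSum c lam z (lam j))
      (analyticAt_xiSum c lam (lam j) z₀).continuousAt continuousAt_snd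
  have h2 : ContinuousAt (fun v : ℂ × (Fin N → ℂ) => f j (xiSum c lam v.2 (lam j))) (α₀, z₀) :=
    ContinuousAt.comp (g := f j) (hd j) h1
  have h3 : ContinuousAt (fun v : ℂ × (Fin N → ℂ) => v.2 j) (α₀, z₀) := by fun_prop
  filter_upwards [(h3.sub (continuousAt_fst.mul h2)).eventually_ne (sub_ne_zero.2 hj)] with v hv hs
  exact hv (sub_eq_zero.2 (hs j))

variable {f : Fin N → ℂ → ℂ} {r : Fin N → ℝ} {θ : ℝ}

/-- The solution of the system in a polydisc is unique as long as the system remains contracting,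
and depends continuously on the coupling constant. -/
theorem exists_unique_branch (hρ : ∀ k, 0 < ρ k) (hθ0 : 0 < θ)
    (hf : ∀ k, DifferentiableOn ℂ (f k) (Metric.ball 0 (r k)))
    (hr : ∀ k, ∀ z ∈ polydisc ρ, ‖xiSum c lam z (lam k)‖ < r k)
    (hb : ∀ k, ∀ z ∈ polydisc ρ, ‖f k (xiSum c lam z (lam k))‖ ≤ θ * ρ k) :
    ∃ z : ℂ → Fin N → ℂ, ContinuousOn z (Metric.ball 0 θ⁻¹) ∧ ∀ α ∈ Metric.ball (0 : ℂ) θ⁻¹,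
      z α ∈ polydisc ρ ∧ SolvesSystem c lam (fun k w => α * f k w) (z α) ∧
      (matM c lam (fun k w => α * f k w) (z α)).det ≠ 0 ∧
      ∀ w ∈ polydisc ρ, SolvesSystem c lam (fun k w => α * f k w) w → w = z α := by
  set U : Set ℂ := Metric.ball 0 θ⁻¹ with hU
  have hUθ : ∀ α ∈ U, ‖α‖ * θ < 1 := by
    intro α hα
    have h1 : ‖α‖ < θ⁻¹ := by simpa [hU] using hα
    calc ‖α‖ * θ < θ⁻¹ * θ := mul_lt_mul_of_pos_right h1 hθ0
      _ = 1 := inv_mul_cancel₀ hθ0.ne'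
  have hd : ∀ k, ∀ z ∈ polydisc ρ, DifferentiableAt ℂ (f k) (xiSum c lam z (lam k)) :=
    fun k z hz => (hf k).differentiableAt (Metric.isOpen_ball.mem_nhds (by simpa using hr k z hz))
  have hbα : ∀ α : ℂ, ∀ k, ∀ z ∈ polydisc ρ,
      ‖α * f k (xiSum c lam z (lam k))‖ ≤ ‖α‖ * θ * ρ k := by
    intro α k z hz
    rw [norm_mul, mul_assoc]
    exact mul_le_mul_of_nonneg_left (hb k z hz) (norm_nonneg _)
  have hdet : ∀ α ∈ U, ∀ z ∈ polydisc ρ, SolvesSystem c lam (fun k w => α * f k w) z →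
      (matM c lam (fun k w => α * f k w) z).det ≠ 0 := fun α hα z hz hs =>
    det_matM_ne_zero hρ (hUθ α hα)
      (fun k w hw => (hd k w hw).const_mul α) (hbα α) hz hs
  have hbranch : ∀ α₀ ∈ U, ∀ z₀ ∈ polydisc ρ, SolvesSystem c lam (fun k w => α₀ * f k w) z₀ →
      ∃ ζ : ℂ → Fin N → ℂ, ContinuousAt ζ α₀ ∧ ζ α₀ = z₀ ∧
        (∀ᶠ α in 𝓝 α₀, ζ α ∈ polydisc ρ ∧ SolvesSystem c lam (fun k w => α * f k w) (ζ α)) ∧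
        ∀ᶠ v : ℂ × (Fin N → ℂ) in 𝓝 (α₀, z₀),
          SolvesSystem c lam (fun k w => v.1 * f k w) v.2 → v.2 = ζ v.1 := by
    intro α₀ hα₀ z₀ hz₀ hs
    obtain ⟨ζ, h1, h2, h3, h4⟩ :=
      exists_implicit_solution hf (fun k => hr k z₀ hz₀) hs (hdet α₀ hα₀ z₀ hz₀ hs)
    refine ⟨ζ, h1.continuousAt, h2, ?_, h4⟩
    -- Contraction places every solution in the interior, so the local branch cannot leave the
    -- polydisc at once.
    have h5 : polydisc ρ ∈ 𝓝 (ζ α₀) := by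
      rw [h2]
      refine polydisc_mem_nhds fun k => ?_
      rw [hs k]
      exact (hbα α₀ k z₀ hz₀).trans_lt (mul_lt_of_lt_one_left (hρ k) (hUθ α₀ hα₀))
    filter_upwards [h1.continuousAt h5, h3] with α h6 h7 using ⟨h6, h7⟩
  -- Continuity method: the set of `α` with exactly one solution contains `0` and is open and
  -- relatively closed in the disc `U`.
  set A : Set ℂ := {α | α ∈ U ∧
    ∃! z, z ∈ polydisc ρ ∧ SolvesSystem c lam (fun k w => α * f k w) z} with hA
  have hlocal : ∀ α₀ ∈ A, ∃ ζ : ℂ → Fin N → ℂ, ContinuousAt ζ α₀ ∧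
      ∀ᶠ α in 𝓝 α₀, ζ α ∈ polydisc ρ ∧ SolvesSystem c lam (fun k w => α * f k w) (ζ α) ∧
        ∀ z ∈ polydisc ρ, SolvesSystem c lam (fun k w => α * f k w) z → z = ζ α := by
    rintro α₀ ⟨hα₀, z₀, ⟨hz₀, hs⟩, huniq⟩
    obtain ⟨ζ, h1, h2, h3, h4⟩ := hbranch α₀ hα₀ z₀ hz₀ hs
    refine ⟨ζ, h1, ?_⟩
    -- Near `z₀` the implicit function theorem gives uniqueness; elsewhere failing to solve the
    -- system is an open condition. Compactness of the polydisc makes this uniform.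
    have h5 : ∀ᶠ α in 𝓝 α₀, ∀ z ∈ polydisc ρ,
        SolvesSystem c lam (fun k w => α * f k w) z → z = ζ α := by
      refine (isCompact_polydisc ρ).eventually_forall_of_forall_eventually fun z hz => ?_
      by_cases hzz : z = z₀
      · rw [hzz]
        exact h4
      · filter_upwards [eventually_not_solvesSystem (fun k => (hd k z hz).continuousAt)
          fun h => hzz (huniq z ⟨hz, h⟩)] with v hv hs' using absurd hs' hv
    filter_upwards [h3, h5] with α h6 h7 using ⟨h6.1, h6.2, h7⟩
  have hUo : IsOpen U := Metric.isOpen_ball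
  have hAo : IsOpen A := by
    refine isOpen_iff_mem_nhds.2 fun α₀ hα₀ => ?_
    obtain ⟨ζ, -, h2⟩ := hlocal α₀ hα₀
    filter_upwards [h2, hUo.mem_nhds hα₀.1] with α h3 h4
    exact ⟨h4, ζ α, ⟨h3.1, h3.2.1⟩, fun z hz => h3.2.2 z hz.1 hz.2⟩
  have h0U : (0 : ℂ) ∈ U := Metric.mem_ball_self (inv_pos.2 hθ0)
  have h0A : (0 : ℂ) ∈ A := by
    refine ⟨h0U, 0, ⟨zero_mem_polydisc hρ, fun j => by simp⟩, fun z hz => ?_⟩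
    ext j
    simpa using hz.2 j
  have hUA : U ⊆ A := by
    refine (convex_ball (0 : ℂ) θ⁻¹).isPreconnected.subset_of_closure_inter_subset hAo
      ⟨0, h0U, h0A⟩ ?_
    rintro α₀ ⟨hcl, hα₀⟩
    have hfreq : ∃ᶠ α in 𝓝 α₀, α ∈ A := mem_closure_iff_frequently.1 hcl
    -- If no point solved the system at the limit `α₀`, compactness would exclude solutions at
    -- nearby `α` as well.
    have hex : ∃ z₀ ∈ polydisc ρ, SolvesSystem c lam (fun k w => α₀ * f k w) z₀ := by
      by_contra! hno
      have h1 : ∀ᶠ α in 𝓝 α₀, ∀ z ∈ polydisc ρ,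
          ¬ SolvesSystem c lam (fun k w => α * f k w) z :=
        (isCompact_polydisc ρ).eventually_forall_of_forall_eventually fun z hz =>
          eventually_not_solvesSystem (fun k => (hd k z hz).continuousAt) (hno z hz)
      obtain ⟨α, ⟨-, z, hz, -⟩, h3⟩ := (hfreq.and_eventually h1).exists
      exact h3 z hz.1 hz.2
    obtain ⟨z₀, hz₀, hs₀⟩ := hex
    refine ⟨hα₀, z₀, ⟨hz₀, hs₀⟩, fun z₁ ⟨hz₁, hs₁⟩ => ?_⟩
    -- Two solutions at `α₀` would extend to two distinct ones at nearby parameters of `A`.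
    by_contra hne
    obtain ⟨ζ₀, h1, h2, h3, -⟩ := hbranch α₀ hα₀ z₀ hz₀ hs₀
    obtain ⟨ζ₁, h5, h6, h7, -⟩ := hbranch α₀ hα₀ z₁ hz₁ hs₁
    have h8 : ∀ᶠ α in 𝓝 α₀, (ζ₁ - ζ₀) α ≠ 0 :=
      (h5.sub h1).eventually_ne (by simpa [h6, h2, sub_eq_zero] using hne)
    obtain ⟨α, hα, h9, h10, h11⟩ := (hfreq.and_eventually (h3.and (h7.and h8))).exists
    exact h11 (sub_eq_zero.2 (hα.2.unique h10 h9))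
  choose! z hz huniq using fun α (hα : α ∈ U) => (hUA hα).2
  have huniq' : ∀ α ∈ U, ∀ w ∈ polydisc ρ,
      SolvesSystem c lam (fun k w => α * f k w) w → w = z α := fun α hα w h1 h2 =>
    huniq α hα w ⟨h1, h2⟩
  refine ⟨z, fun α₀ hα₀ => ?_, fun α hα =>
    ⟨(hz α hα).1, (hz α hα).2, hdet α hα _ (hz α hα).1 (hz α hα).2, huniq' α hα⟩⟩
  obtain ⟨ζ, h1, h2⟩ := hlocal α₀ (hUA hα₀)
  have h3 : z =ᶠ[𝓝 α₀] ζ := by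
    filter_upwards [h2, hUo.mem_nhds hα₀] with α h4 h5
    exact h4.2.2 _ (hz α h5).1 (hz α h5).2
  exact (h1.congr_of_eventuallyEq h3).continuousWithinAt

end FixedPoint

/-! ### The formula on a polydisc. -/

section MeanValue

open TopologicalSpace Topology

variable {S : Set ℂ} {N : ℕ} {c : ℝ} {lam : Fin N → S} {ρ : Fin N → ℝ}

/-- The mean value on a polydisc on which the geometric series converge. -/
theorem mean_value_on_polydisc {f : Fin N → ℂ → ℂ} {r : Fin N → ℝ}
    (hf : ∀ k, DifferentiableOn ℂ (f k) (Metric.ball 0 (r k)))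
    {F : (S → ℂ) → (S → ℂ) → ℂ} {D : Set (Fin N → ℂ)} (hDo : IsOpen D) (hDb : Balanced ℂ D)
    (hF : AnalyticOnNhd ℂ (fun z : Fin N → ℂ => F (xiSum c lam z) (xiTSum c lam z)) D)
    (hρ : ∀ k, 0 < ρ k) (hξ : ∀ k, ∑ m, ρ m * ‖xi c (lam m) (lam k)‖ < r k)
    (hD : polydisc ρ ⊆ D)
    (hb : ∀ z : Fin N → ℂ, (∀ k, ‖z k‖ = ρ k) → ∀ j, ‖f j (xiSum c lam z (lam j))‖ < ‖z j‖) :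
    ∃ z₀ : Fin N → ℂ,
      (∀ k, ‖z₀ k‖ < ρ k) ∧ SolvesSystem c lam f z₀ ∧
      (∀ z ∈ polydisc ρ, SolvesSystem c lam f z → z = z₀) ∧
      (matM c lam f z₀).det ≠ 0 ∧
      Summable (expTerm (fieldExponent c lam f) (functionalKet F)) ∧
      Summable (expTerm (numberExponent c lam z₀) (functionalKet F)) ∧
      expMean (fieldExponent c lam f) (functionalKet F) =
        expMean (numberExponent c lam z₀) (functionalKet F) / (matM c lam f z₀).det := by
  have hr : ∀ k, ∀ z ∈ polydisc ρ, ‖xiSum c lam z (lam k)‖ < r k := fun k z hz =>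
    (norm_xiSum_le hz k).trans_lt (hξ k)
  have hd : ∀ k, ∀ z ∈ polydisc ρ, DifferentiableAt ℂ (f k) (xiSum c lam z (lam k)) :=
    fun k z hz => (hf k).differentiableAt (Metric.isOpen_ball.mem_nhds (by simpa using hr k z hz))
  obtain ⟨θ, hθ0, hθ, hbθ⟩ := exists_contraction_factor hρ hd hb
  obtain ⟨z, hzc, hz⟩ := exists_unique_branch hρ hθ0 hf hr hbθ
  have hone : (fun k w => (1 : ℂ) * f k w) = f := by simp
  have h1U : (1 : ℂ) ∈ Metric.ball (0 : ℂ) θ⁻¹ := by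
    simpa using (one_lt_inv₀ hθ0).2 hθ
  have h0U : (0 : ℂ) ∈ Metric.ball (0 : ℂ) θ⁻¹ := Metric.mem_ball_self (inv_pos.2 hθ0)
  have hz0 : z 0 = 0 := by
    ext j
    simpa using (hz 0 h0U).2.1 j
  obtain ⟨A, -, -, hA, hAform⟩ := continuation hf hDo hDb hF Metric.isOpen_ball h0U hzc hz0
    fun α hα => ⟨hD (hz α hα).1, fun k => hr k _ (hz α hα).1, (hz α hα).2.1, (hz α hα).2.2.1⟩
  obtain ⟨h1, h2, h3, h4⟩ := hz 1 h1U
  obtain ⟨h5, h6⟩ := hAform 1 h1U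
  have h7 := hA 1 ((convex_ball (0 : ℂ) θ⁻¹).segment_subset h0U h1U)
  rw [hone] at h2 h3 h4 h6 h7
  -- Convergence at `α = 1` comes from the geometric domination by `θ^m`, independently of the
  -- continuation; it is what the segment statement requires.
  have hsum : Summable (expTerm (fieldExponent c lam f) (functionalKet F)) := by
    set Ω : Opens (Fin N → ℂ) := ⟨D ∩ {z | ∀ k, ‖xiSum c lam z (lam k)‖ < r k}, by
      refine hDo.inter ?_
      simp only [Set.ofPred_forall]
      refine isOpen_iInter_of_finite fun k => isOpen_lt ?_ continuous_const
      simp only [← xiForm_apply]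
      fun_prop⟩ with hΩdef
    have hΩ : ∀ k, ∀ z ∈ Ω, ‖xiSum c lam z (lam k)‖ < r k := fun k z hz => hz.2 k
    have hcon : Contracting (fun k => compXi c lam k (hf k) (hΩ k)) ρ θ :=
      ⟨hρ, fun z hz => ⟨hD hz, fun k => hr k z hz⟩, hθ0.le, hθ, fun k z hz => by
        rw [evalAt_compXi]
        exact hbθ k z hz⟩
    exact (hasSum_expTerm_fieldExponent hΩ hf (hF.mono fun z hz => hz.1) hcon).summable
  refine ⟨z 1, fun k => ?_, h2, h4, h3, hsum, h5, (h7 hsum).trans h6⟩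
  rw [h2 k]
  exact (hbθ k _ h1).trans_lt (mul_lt_of_lt_one_left (hρ k) hθ)

end MeanValue

end DualFields

end

theorem mainTheorem2 (c : ℝ) (hc : 0 < c)
    -- the spectral parameters on which the fields live; the kernels have no poles there
    (S : Set ℂ) (hS : ∀ l ∈ S, ∀ m ∈ S, l - m ≠ Complex.I * c)
    (N : ℕ) (lam : Fin N → S)
    -- `f k` is holomorphic in the disc of radius `r k`
    (f : Fin N → ℂ → ℂ) (r : Fin N → ℝ)
    (hf : ∀ k, DifferentiableOn ℂ (f k) (Metric.ball 0 (r k)))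
    -- the functional `F`, holomorphic along the configurations generated by the `λ k`
    (F : (S → ℂ) → (S → ℂ) → ℂ) (D : Set (Fin N → ℂ)) (hDo : IsOpen D) (hDb : Balanced ℂ D)
    (hF : AnalyticOnNhd ℂ
      (fun z : Fin N → ℂ => F (DualFields.xiSum c lam z) (DualFields.xiTSum c lam z)) D) :
    -- the formula on a polydisc on which the geometric series converge
    (∀ ρ : Fin N → ℝ, (∀ k, 0 < ρ k) →
      (∀ k, ∑ m, ρ m * ‖DualFields.xi c (lam m) (lam k)‖ < r k) →
      {z : Fin N → ℂ | ∀ k, ‖z k‖ ≤ ρ k} ⊆ D →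
      (∀ z : Fin N → ℂ, (∀ k, ‖z k‖ = ρ k) →
        ∀ j, ‖f j (DualFields.xiSum c lam z (lam j))‖ < ‖z j‖) →
      ∃ z₀ : Fin N → ℂ,
        (∀ k, ‖z₀ k‖ < ρ k) ∧ DualFields.SolvesSystem c lam f z₀ ∧
        (∀ z : Fin N → ℂ, (∀ k, ‖z k‖ ≤ ρ k) → DualFields.SolvesSystem c lam f z → z = z₀) ∧
        (DualFields.matM c lam f z₀).det ≠ 0 ∧
        Summable (DualFields.expTerm (DualFields.fieldExponent c lam f)
          (DualFields.functionalKet F)) ∧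
        Summable (DualFields.expTerm (DualFields.numberExponent c lam z₀)
          (DualFields.functionalKet F)) ∧
        DualFields.expMean (DualFields.fieldExponent c lam f) (DualFields.functionalKet F) =
          DualFields.expMean (DualFields.numberExponent c lam z₀) (DualFields.functionalKet F) /
            (DualFields.matM c lam f z₀).det) ∧
    -- analytic continuation in `α` after the replacement `f k → α f k`, along the solution that
    -- vanishes at `α = 0`
    (∀ (U : Set ℂ) (z : ℂ → Fin N → ℂ), IsOpen U → IsPreconnected U → (0 : ℂ) ∈ U →
      ContinuousOn z U → z 0 = 0 →
      (∀ α ∈ U, z α ∈ D ∧ (∀ k, ‖DualFields.xiSum c lam (z α) (lam k)‖ < r k) ∧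
        DualFields.SolvesSystem c lam (fun k w => α * f k w) (z α) ∧
        (DualFields.matM c lam (fun k w => α * f k w) (z α)).det ≠ 0) →
      ∃ A : ℂ → ℂ, AnalyticOnNhd ℂ A U ∧
        -- near `0`, `A` is the mean value
        (∀ᶠ α in nhds (0 : ℂ),
          HasSum (DualFields.expTerm (DualFields.fieldExponent c lam (fun k w => α * f k w))
            (DualFields.functionalKet F)) (A α)) ∧
        -- so it is wherever the series converges on a segment from `0` inside `U`
        (∀ α : ℂ, segment ℝ 0 α ⊆ U →
          Summable (DualFields.expTerm (DualFields.fieldExponent c lam (fun k w => α * f k w))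
            (DualFields.functionalKet F)) →
          DualFields.expMean (DualFields.fieldExponent c lam (fun k w => α * f k w))
            (DualFields.functionalKet F) = A α) ∧
        ∀ α ∈ U,
          Summable (DualFields.expTerm (DualFields.numberExponent c lam (z α))
            (DualFields.functionalKet F)) ∧
          A α =
            DualFields.expMean (DualFields.numberExponent c lam (z α))
              (DualFields.functionalKet F) /
              (DualFields.matM c lam (fun k w => α * f k w) (z α)).det) := by
  refine ⟨fun ρ hρ hξ hD hb => ?_, fun U z hU _ h0U hzc hz0 hz => ?_⟩
  · exact DualFields.mean_value_on_polydisc hf hDo hDb hF hρ hξ hD hb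
  · exact DualFields.continuation hf hDo hDb hF hU h0U hzc hz0 hz
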